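/- Let $b\in(0,3)$ and write $Gf=\tfrac12 e^{-|\cdot|}*f=(1-\partial_x^2)^{-1}f$ on $\mathbb R$. Let $u\in C([0,\infty):H^2(\mathbb R))$ be a (real-valued) global solution of the $b$-family equation $$\partial_t u+\partial_x\Big(\tfrac12u^2+G\big(\tfrac b2u^2+\tfrac{3-b}2(\partial_xu)^2\big)\Big)=0$$ in the sense of distributions on $(0,\infty)\times\mathbb R$. Put $m(t)=u(t)-\partial_x^2u(t)\in L^2(\mathbb R)$ and $m_0=m(0)$, and suppose that $m_0\ge 0$ almost everywhere and $m_0\in L^1(\mathbb R)$. For $t>1$ let $$\Lambda_{1/2}(t)=\Big(-\frac{t^{1/2}}{\log t},\ \frac{t^{1/2}}{\log t}\Big).$$ Then there exists $L\in\mathbb R$ such that $$\lim_{t\to\infty}\|m(t)\|_{L^1(\Lambda_{1/2}(t))}=\lim_{t\to\infty}\|u(t)\|_{L^1(\Lambda_{1/2}(t))}=L .$$ -/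

import Mathlib

open MeasureTheory Set Filter Topology
open scoped ContDiff

noncomputable section

/-- `g` is the weak (distributional) derivative of `f` on the real line. It is applied below to
square integrable functions, for which both integrals converge. -/
def HasWeakDeriv (f g : ℝ → ℝ) : Prop :=
  ∀ χ : ℝ → ℝ, ContDiff ℝ ∞ χ → HasCompactSupport χ →
    ∫ x, f x * deriv χ x = -∫ x, g x * χ x

/-- A square integrable function times a continuous compactly supported one is integrable. -/
theorem integrable_mul_of_hasCompactSupport (f : Lp ℝ 2 (volume : Measure ℝ)) {χ : ℝ → ℝ}
    (hc : Continuous χ) (hs : HasCompactSupport χ) : Integrable (fun x => f x * χ x) :=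
  (Lp.memLp f).integrable_mul (hc.memLp_of_hasCompactSupport (p := 2) hs)

theorem integrable_mul_deriv_of_hasCompactSupport (f : Lp ℝ 2 (volume : Measure ℝ)) {χ : ℝ → ℝ}
    (hc : ContDiff ℝ ∞ χ) (hs : HasCompactSupport χ) :
    Integrable (fun x => f x * deriv χ x) :=
  integrable_mul_of_hasCompactSupport f (hc.continuous_deriv (by simp)) hs.deriv

/-- The Sobolev space `H²(ℝ)`: triples `(u, ∂ₓu, ∂ₓ²u)` of elements of `L²(ℝ)`, each entry being
the weak derivative of the preceding one. The norm inherited from the `ℓ²`-product is the usual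
one, `‖u‖² = ‖u‖²_{L²} + ‖∂ₓu‖²_{L²} + ‖∂ₓ²u‖²_{L²}`. -/
def SobolevH2 : Submodule ℝ (PiLp 2 (fun _ : Fin 3 => Lp ℝ 2 (volume : Measure ℝ))) where
  carrier := {U | HasWeakDeriv (U 0) (U 1) ∧ HasWeakDeriv (U 1) (U 2)}
  add_mem' := by
    have key : ∀ f f' g g' : Lp ℝ 2 (volume : Measure ℝ), HasWeakDeriv f g → HasWeakDeriv f' g' →
        HasWeakDeriv (f + f' : Lp ℝ 2 (volume : Measure ℝ))
          (g + g' : Lp ℝ 2 (volume : Measure ℝ)) := by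
      intro f f' g g' h h' χ hc hs
      have e1 : ∫ x, (f + f' : Lp ℝ 2 (volume : Measure ℝ)) x * deriv χ x
          = ∫ x, (f x * deriv χ x + f' x * deriv χ x) := by
        refine integral_congr_ae ?_
        filter_upwards [Lp.coeFn_add f f'] with x hx
        rw [hx, Pi.add_apply, add_mul]
      have e2 : ∫ x, (g + g' : Lp ℝ 2 (volume : Measure ℝ)) x * χ x
          = ∫ x, (g x * χ x + g' x * χ x) := by
        refine integral_congr_ae ?_
        filter_upwards [Lp.coeFn_add g g'] with x hx
        rw [hx, Pi.add_apply, add_mul]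
      rw [e1, e2, integral_add (integrable_mul_deriv_of_hasCompactSupport f hc hs)
        (integrable_mul_deriv_of_hasCompactSupport f' hc hs),
        integral_add (integrable_mul_of_hasCompactSupport g hc.continuous hs)
        (integrable_mul_of_hasCompactSupport g' hc.continuous hs), h χ hc hs, h' χ hc hs]
      ring
    rintro U V ⟨h0, h1⟩ ⟨k0, k1⟩
    exact ⟨key _ _ _ _ h0 k0, key _ _ _ _ h1 k1⟩
  zero_mem' := by
    have key : HasWeakDeriv (0 : Lp ℝ 2 (volume : Measure ℝ)) (0 : Lp ℝ 2 (volume : Measure ℝ)) := by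
      intro χ _ _
      have e : ∀ ξ : ℝ → ℝ, ∫ x, (0 : Lp ℝ 2 (volume : Measure ℝ)) x * ξ x = 0 := by
        intro ξ
        refine integral_eq_zero_of_ae ?_
        filter_upwards [Lp.coeFn_zero ℝ 2 (volume : Measure ℝ)] with x hx
        rw [hx, Pi.zero_apply, zero_mul]
      rw [e, e, neg_zero]
    exact ⟨key, key⟩
  smul_mem' := by
    have key : ∀ (c : ℝ) (f g : Lp ℝ 2 (volume : Measure ℝ)), HasWeakDeriv f g →
        HasWeakDeriv (c • f : Lp ℝ 2 (volume : Measure ℝ))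
          (c • g : Lp ℝ 2 (volume : Measure ℝ)) := by
      intro c f g h χ hc hs
      have e : ∀ (k : Lp ℝ 2 (volume : Measure ℝ)) (ξ : ℝ → ℝ),
          ∫ x, (c • k : Lp ℝ 2 (volume : Measure ℝ)) x * ξ x = c * ∫ x, k x * ξ x := by
        intro k ξ
        rw [← integral_const_mul]
        refine integral_congr_ae ?_
        filter_upwards [Lp.coeFn_smul c k] with x hx
        rw [hx, Pi.smul_apply, smul_eq_mul, mul_assoc]
      rw [e, e, h χ hc hs]
      ring
    rintro c U ⟨h0, h1⟩
    exact ⟨key c _ _ h0, key c _ _ h1⟩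

namespace SobolevH2

/-- The function itself, as an element of `L²(ℝ)`. -/
def fn (u : SobolevH2) : Lp ℝ 2 (volume : Measure ℝ) := u.1 0

/-- The first weak derivative `∂ₓu`. -/
def dx (u : SobolevH2) : Lp ℝ 2 (volume : Measure ℝ) := u.1 1

/-- The second weak derivative `∂ₓ²u`. -/
def dxx (u : SobolevH2) : Lp ℝ 2 (volume : Measure ℝ) := u.1 2

/-- The momentum `m = u - ∂ₓ²u`. -/
def momentum (u : SobolevH2) : Lp ℝ 2 (volume : Measure ℝ) := fn u - dxx u

end SobolevH2

/-- The operator `G = (1 - ∂ₓ²)⁻¹`, that is, convolution with `½ e^{-|x|}`. -/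
def greenOp (f : ℝ → ℝ) (x : ℝ) : ℝ := ∫ y, (1 / 2) * Real.exp (-|x - y|) * f y

/-- The flux `½ u² + G(b/2 u² + (3-b)/2 (∂ₓu)²)` of the `b`-family. -/
def bFlux (b : ℝ) (u : SobolevH2) (x : ℝ) : ℝ :=
  (1 / 2) * (SobolevH2.fn u x) ^ 2
    + greenOp (fun y => b / 2 * (SobolevH2.fn u y) ^ 2 + (3 - b) / 2 * (SobolevH2.dx u y) ^ 2) x

/-- `u ∈ C([0,∞) : H²(ℝ))` is a global solution of
`∂ₜu + ∂ₓ(½ u² + G(b/2 u² + (3-b)/2 (∂ₓu)²)) = 0`, in the sense of distributions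
on `(0,∞) × ℝ`. Values of `u` at negative times are irrelevant. -/
structure IsGlobalSolution (b : ℝ) (u : ℝ → SobolevH2) : Prop where
  continuousOn : ContinuousOn u (Ici 0)
  equation : ∀ φ : ℝ × ℝ → ℝ, ContDiff ℝ ∞ φ → HasCompactSupport φ →
    tsupport φ ⊆ Ioi (0 : ℝ) ×ˢ (univ : Set ℝ) →
      ∫ t in Ioi (0 : ℝ), ∫ x : ℝ,
        (SobolevH2.fn (u t) x * deriv (fun s => φ (s, x)) t
          + bFlux b (u t) x * deriv (fun y => φ (t, y)) x) = 0

/-- The interval `Λ_c(t) = (-|t|^c / log |t|, |t|^c / log |t|)`. -/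
def Lam (c t : ℝ) : Set ℝ :=
  Ioo (-(|t| ^ c / Real.log |t|)) (|t| ^ c / Real.log |t|)

/-- The norm of `L¹(A)`. -/
def L1NormOn (A : Set ℝ) (f : ℝ → ℝ) : ℝ := ∫ x in A, |f x|

end

/-! The limit is zero: the local mass disappears. Write the equation as uₜ + Fₓ = 0 with F the flux
`bFlux`. For 0 < b < 3 the density under `G` is nonnegative, so F ≥ u²/2 ≥ 0 and mass moves only to
the right. Suppose that [-r, r] carries mass μ at time T. At every earlier time the half-line left
of 2r already carried at least μ, while the mass left of -2r never exceeds the initial mass e of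
(-∞, -r]. So [-2r, 2r] carries at least μ - e throughout [0, T], and, if μ > e, Cauchy–Schwarz
bounds the flux there below by (μ - e)²/(8r). The virial functional ∫ u(x) `ramp`(x/r) dx then
decreases at rate at least (μ - e)²/(8r²), yet it is bounded by a multiple of the total mass. Hence
μ ≤ e + A r/√T, which is `exists_setIntegral_fn_le`. For r of order √T/log T, e is a tail of an
integrable function and r/√T is of order 1/log T, so both terms vanish. Testing m = u - uₓₓ against
a dilated cutoff carries the decay over to m (`exists_setIntegral_momentum_le`).

This uses u ≥ 0 and u(t) ∈ L¹, hence the persistence of m ≥ 0 (`momentum_nonneg`). The momentum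
solves the transport equation mₜ + (um)ₓ + (b-1)uₓm = 0, but lies only in L², so it is mollified.
The commutator of mollification and transport tends to zero in L² (`l2norm_commutator_le`), because
uₓ is Hölder continuous of exponent 1/2 and translations are continuous in L². Grönwall's inequality
for the squared negative part of the mollified momentum (`integral_min_zero_sq_le`) then gives the
sign in the limit. Positivity of (1 - ∂ₓ²)⁻¹ yields u ≥ 0 (`rep_nonneg`), and dilated cutoffs yield
integrability. -/

/-! ### Primitives, the du Bois-Reymond lemma and weak derivatives -/

/-- `F` is a primitive of the locally integrable function `f`. -/
structure IsPrimitive (F f : ℝ → ℝ) : Prop where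
  locallyIntegrable : LocallyIntegrable f
  sub_eq : ∀ a b, F b - F a = ∫ x in a..b, f x

namespace IsPrimitive

variable {F G f g : ℝ → ℝ}

theorem intervalIntegrable (h : IsPrimitive F f) (a b : ℝ) :
    IntervalIntegrable f volume a b :=
  intervalIntegrable_iff.mpr <|
    (h.locallyIntegrable.integrableOn_isCompact isCompact_uIcc).mono_set uIoc_subset_uIcc

theorem eq_add (h : IsPrimitive F f) (a : ℝ) : F = fun x => F a + ∫ t in a..x, f t := by
  funext x
  linarith [h.sub_eq a x]

theorem absolutelyContinuousOnInterval (h : IsPrimitive F f) (a b : ℝ) :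
    AbsolutelyContinuousOnInterval F a b := by
  have h1 := (h.intervalIntegrable a b).absolutelyContinuousOnInterval_intervalIntegral
    (c := a) (by simp)
  have h2 : AbsolutelyContinuousOnInterval (fun _ : ℝ => F a) a b :=
    (contDiff_const.contDiffOn (n := 1)).absolutelyContinuousOnInterval
  rw [h.eq_add a]
  exact h2.add h1

theorem ae_hasDerivAt (h : IsPrimitive F f) : ∀ᵐ x, HasDerivAt F (f x) x := by
  filter_upwards [_root_.LocallyIntegrable.ae_hasDerivAt_integral h.locallyIntegrable] with x hx
  rw [h.eq_add 0]
  exact (hx 0).const_add _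

theorem continuous (h : IsPrimitive F f) : Continuous F := by
  rw [continuous_iff_continuousAt]
  intro x
  have := (h.absolutelyContinuousOnInterval (x - 1) (x + 1)).continuousOn
  rw [uIcc_of_le (by linarith)] at this
  exact this.continuousAt (Icc_mem_nhds (by linarith) (by linarith))

/-- Both factors are absolutely continuous on every interval, so the product rule holds in
integrated form. The integrations by parts with merely locally integrable derivatives rest on this.
-/
theorem mul (hF : IsPrimitive F f) (hG : IsPrimitive G g) :
    IsPrimitive (fun x => F x * G x) (fun x => f x * G x + F x * g x) where
  locallyIntegrable :=
    (hF.locallyIntegrable.mul_continuous hG.continuous).add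
      (hG.locallyIntegrable.continuous_mul hF.continuous)
  sub_eq a b := by
    rw [← AbsolutelyContinuousOnInterval.integral_deriv_mul_eq_sub
      (hF.absolutelyContinuousOnInterval a b) (hG.absolutelyContinuousOnInterval a b)]
    refine intervalIntegral.integral_congr_ae ?_
    filter_upwards [hF.ae_hasDerivAt, hG.ae_hasDerivAt] with x h1 h2 _
    rw [h1.deriv, h2.deriv]

theorem of_contDiff {χ : ℝ → ℝ} (h : ContDiff ℝ 1 χ) : IsPrimitive χ (deriv χ) where
  locallyIntegrable := (h.continuous_deriv (by simp)).locallyIntegrable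
  sub_eq a b := by
    rw [intervalIntegral.integral_deriv_eq_sub
      (fun x _ => (h.differentiable (by simp)).differentiableAt)
      ((h.continuous_deriv (by simp)).intervalIntegrable _ _)]

theorem of_integral (hf : LocallyIntegrable f) (a : ℝ) :
    IsPrimitive (fun x => ∫ t in a..x, f t) f where
  locallyIntegrable := hf
  sub_eq c d := by
    have hi : ∀ a b, IntervalIntegrable f volume a b := fun _ _ =>
      intervalIntegrable_iff.mpr <|
        (hf.integrableOn_isCompact isCompact_uIcc).mono_set uIoc_subset_uIcc
    rw [intervalIntegral.integral_interval_sub_left (hi _ _) (hi _ _)]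

theorem hasDerivAt (h : IsPrimitive F f) (hf : Continuous f) (x : ℝ) : HasDerivAt F (f x) x := by
  rw [h.eq_add 0]
  exact (intervalIntegral.integral_hasDerivAt_right (hf.intervalIntegrable _ _)
    (hf.stronglyMeasurableAtFilter _ _) hf.continuousAt).const_add _

theorem congr_right (h : IsPrimitive F f) (hfg : f =ᵐ[volume] g) : IsPrimitive F g where
  locallyIntegrable := by
    refine h.locallyIntegrable.congr hfg
  sub_eq a b := by
    rw [h.sub_eq, intervalIntegral.integral_congr_ae]
    filter_upwards [hfg] with x hx _ using hx

theorem integral_eq_zero (h : IsPrimitive F f) (hF : HasCompactSupport F)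
    (hf : HasCompactSupport f) : ∫ x, f x = 0 := by
  obtain ⟨R, hR⟩ := (hF.isCompact.union hf.isCompact).isBounded.subset_closedBall 0
  have hout : ∀ x, R < |x| → F x = 0 ∧ f x = 0 := by
    intro x hx
    have : x ∉ tsupport F ∪ tsupport f := fun hm => by
      have := hR hm
      rw [Metric.mem_closedBall, Real.dist_0_eq_abs] at this
      linarith
    rw [mem_union, not_or] at this
    exact ⟨image_eq_zero_of_notMem_tsupport this.1, image_eq_zero_of_notMem_tsupport this.2⟩
  have key := h.sub_eq (-(|R| + 1)) (|R| + 1)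
  have hR1 := le_abs_self R
  have h0 := abs_nonneg R
  have e : |(|R| + 1)| = |R| + 1 := abs_of_nonneg (by linarith)
  rw [(hout (|R| + 1) (by rw [e]; linarith)).1,
    (hout (-(|R| + 1)) (by rw [abs_neg, e]; linarith)).1,
    intervalIntegral.integral_eq_integral_of_support_subset] at key
  · linarith
  · intro x hx
    by_contra hn
    refine hx (hout x ?_).2
    simp only [mem_Ioc, not_and_or, not_lt, not_le] at hn
    rcases hn with hn | hn
    · rw [abs_of_nonpos (by linarith)]; linarith
    · rw [abs_of_nonneg (by linarith)]; linarith

theorem integral_mul_deriv (h : IsPrimitive F f) {χ : ℝ → ℝ} (hχ : ContDiff ℝ 1 χ)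
    (hs : HasCompactSupport χ) : ∫ x, F x * deriv χ x = -∫ x, f x * χ x := by
  have h1 : Integrable (fun x => f x * χ x) := by
    simpa [mul_comm] using h.locallyIntegrable.integrable_smul_left_of_hasCompactSupport
      hχ.continuous hs
  have h2 : Integrable (fun x => F x * deriv χ x) :=
    (h.continuous.mul (hχ.continuous_deriv (by simp))).integrable_of_hasCompactSupport
      hs.deriv.mul_left
  have := (h.mul (of_contDiff hχ)).integral_eq_zero hs.mul_left
    (hs.mul_left.add hs.deriv.mul_left)
  rw [integral_add h1 h2] at this
  linarith

end IsPrimitive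

/-- The lemma of du Bois-Reymond on an open interval. -/
theorem ae_eq_const_of_integral_mul_deriv_eq_zero {S : Set ℝ} (hS : IsOpen S) (hc : S.OrdConnected)
    (hne : S.Nonempty) {h : ℝ → ℝ} (hh : LocallyIntegrableOn h S)
    (H : ∀ θ : ℝ → ℝ, ContDiff ℝ ∞ θ → HasCompactSupport θ → tsupport θ ⊆ S →
      ∫ x, h x * deriv θ x = 0) :
    ∃ c : ℝ, ∀ᵐ x, x ∈ S → h x = c := by
  have hint : ∀ χ : ℝ → ℝ, Continuous χ → HasCompactSupport χ → tsupport χ ⊆ S →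
      Integrable (fun x => h x * χ x) := by
    intro χ hχ hs hsub
    have h1 : IntegrableOn h (tsupport χ) := hh.integrableOn_compact_subset hsub hs
    have h2 : IntegrableOn (fun x => h x * χ x) (tsupport χ) :=
      h1.mul_continuousOn hχ.continuousOn hs
    refine (integrableOn_iff_integrable_of_support_subset ?_).1 h2
    exact (Function.support_mul_subset_right _ _).trans (subset_tsupport χ)
  obtain ⟨p, hp⟩ := hne
  obtain ⟨r, hr, hball⟩ := Metric.isOpen_iff.1 hS p hp
  let η0 : ContDiffBump p := ⟨r / 4, r / 2, by positivity, by linarith⟩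
  let η : ℝ → ℝ := η0.normed volume
  have hη : ContDiff ℝ ∞ η := η0.contDiff_normed
  have hηs : HasCompactSupport η := η0.hasCompactSupport_normed
  have hη1 : ∫ x, η x = 1 := η0.integral_normed
  have hηS : tsupport η ⊆ S := by
    refine Subset.trans ?_ hball
    rw [show tsupport η = Metric.closedBall p (r / 2) from η0.tsupport_normed_eq]
    exact Metric.closedBall_subset_ball (by linarith)
  refine ⟨∫ x, h x * η x, ?_⟩
  set c := ∫ x, h x * η x with hcdef
  have key : ∀ᵐ x, x ∈ S → h x - c = 0 := by
    refine hS.ae_eq_zero_of_integral_contDiff_smul_eq_zero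
      (hh.sub ((locallyIntegrable_const c).locallyIntegrableOn S)) ?_
    intro χ hχ hs hsub
    let I := ∫ x, χ x
    -- Subtracting (∫ χ) η makes the integral of ψ vanish, so its primitive θ has compact support
    -- and can be used as a test function with derivative ψ.
    let ψ : ℝ → ℝ := fun x => χ x - I * η x
    have hψ : ContDiff ℝ ∞ ψ := hχ.sub (contDiff_const.mul hη)
    have hχi : Integrable χ := hχ.continuous.integrable_of_hasCompactSupport hs
    have hηi : Integrable η := hη.continuous.integrable_of_hasCompactSupport hηs
    have hψi : Integrable ψ := hχi.sub (hηi.const_mul I)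
    have hψ0 : ∫ x, ψ x = 0 := by
      simp only [ψ]
      rw [integral_sub hχi (hηi.const_mul I), integral_const_mul, hη1]
      simp [I]
    let K := tsupport χ ∪ tsupport η
    have hK : IsCompact K := hs.isCompact.union hηs.isCompact
    have hKS : K ⊆ S := union_subset hsub hηS
    have hKne : K.Nonempty := ⟨p, Or.inr (by
      rw [show tsupport η = Metric.closedBall p (r / 2) from η0.tsupport_normed_eq]
      exact Metric.mem_closedBall_self (by linarith))⟩
    have hψK : ∀ x, x ∉ K → ψ x = 0 := by
      intro x hx
      rw [mem_union, not_or] at hx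
      simp [ψ, image_eq_zero_of_notMem_tsupport hx.1, image_eq_zero_of_notMem_tsupport hx.2]
    let a := sInf K
    let b := sSup K
    have haK : a ∈ K := hK.sInf_mem hKne
    have hbK : b ∈ K := hK.sSup_mem hKne
    have hab : ∀ x ∈ K, a ≤ x ∧ x ≤ b := fun x hx =>
      ⟨csInf_le hK.bddBelow hx, le_csSup hK.bddAbove hx⟩
    let θ : ℝ → ℝ := fun x => ∫ t in a..x, ψ t
    have hP : IsPrimitive θ ψ := IsPrimitive.of_integral hψ.continuous.locallyIntegrable a
    have hd : ∀ x, HasDerivAt θ (ψ x) x := hP.hasDerivAt hψ.continuous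
    have hderiv : deriv θ = ψ := funext fun x => (hd x).deriv
    have hθ : ContDiff ℝ ∞ θ := by
      rw [contDiff_infty_iff_deriv, hderiv]
      exact ⟨fun x => (hd x).differentiableAt, hψ⟩
    have hθl : ∀ x, x < a → θ x = 0 := by
      intro x hx
      refine intervalIntegral.integral_zero_ae ?_
      have : ∀ᵐ t : ℝ, t ≠ a := by simp [ae_iff, measure_singleton]
      filter_upwards [this] with t hta ht
      rw [uIoc_of_ge hx.le] at ht
      exact hψK t fun hm => hta (le_antisymm ht.2 (hab t hm).1)
    have hθr : ∀ x, b < x → θ x = 0 := by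
      intro x hx
      have hab' := (hab b hbK).1
      rw [show θ x = ∫ t, ψ t from ?_, hψ0]
      have hsupp : ∀ t, ψ t ≠ 0 → t ∈ Icc a b := fun t ht =>
        hab t (by_contra fun hn => ht (hψK t hn))
      rw [← setIntegral_eq_integral_of_forall_compl_eq_zero (s := Icc a x), integral_Icc_eq_integral_Ioc,
        ← intervalIntegral.integral_of_le (by linarith)]
      intro t ht
      by_contra hn
      exact ht ⟨(hsupp t hn).1, (hsupp t hn).2.trans hx.le⟩
    have hθsub : tsupport θ ⊆ Icc a b := by
      refine closure_minimal ?_ isClosed_Icc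
      intro x hx
      by_contra hn
      rw [mem_Icc, not_and_or, not_le, not_le] at hn
      exact hx (hn.elim (hθl x) (hθr x))
    have hθc : HasCompactSupport θ :=
      isCompact_Icc.of_isClosed_subset (isClosed_tsupport θ) hθsub
    -- Order-connectedness of `S` is what keeps the whole interval [a, b], and so the support of θ,
    -- inside `S`.
    have := H θ hθ hθc (hθsub.trans (hc.out (hKS haK) (hKS hbK)))
    rw [hderiv] at this
    have e : ∫ x, h x * ψ x = (∫ x, h x * χ x) - I * c := by
      rw [hcdef, ← integral_const_mul, ← integral_sub (hint χ hχ.continuous hs hsub)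
        ((hint η hη.continuous hηs hηS).const_mul I)]
      congr 1
      funext x
      simp only [ψ]
      ring
    have e2 : ∫ x, χ x • (h x - c) = (∫ x, h x * χ x) - I * c := by
      rw [show I * c = ∫ x, χ x * c from (integral_mul_const c χ).symm,
        ← integral_sub (hint χ hχ.continuous hs hsub) (hχi.mul_const c)]
      congr 1
      funext x
      simp only [smul_eq_mul]
      ring
    rw [e2, ← e, this]
  filter_upwards [key] with x hx hxS
  linarith [hx hxS]

/-- A weakly differentiable locally integrable function agrees almost everywhere with a primitive
of its weak derivative. -/
theorem HasWeakDeriv.exists_isPrimitive {f g : ℝ → ℝ} (h : HasWeakDeriv f g)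
    (hf : LocallyIntegrable f) (hg : LocallyIntegrable g) :
    ∃ F, IsPrimitive F g ∧ f =ᵐ[volume] F := by
  have hP := IsPrimitive.of_integral hg 0
  obtain ⟨c, hc⟩ := ae_eq_const_of_integral_mul_deriv_eq_zero isOpen_univ ordConnected_univ
    univ_nonempty (h := fun x => f x - ∫ t in (0 : ℝ)..x, g t)
    ((hf.sub hP.continuous.locallyIntegrable).locallyIntegrableOn _) (by
      intro θ hθ hs _
      have hi : ∀ k : ℝ → ℝ, LocallyIntegrable k → Integrable (fun x => k x * deriv θ x) := by
        intro k hk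
        simpa [mul_comm] using hk.integrable_smul_left_of_hasCompactSupport
          (hθ.continuous_deriv (by simp)) hs.deriv
      simp only [sub_mul]
      rw [integral_sub (hi _ hf) (hi _ hP.continuous.locallyIntegrable), h θ hθ hs,
        hP.integral_mul_deriv (hθ.of_le (by simp)) hs]
      ring)
  refine ⟨fun x => c + ∫ t in (0 : ℝ)..x, g t, ⟨hg, fun a b => ?_⟩, ?_⟩
  · rw [← hP.sub_eq a b]; ring
  · filter_upwards [hc] with x hx
    linarith [hx (mem_univ x)]

/-! ### The L² norm of a function -/

/-- The norm of `L²(ℝ)` of a function. -/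
noncomputable def l2norm (f : ℝ → ℝ) : ℝ := (eLpNorm f 2 volume).toReal

theorem l2norm_nonneg (f : ℝ → ℝ) : 0 ≤ l2norm f := ENNReal.toReal_nonneg

theorem l2norm_coe (f : Lp ℝ 2 (volume : Measure ℝ)) : l2norm f = ‖f‖ := (Lp.norm_def f).symm

theorem l2norm_congr {f g : ℝ → ℝ} (h : f =ᵐ[volume] g) : l2norm f = l2norm g := by
  rw [l2norm, eLpNorm_congr_ae h, l2norm]

theorem norm_toLp_eq_l2norm {f : ℝ → ℝ} (hf : MemLp f 2) : ‖hf.toLp f‖ = l2norm f :=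
  Lp.norm_toLp f hf

theorem abs_integral_mul_le {f g : ℝ → ℝ} (hf : MemLp f 2) (hg : MemLp g 2) :
    |∫ x, f x * g x| ≤ l2norm f * l2norm g := by
  rw [← norm_toLp_eq_l2norm hf, ← norm_toLp_eq_l2norm hg]
  have h := abs_real_inner_le_norm (hf.toLp f) (hg.toLp g)
  rw [L2.inner_def] at h
  refine le_trans (le_of_eq ?_) h
  congr 1
  refine integral_congr_ae ?_
  filter_upwards [hf.coeFn_toLp, hg.coeFn_toLp] with x h1 h2
  rw [h1, h2]
  simp [mul_comm]

theorem l2norm_sq {f : ℝ → ℝ} (hf : MemLp f 2) : l2norm f ^ 2 = ∫ x, f x ^ 2 := by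
  rw [← norm_toLp_eq_l2norm hf, ← real_inner_self_eq_norm_sq, L2.inner_def]
  refine integral_congr_ae ?_
  filter_upwards [hf.coeFn_toLp] with x h1
  rw [h1]
  simp [sq]

theorem l2norm_abs (f : ℝ → ℝ) : l2norm (fun x => |f x|) = l2norm f := by
  rw [l2norm, l2norm]
  congr 1
  exact eLpNorm_norm f

theorem l2norm_mono {f g : ℝ → ℝ} (hg : MemLp g 2) (h : ∀ x, |f x| ≤ g x) :
    l2norm f ≤ l2norm g := by
  refine ENNReal.toReal_mono hg.eLpNorm_ne_top (eLpNorm_mono_real h)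

theorem l2norm_add_le {f g : ℝ → ℝ} (hf : MemLp f 2) (hg : MemLp g 2) :
    l2norm (fun x => f x + g x) ≤ l2norm f + l2norm g := by
  rw [l2norm, l2norm, l2norm, ← ENNReal.toReal_add hf.eLpNorm_ne_top hg.eLpNorm_ne_top]
  exact ENNReal.toReal_mono (ENNReal.add_ne_top.2 ⟨hf.eLpNorm_ne_top, hg.eLpNorm_ne_top⟩)
    (eLpNorm_add_le hf.1 hg.1 (by norm_num))

theorem l2norm_const_mul (c : ℝ) (f : ℝ → ℝ) : l2norm (fun x => c * f x) = |c| * l2norm f := by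
  have : eLpNorm (fun x => c * f x) 2 volume = ‖c‖ₑ * eLpNorm f 2 volume :=
    eLpNorm_const_smul c f 2 volume
  rw [l2norm, l2norm, this, ENNReal.toReal_mul]
  simp

/-- Cauchy–Schwarz against the indicator of `s`. -/
theorem setIntegral_abs_le {f : ℝ → ℝ} (hf : MemLp f 2) {s : Set ℝ} (hs : MeasurableSet s)
    (hfin : volume s ≠ ⊤) : ∫ x in s, |f x| ≤ √(volume.real s) * l2norm f := by
  have hi : MemLp (s.indicator fun _ => (1 : ℝ)) 2 := memLp_indicator_const 2 hs 1 (Or.inr hfin)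
  have h1 := abs_integral_mul_le hi hf.abs
  rw [show |f| = fun x => |f x| from rfl, l2norm_abs] at h1
  have h2 : l2norm (s.indicator fun _ => (1 : ℝ)) = √(volume.real s) := by
    rw [← Real.sqrt_sq (l2norm_nonneg _), l2norm_sq hi]
    congr 1
    have : ∀ x, (s.indicator (fun _ => (1 : ℝ)) x) ^ 2 = s.indicator (fun _ => (1 : ℝ)) x := by
      intro x
      by_cases hx : x ∈ s <;> simp [hx]
    simp only [this]
    rw [integral_indicator hs]
    simp
  rw [h2] at h1
  refine le_trans (le_of_eq ?_) ((le_abs_self _).trans h1)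
  rw [← integral_indicator hs]
  congr 1
  funext x
  by_cases hx : x ∈ s <;> simp [hx]

/-! ### Sobolev embedding and continuous representatives -/

namespace IsPrimitive

variable {F f : ℝ → ℝ}

/-- Cauchy–Schwarz on the interval between the two points. Applied to ∂ₓu it gives the Hölder
exponent 1/2 on which the commutator estimate rests. -/
theorem abs_sub_le (h : IsPrimitive F f) (hf : MemLp f 2) (x y : ℝ) :
    |F x - F y| ≤ √|x - y| * l2norm f := by
  rw [h.sub_eq y x]
  refine (intervalIntegral.norm_integral_le_integral_norm_uIoc (f := f) (μ := volume)).trans ?_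
  refine (setIntegral_abs_le hf measurableSet_uIoc (by simp [uIoc])).trans (le_of_eq ?_)
  congr 2
  rw [uIoc, measureReal_def, Real.volume_Ioc, max_sub_min_eq_abs, ENNReal.toReal_ofReal (abs_nonneg _)]

/-- For y within distance one of x, |F x| exceeds |F y| by at most the L² norm of f; averaging over
y in [x, x + 1] replaces |F y| by the L² norm of F. -/
theorem abs_le (h : IsPrimitive F f) (hF : MemLp F 2) (hf : MemLp f 2) (x : ℝ) :
    |F x| ≤ l2norm F + l2norm f := by
  have h1 : ∀ y ∈ Icc x (x + 1), |F x| ≤ |F y| + l2norm f := by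
    intro y hy
    have h2 := h.abs_sub_le hf x y
    have h3 : √|x - y| ≤ 1 := by
      rw [Real.sqrt_le_one]
      rw [_root_.abs_le]; constructor <;> linarith [hy.1, hy.2]
    have h4 := abs_sub_abs_le_abs_sub (F x) (F y)
    nlinarith [l2norm_nonneg f]
  have h5 := setIntegral_abs_le hF (s := Icc x (x + 1)) measurableSet_Icc (by simp)
  have h6 : volume.real (Icc x (x + 1)) = 1 := by simp
  rw [h6, Real.sqrt_one, one_mul] at h5
  have h7 : ∫ y in Icc x (x + 1), |F x| ≤ ∫ y in Icc x (x + 1), (|F y| + l2norm f) := by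
    refine setIntegral_mono_on (by simp) ?_ measurableSet_Icc h1
    exact (h.continuous.abs.add continuous_const).continuousOn.integrableOn_Icc
  rw [integral_add h.continuous.abs.continuousOn.integrableOn_Icc (by simp)] at h7
  simp only [setIntegral_const, h6, smul_eq_mul, one_mul] at h7
  linarith

end IsPrimitive

namespace SobolevH2

theorem continuous_fn : Continuous fn :=
  (PiLp.continuous_apply 2 _ 0).comp continuous_subtype_val

theorem continuous_dx : Continuous dx :=
  (PiLp.continuous_apply 2 _ 1).comp continuous_subtype_val

theorem continuous_dxx : Continuous dxx :=
  (PiLp.continuous_apply 2 _ 2).comp continuous_subtype_val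

theorem continuous_momentum : Continuous momentum := continuous_fn.sub continuous_dxx

theorem norm_fn_le (v : SobolevH2) : ‖fn v‖ ≤ ‖v‖ := PiLp.norm_apply_le v.1 0

theorem norm_dx_le (v : SobolevH2) : ‖dx v‖ ≤ ‖v‖ := PiLp.norm_apply_le v.1 1

theorem norm_dxx_le (v : SobolevH2) : ‖dxx v‖ ≤ ‖v‖ := PiLp.norm_apply_le v.1 2

theorem momentum_ae (v : SobolevH2) : momentum v =ᵐ[volume] fun x => fn v x - dxx v x :=
  Lp.coeFn_sub _ _

theorem memLp_fn (v : SobolevH2) : MemLp (fn v) 2 := Lp.memLp _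

theorem memLp_dx (v : SobolevH2) : MemLp (dx v) 2 := Lp.memLp _

theorem memLp_dxx (v : SobolevH2) : MemLp (dxx v) 2 := Lp.memLp _

/-- Take V from the weak derivative of ∂ₓu and U from that of u. Since ∂ₓu = V almost everywhere, U
is a primitive of the continuous function V and hence C¹. -/
theorem exists_isPrimitive (v : SobolevH2) : ∃ U V : ℝ → ℝ, IsPrimitive U V ∧
    IsPrimitive V (dxx v) ∧ fn v =ᵐ[volume] U ∧ dx v =ᵐ[volume] V := by
  have hl : ∀ f : Lp ℝ 2 (volume : Measure ℝ), LocallyIntegrable f := fun f =>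
    (Lp.memLp f).locallyIntegrable (by norm_num)
  obtain ⟨V, hV, hV'⟩ := HasWeakDeriv.exists_isPrimitive (v.2.2 : HasWeakDeriv (dx v) (dxx v))
    (hl _) (hl _)
  obtain ⟨U, hU, hU'⟩ := HasWeakDeriv.exists_isPrimitive (v.2.1 : HasWeakDeriv (fn v) (dx v))
    (hl _) (hl _)
  exact ⟨U, V, hU.congr_right hV', hV, hU', hV'⟩

/-- The continuous representative of `u`. -/
noncomputable def rep (v : SobolevH2) : ℝ → ℝ := (exists_isPrimitive v).choose

/-- The continuous representative of `∂ₓu`. -/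
noncomputable def repDx (v : SobolevH2) : ℝ → ℝ := (exists_isPrimitive v).choose_spec.choose

theorem isPrimitive_rep (v : SobolevH2) : IsPrimitive (rep v) (repDx v) :=
  (exists_isPrimitive v).choose_spec.choose_spec.1

theorem isPrimitive_repDx (v : SobolevH2) : IsPrimitive (repDx v) (dxx v) :=
  (exists_isPrimitive v).choose_spec.choose_spec.2.1

theorem fn_ae (v : SobolevH2) : fn v =ᵐ[volume] rep v :=
  (exists_isPrimitive v).choose_spec.choose_spec.2.2.1

theorem dx_ae (v : SobolevH2) : dx v =ᵐ[volume] repDx v :=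
  (exists_isPrimitive v).choose_spec.choose_spec.2.2.2

theorem memLp_rep (v : SobolevH2) : MemLp (rep v) 2 := (memLp_fn v).ae_eq (fn_ae v)

theorem memLp_repDx (v : SobolevH2) : MemLp (repDx v) 2 := (memLp_dx v).ae_eq (dx_ae v)

theorem continuous_rep (v : SobolevH2) : Continuous (rep v) := (isPrimitive_rep v).continuous

theorem continuous_repDx (v : SobolevH2) : Continuous (repDx v) := (isPrimitive_repDx v).continuous

theorem hasDerivAt_rep (v : SobolevH2) (x : ℝ) : HasDerivAt (rep v) (repDx v x) x :=
  (isPrimitive_rep v).hasDerivAt (continuous_repDx v) x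

theorem abs_rep_le (v : SobolevH2) (x : ℝ) : |rep v x| ≤ 2 * ‖v‖ := by
  have h := (isPrimitive_rep v).abs_le (memLp_rep v) (memLp_repDx v) x
  rw [← l2norm_congr (fn_ae v), ← l2norm_congr (dx_ae v), l2norm_coe, l2norm_coe] at h
  linarith [norm_fn_le v, norm_dx_le v]

theorem abs_repDx_le (v : SobolevH2) (x : ℝ) : |repDx v x| ≤ 2 * ‖v‖ := by
  have h := (isPrimitive_repDx v).abs_le (memLp_repDx v) (memLp_dxx v) x
  rw [← l2norm_congr (dx_ae v), l2norm_coe, l2norm_coe] at h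
  linarith [norm_dxx_le v, norm_dx_le v]

theorem abs_repDx_sub_le (v : SobolevH2) (x y : ℝ) :
    |repDx v x - repDx v y| ≤ √|x - y| * ‖v‖ := by
  refine ((isPrimitive_repDx v).abs_sub_le (memLp_dxx v) x y).trans ?_
  rw [l2norm_coe]
  gcongr
  exact norm_dxx_le v

end SobolevH2

/-! ### The operator `G` -/

theorem integrable_greenKernel : Integrable fun x : ℝ => 1 / 2 * Real.exp (-|x|) := by
  refine Integrable.const_mul ?_ _
  rw [← integrableOn_univ, ← Iic_union_Ioi (a := (0 : ℝ))]
  refine IntegrableOn.union ?_ ?_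
  · refine (integrableOn_exp_Iic 0).congr_fun ?_ measurableSet_Iic
    intro x hx
    simp [abs_of_nonpos (show x ≤ 0 from hx)]
  · refine (exp_neg_integrableOn_Ioi 0 one_pos).congr_fun ?_ measurableSet_Ioi
    intro x hx
    simp [abs_of_pos (show 0 < x from hx)]

theorem greenOp_eq_convolution (f : ℝ → ℝ) :
    greenOp f = convolution f (fun x => 1 / 2 * Real.exp (-|x|)) (ContinuousLinearMap.mul ℝ ℝ)
      volume := by
  funext x
  simp only [greenOp, convolution, ContinuousLinearMap.mul_apply']
  congr 1
  funext y
  ring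

theorem Integrable.greenOp {f : ℝ → ℝ} (hf : Integrable f) : Integrable (greenOp f) := by
  rw [greenOp_eq_convolution]
  exact hf.integrable_convolution _ integrable_greenKernel

theorem greenOp_nonneg {f : ℝ → ℝ} (hf : ∀ x, 0 ≤ f x) (x : ℝ) : 0 ≤ greenOp f x :=
  integral_nonneg fun y => mul_nonneg (by positivity) (hf y)

theorem integral_exp_neg_abs : ∫ x : ℝ, 1 / 2 * Real.exp (-|x|) = 1 := by
  rw [integral_const_mul, integral_comp_abs (f := fun x => Real.exp (-x)),
    integral_exp_neg_Ioi_zero]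
  norm_num

theorem integral_greenOp {f : ℝ → ℝ} (hf : Integrable f) : ∫ x, greenOp f x = ∫ x, f x := by
  rw [greenOp_eq_convolution, integral_convolution _ hf integrable_greenKernel,
    integral_exp_neg_abs]
  simp

theorem HasCompactSupport.continuous_greenOp {χ : ℝ → ℝ} (hs : HasCompactSupport χ)
    (hχ : Continuous χ) : Continuous (greenOp χ) := by
  rw [greenOp_eq_convolution]
  exact hs.continuous_convolution_left _ hχ integrable_greenKernel.locallyIntegrable

theorem abs_greenOp_le {χ : ℝ → ℝ} (hχ : Integrable χ) (x : ℝ) :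
    |greenOp χ x| ≤ ∫ y, |χ y| := by
  refine (norm_integral_le_integral_norm (μ := volume)
    fun y => 1 / 2 * Real.exp (-|x - y|) * χ y).trans ?_
  refine integral_mono_of_nonneg (Eventually.of_forall fun y => norm_nonneg _) hχ.abs
    (Eventually.of_forall fun y => ?_)
  have h1 : Real.exp (-|x - y|) ≤ 1 := Real.exp_le_one_iff.2 (by simp)
  have h0 := Real.exp_pos (-|x - y|)
  simp only [norm_mul, Real.norm_eq_abs, abs_of_pos h0]
  rw [abs_of_pos (by norm_num : (0 : ℝ) < 1 / 2)]
  nlinarith [abs_nonneg (χ y)]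

/-- The operator `G` is symmetric. -/
theorem integral_greenOp_mul {f χ : ℝ → ℝ} (hf : Integrable f) (hχ : Integrable χ) :
    ∫ x, greenOp f x * χ x = ∫ x, f x * greenOp χ x := by
  have hint : Integrable (fun p : ℝ × ℝ => (1 / 2 * Real.exp (-|p.1 - p.2|)) * (χ p.1 * f p.2))
      (volume.prod volume) := by
    refine (hχ.mul_prod hf).bdd_mul (c := 1)
      (Continuous.aestronglyMeasurable (by fun_prop)) (Eventually.of_forall fun p => ?_)
    have h1 : Real.exp (-|p.1 - p.2|) ≤ 1 := Real.exp_le_one_iff.2 (by simp)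
    have h0 := Real.exp_pos (-|p.1 - p.2|)
    rw [Real.norm_eq_abs, abs_of_pos (by positivity)]
    linarith
  have h := integral_integral_swap (f := fun x y => (1 / 2 * Real.exp (-|x - y|)) * (χ x * f y)) hint
  calc ∫ x, greenOp f x * χ x = ∫ x, ∫ y, (1 / 2 * Real.exp (-|x - y|)) * (χ x * f y) := by
        congr 1
        funext x
        rw [greenOp, ← integral_mul_const]
        congr 1
        funext y
        ring
    _ = ∫ y, ∫ x, (1 / 2 * Real.exp (-|x - y|)) * (χ x * f y) := h
    _ = ∫ x, f x * greenOp χ x := by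
        congr 1
        funext x
        rw [greenOp, ← integral_const_mul]
        congr 1
        funext y
        rw [abs_sub_comm]
        ring

/-- `G (χ - χ'') = χ` for test functions. -/
theorem greenOp_sub_deriv_deriv {χ : ℝ → ℝ} (hχ : ContDiff ℝ ∞ χ) (hs : HasCompactSupport χ) :
    greenOp (fun x => χ x - deriv (deriv χ) x) = χ := by
  funext x
  have hχ' : ContDiff ℝ ∞ (deriv χ) := (contDiff_infty_iff_deriv.1 hχ).2
  have d1 : ∀ y, HasDerivAt χ (deriv χ y) y := fun y =>
    ((hχ.differentiable (by simp)) y).hasDerivAt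
  have d2 : ∀ y, HasDerivAt (deriv χ) (deriv (deriv χ) y) y := fun y =>
    ((hχ'.differentiable (by simp)) y).hasDerivAt
  have c2 : Continuous (deriv (deriv χ)) := hχ'.continuous_deriv (by simp)
  have hint : Integrable (fun y => 1 / 2 * Real.exp (-|x - y|) * (χ y - deriv (deriv χ) y)) := by
    refine Continuous.integrable_of_hasCompactSupport ?_ ?_
    · have := hχ.continuous
      fun_prop
    · exact (hs.sub hs.deriv.deriv).mul_left
  -- On each side of x the integrand has an explicit antiderivative that vanishes at infinity. The
  -- left half-line contributes ½(χ - χ')(x) and the right one ½(χ + χ')(x), with sum χ(x).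
  have l := integral_Iic_of_hasDerivAt_of_tendsto (a := x) (m := 0)
    (f := fun y => 1 / 2 * Real.exp (y - x) * (χ y - deriv χ y))
    (f' := fun y => 1 / 2 * Real.exp (-|x - y|) * (χ y - deriv (deriv χ) y))
    (Continuous.continuousWithinAt (by
      have := hχ.continuous
      have := hχ'.continuous
      fun_prop))
    (fun y hy => by
      have he : HasDerivAt (fun y => 1 / 2 * Real.exp (y - x)) (1 / 2 * Real.exp (y - x)) y := by
        simpa only [mul_one, id] using (((hasDerivAt_id y).sub_const x).exp).const_mul (1 / 2 : ℝ)
      convert! he.mul ((d1 y).sub (d2 y)) using 1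
      rw [abs_of_pos (sub_pos.2 hy), neg_sub]
      simp only [Pi.sub_apply]
      ring)
    hint.integrableOn
    (by
      exact ((hs.sub hs.deriv).mul_left (f := fun y => 1 / 2 * Real.exp (y - x))).is_zero_at_infty.mono_left
        atBot_le_cocompact)
  have r := integral_Ioi_of_hasDerivAt_of_tendsto (a := x) (m := 0)
    (f := fun y => -(1 / 2 * Real.exp (x - y) * (χ y + deriv χ y)))
    (f' := fun y => 1 / 2 * Real.exp (-|x - y|) * (χ y - deriv (deriv χ) y))
    (Continuous.continuousWithinAt (by
      have := hχ.continuous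
      have := hχ'.continuous
      fun_prop))
    (fun y hy => by
      have he : HasDerivAt (fun y => 1 / 2 * Real.exp (x - y)) (-(1 / 2 * Real.exp (x - y))) y := by
        simpa only [mul_neg, mul_one, id] using (((hasDerivAt_id y).const_sub x).exp).const_mul (1 / 2 : ℝ)
      convert! (he.mul ((d1 y).add (d2 y))).neg using 1
      rw [abs_of_neg (sub_neg.2 hy), neg_neg]
      simp only [Pi.add_apply]
      ring)
    hint.integrableOn
    (by
      exact ((hs.add hs.deriv).mul_left
        (f := fun y => 1 / 2 * Real.exp (x - y))).neg.is_zero_at_infty.mono_left atTop_le_cocompact)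
  rw [greenOp, ← integral_add_compl (measurableSet_Iic (a := x)) hint, compl_Iic, l, r]
  simp
  ring

/-! ### Continuity of pairings, and the flux tested in space -/

theorem MemLp.bounded_mul {f w : ℝ → ℝ} {C : ℝ} (hf : MemLp f 2) (hw : AEStronglyMeasurable w)
    (hC : ∀ x, |w x| ≤ C) : MemLp (fun x => w x * f x) 2 := by
  refine hf.of_le_mul (c := C) (hw.mul hf.1) (Eventually.of_forall fun x => ?_)
  rw [norm_mul]
  exact mul_le_mul_of_nonneg_right (hC x) (norm_nonneg _)

theorem l2norm_bounded_mul_le {f w : ℝ → ℝ} {C : ℝ} (hC0 : 0 ≤ C) (hf : MemLp f 2)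
    (hC : ∀ x, |w x| ≤ C) : l2norm (fun x => w x * f x) ≤ C * l2norm f := by
  have h := l2norm_const_mul C fun x => |f x|
  rw [abs_of_nonneg hC0, l2norm_abs] at h
  rw [← h]
  refine l2norm_mono (hf.abs.const_mul C) fun x => ?_
  rw [abs_mul]
  exact mul_le_mul_of_nonneg_right (hC x) (abs_nonneg _)

/-- The pairing `∫ f g w` is continuous in `f, g ∈ L²` for a bounded weight `w`. -/
theorem continuous_integral_mul_mul {w : ℝ → ℝ} {C : ℝ} (hw : AEStronglyMeasurable w)
    (hC : ∀ x, |w x| ≤ C) :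
    Continuous fun p : Lp ℝ 2 (volume : Measure ℝ) × Lp ℝ 2 (volume : Measure ℝ) =>
      ∫ x, p.1 x * p.2 x * w x := by
  have hi : ∀ f g : Lp ℝ 2 (volume : Measure ℝ), Integrable fun x => f x * g x * w x := by
    intro f g
    have := (Lp.memLp f).integrable_mul (MemLp.bounded_mul (Lp.memLp g) hw hC)
    refine this.congr (Eventually.of_forall fun x => ?_)
    simp only [Pi.mul_apply]
    ring
  have hC0 : 0 ≤ C := (abs_nonneg _).trans (hC 0)
  let B : Lp ℝ 2 (volume : Measure ℝ) →ₗ[ℝ] Lp ℝ 2 (volume : Measure ℝ) →ₗ[ℝ] ℝ :=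
    LinearMap.mk₂ ℝ (fun f g => ∫ x, f x * g x * w x)
      (fun f f' g => by
        rw [← integral_add (hi _ _) (hi _ _)]
        refine integral_congr_ae ?_
        filter_upwards [Lp.coeFn_add f f'] with x hx
        rw [hx, Pi.add_apply]
        ring)
      (fun c f g => by
        rw [smul_eq_mul, ← integral_const_mul]
        refine integral_congr_ae ?_
        filter_upwards [Lp.coeFn_smul c f] with x hx
        rw [hx, Pi.smul_apply, smul_eq_mul]
        ring)
      (fun f g g' => by
        rw [← integral_add (hi _ _) (hi _ _)]
        refine integral_congr_ae ?_
        filter_upwards [Lp.coeFn_add g g'] with x hx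
        rw [hx, Pi.add_apply]
        ring)
      (fun c f g => by
        rw [smul_eq_mul, ← integral_const_mul]
        refine integral_congr_ae ?_
        filter_upwards [Lp.coeFn_smul c g] with x hx
        rw [hx, Pi.smul_apply, smul_eq_mul]
        ring)
  have hB : ∀ f g, ‖B f g‖ ≤ C * ‖f‖ * ‖g‖ := by
    intro f g
    have h1 := abs_integral_mul_le (Lp.memLp f) (MemLp.bounded_mul (Lp.memLp g) hw hC)
    have h2 := l2norm_bounded_mul_le hC0 (Lp.memLp g) hC
    rw [l2norm_coe] at h1 h2
    have h3 : B f g = ∫ x, f x * (w x * g x) := by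
      simp only [B, LinearMap.mk₂_apply]
      congr 1
      funext x
      ring
    rw [Real.norm_eq_abs, h3]
    nlinarith [norm_nonneg f, norm_nonneg g]
  exact (B.mkContinuous₂ C hB).continuous₂

/-- The pairing of an element of `L²` with a fixed function in `L²` is continuous. -/
theorem continuous_integral_mul {χ : ℝ → ℝ} (hχ : MemLp χ 2) :
    Continuous fun f : Lp ℝ 2 (volume : Measure ℝ) => ∫ x, f x * χ x := by
  have h : Continuous fun f : Lp ℝ 2 (volume : Measure ℝ) => inner ℝ (hχ.toLp χ) f := by
    fun_prop
  refine h.congr fun f => ?_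
  rw [L2.inner_def]
  refine integral_congr_ae ?_
  filter_upwards [hχ.coeFn_toLp] with x hx
  rw [hx]
  simp

namespace SobolevH2

/-- The density `b/2 u² + (3-b)/2 (∂ₓu)²` to which `G` is applied in the flux. -/
noncomputable def density (b : ℝ) (v : SobolevH2) (x : ℝ) : ℝ :=
  b / 2 * (fn v x) ^ 2 + (3 - b) / 2 * (dx v x) ^ 2

theorem integrable_density (b : ℝ) (v : SobolevH2) : Integrable (density b v) :=
  ((memLp_fn v).integrable_sq.const_mul _).add ((memLp_dx v).integrable_sq.const_mul _)

theorem bFlux_eq (b : ℝ) (v : SobolevH2) (x : ℝ) :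
    bFlux b v x = 1 / 2 * (fn v x) ^ 2 + greenOp (density b v) x := rfl

theorem integrable_bFlux (b : ℝ) (v : SobolevH2) : Integrable (bFlux b v) :=
  ((memLp_fn v).integrable_sq.const_mul _).add (Integrable.greenOp (integrable_density b v))

/-- Symmetry moves `G` onto the test function. What remains are quadratic L² pairings with bounded
weights, whose continuity in `v` is immediate. -/
theorem integral_bFlux_mul (b : ℝ) (v : SobolevH2) {χ : ℝ → ℝ} (hχ : Continuous χ)
    (hs : HasCompactSupport χ) :
    ∫ x, bFlux b v x * χ x = (∫ x, fn v x * fn v x * (1 / 2 * χ x + b / 2 * greenOp χ x))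
      + ∫ x, dx v x * dx v x * ((3 - b) / 2 * greenOp χ x) := by
  have hi : Integrable χ := hχ.integrable_of_hasCompactSupport hs
  obtain ⟨C, hC⟩ := hs.exists_bound_of_continuous hχ
  have hG : Continuous (greenOp χ) := HasCompactSupport.continuous_greenOp hs hχ
  have bd : ∀ {k w : ℝ → ℝ} {D : ℝ}, Integrable k → Continuous w → (∀ x, |w x| ≤ D) →
      Integrable fun x => k x * w x := by
    intro k w D hk hw hD
    simpa [mul_comm] using hk.bdd_mul hw.aestronglyMeasurable (Eventually.of_forall hD)
  have i1 := bd (memLp_fn v).integrable_sq hχ hC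
  have i2 := bd (memLp_fn v).integrable_sq hG (abs_greenOp_le hi)
  have i3 := bd (memLp_dx v).integrable_sq hG (abs_greenOp_le hi)
  have i4 := bd (Integrable.greenOp (integrable_density b v)) hχ hC
  calc ∫ x, bFlux b v x * χ x
      = ∫ x, (1 / 2 * ((fn v x) ^ 2 * χ x) + greenOp (density b v) x * χ x) := by
        congr 1
        funext x
        rw [bFlux_eq]
        ring
    _ = (∫ x, 1 / 2 * ((fn v x) ^ 2 * χ x)) + ∫ x, density b v x * greenOp χ x := by
        rw [integral_add (i1.const_mul _) i4, integral_greenOp_mul (integrable_density b v) hi]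
    _ = (∫ x, 1 / 2 * ((fn v x) ^ 2 * χ x)) + ((∫ x, b / 2 * ((fn v x) ^ 2 * greenOp χ x))
          + ∫ x, (3 - b) / 2 * ((dx v x) ^ 2 * greenOp χ x)) := by
        rw [← integral_add (i2.const_mul _) (i3.const_mul _)]
        congr 2
        funext x
        rw [density]
        ring
    _ = _ := by
        rw [← add_assoc, ← integral_add (i1.const_mul _) (i2.const_mul _)]
        congr 2 <;> funext x <;> ring

theorem continuous_integral_bFlux_mul (b : ℝ) {χ : ℝ → ℝ} (hχ : Continuous χ)
    (hs : HasCompactSupport χ) : Continuous fun v : SobolevH2 => ∫ x, bFlux b v x * χ x := by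
  simp only [fun v => integral_bFlux_mul b v hχ hs]
  have hi : Integrable χ := hχ.integrable_of_hasCompactSupport hs
  obtain ⟨C, hC⟩ := hs.exists_bound_of_continuous hχ
  have hG : Continuous (greenOp χ) := HasCompactSupport.continuous_greenOp hs hχ
  refine Continuous.add ?_ ?_
  · refine (continuous_integral_mul_mul (w := fun x => 1 / 2 * χ x + b / 2 * greenOp χ x)
      (C := 1 / 2 * C + |b / 2| * ∫ y, |χ y|) (by fun_prop) fun x => ?_).comp
        (continuous_fn.prodMk continuous_fn)
    refine (abs_add_le _ _).trans ?_
    rw [abs_mul, abs_mul, abs_of_pos (by norm_num : (0 : ℝ) < 1 / 2)]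
    have h1 : |χ x| ≤ C := hC x
    gcongr
    exact abs_greenOp_le hi x
  · refine (continuous_integral_mul_mul (w := fun x => (3 - b) / 2 * greenOp χ x)
      (C := |(3 - b) / 2| * ∫ y, |χ y|) (by fun_prop) fun x => ?_).comp
        (continuous_dx.prodMk continuous_dx)
    rw [abs_mul]
    gcongr
    exact abs_greenOp_le hi x

/-- The flux tested against `(1 - ∂ₓ²)χ'` in terms of the momentum. -/
theorem integral_bFlux_mul_sub (b : ℝ) (v : SobolevH2) {χ : ℝ → ℝ} (hχ : ContDiff ℝ ∞ χ)
    (hs : HasCompactSupport χ) :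
    ∫ x, bFlux b v x * deriv (fun y => χ y - deriv (deriv χ) y) x
      = (∫ x, rep v x * momentum v x * deriv χ x)
        - (b - 1) * ∫ x, repDx v x * momentum v x * χ x := by
  have c1 : ContDiff ℝ ∞ (deriv χ) := (contDiff_infty_iff_deriv.1 hχ).2
  have c2 : ContDiff ℝ ∞ (deriv (deriv χ)) := (contDiff_infty_iff_deriv.1 c1).2
  have c3 : ContDiff ℝ ∞ (deriv (deriv (deriv χ))) := (contDiff_infty_iff_deriv.1 c2).2
  have e : deriv (fun y => χ y - deriv (deriv χ) y)
      = fun y => deriv χ y - deriv (deriv (deriv χ)) y := by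
    funext y
    exact deriv_fun_sub (hχ.differentiable (by simp) y) (c2.differentiable (by simp) y)
  have hc : Continuous (fun y => deriv χ y - deriv (deriv (deriv χ)) y) :=
    c1.continuous.sub c3.continuous
  have hcs : HasCompactSupport (fun y => deriv χ y - deriv (deriv (deriv χ)) y) :=
    hs.deriv.sub hs.deriv.deriv.deriv
  have hU := isPrimitive_rep v
  have hV := isPrimitive_repDx v
  have li : ∀ {k : ℝ → ℝ} {w : ℝ → ℝ}, LocallyIntegrable k → ContDiff ℝ ∞ w →
      HasCompactSupport w → Integrable fun x => k x * w x := by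
    intro k w hk hw hws
    simpa [mul_comm] using hk.integrable_smul_left_of_hasCompactSupport hw.continuous hws
  have lU : LocallyIntegrable fun x => rep v x * rep v x :=
    (hU.continuous.mul hU.continuous).locallyIntegrable
  have lV : LocallyIntegrable fun x => repDx v x * repDx v x :=
    (hV.continuous.mul hV.continuous).locallyIntegrable
  have lUV : LocallyIntegrable fun x => rep v x * repDx v x :=
    (hU.continuous.mul hV.continuous).locallyIntegrable
  have lUw : LocallyIntegrable fun x => rep v x * dxx v x :=
    hV.locallyIntegrable.continuous_mul hU.continuous
  have lVw : LocallyIntegrable fun x => repDx v x * dxx v x :=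
    hV.locallyIntegrable.continuous_mul hV.continuous
  -- Testing against (1 - ∂ₓ²)χ' undoes `G`: its image is the local weight χ'. Integrations by parts
  -- do the rest.
  rw [e, integral_bFlux_mul b v hc hcs, greenOp_sub_deriv_deriv c1 hs.deriv]
  have a1 : ∫ x, fn v x * fn v x * (1 / 2 * (deriv χ x - deriv (deriv (deriv χ)) x)
      + b / 2 * deriv χ x) = (1 / 2 + b / 2) * (∫ x, rep v x * rep v x * deriv χ x)
        - 1 / 2 * ∫ x, rep v x * rep v x * deriv (deriv (deriv χ)) x := by
    rw [← integral_const_mul, ← integral_const_mul, ← integral_sub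
      ((li lU c1 hs.deriv).const_mul _) ((li lU c3 hs.deriv.deriv.deriv).const_mul _)]
    refine integral_congr_ae ?_
    filter_upwards [fn_ae v] with x hx
    rw [hx]
    ring
  have a2 : ∫ x, dx v x * dx v x * ((3 - b) / 2 * deriv χ x)
      = (3 - b) / 2 * ∫ x, repDx v x * repDx v x * deriv χ x := by
    rw [← integral_const_mul]
    refine integral_congr_ae ?_
    filter_upwards [dx_ae v] with x hx
    rw [hx]
    ring
  have a3 : ∫ x, rep v x * momentum v x * deriv χ x
      = (∫ x, rep v x * rep v x * deriv χ x) - ∫ x, rep v x * dxx v x * deriv χ x := by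
    rw [← integral_sub (li lU c1 hs.deriv) (li lUw c1 hs.deriv)]
    refine integral_congr_ae ?_
    filter_upwards [fn_ae v, momentum_ae v] with x hx hm
    rw [hm, hx]
    ring
  have a4 : ∫ x, repDx v x * momentum v x * χ x
      = (∫ x, rep v x * repDx v x * χ x) - ∫ x, repDx v x * dxx v x * χ x := by
    rw [← integral_sub (li lUV hχ hs) (li lVw hχ hs)]
    refine integral_congr_ae ?_
    filter_upwards [fn_ae v, momentum_ae v] with x hx hm
    rw [hm, hx]
    ring
  have p1 : ∫ x, rep v x * rep v x * deriv χ x = -(2 * ∫ x, rep v x * repDx v x * χ x) := by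
    rw [(hU.mul hU).integral_mul_deriv (hχ.of_le (by simp)) hs, ← integral_const_mul]
    congr 2
    funext x
    ring
  have p2 : ∫ x, repDx v x * repDx v x * deriv χ x = -(2 * ∫ x, repDx v x * dxx v x * χ x) := by
    rw [(hV.mul hV).integral_mul_deriv (hχ.of_le (by simp)) hs, ← integral_const_mul]
    congr 2
    funext x
    ring
  have p3 : ∫ x, rep v x * rep v x * deriv (deriv (deriv χ)) x
      = -(2 * ∫ x, rep v x * repDx v x * deriv (deriv χ) x) := by
    rw [(hU.mul hU).integral_mul_deriv (c2.of_le (by simp)) hs.deriv.deriv, ← integral_const_mul]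
    congr 2
    funext x
    ring
  have p4 : ∫ x, rep v x * repDx v x * deriv (deriv χ) x
      = -((∫ x, repDx v x * repDx v x * deriv χ x) + ∫ x, rep v x * dxx v x * deriv χ x) := by
    rw [(hU.mul hV).integral_mul_deriv (c1.of_le (by simp)) hs.deriv,
      ← integral_add (li lV c1 hs.deriv) (li lUw c1 hs.deriv)]
    congr 2
    funext x
    ring
  rw [a1, a2, a3, a4, p3, p4]
  -- At this point the two sides differ by (b-1)/2 times ∫ (u² - (∂ₓu)²) χ' + 2 ∫ ∂ₓu m χ, which
  -- vanishes by `p1` and `p2`.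
  linear_combination (b - 1) / 2 * p1 - (b - 1) / 2 * p2

/-- Two integrations by parts: `∫ m χ = ∫ u (χ - χ'')`. -/
theorem integral_momentum_mul (v : SobolevH2) {χ : ℝ → ℝ} (hχ : ContDiff ℝ ∞ χ)
    (hs : HasCompactSupport χ) :
    ∫ x, momentum v x * χ x = ∫ x, fn v x * (χ x - deriv (deriv χ) x) := by
  have c1 : ContDiff ℝ ∞ (deriv χ) := (contDiff_infty_iff_deriv.1 hχ).2
  have c2 : ContDiff ℝ ∞ (deriv (deriv χ)) := (contDiff_infty_iff_deriv.1 c1).2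
  have h1 : ∫ x, fn v x * deriv (deriv χ) x = -∫ x, dx v x * deriv χ x :=
    v.2.1 (deriv χ) c1 hs.deriv
  have h2 : ∫ x, dx v x * deriv χ x = -∫ x, dxx v x * χ x := v.2.2 χ hχ hs
  have e1 : ∫ x, momentum v x * χ x = (∫ x, fn v x * χ x) - ∫ x, dxx v x * χ x := by
    rw [← integral_sub (integrable_mul_of_hasCompactSupport _ hχ.continuous hs)
      (integrable_mul_of_hasCompactSupport _ hχ.continuous hs)]
    refine integral_congr_ae ?_
    filter_upwards [momentum_ae v] with x hm
    rw [hm]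
    ring
  have e2 : ∫ x, fn v x * (χ x - deriv (deriv χ) x)
      = (∫ x, fn v x * χ x) - ∫ x, fn v x * deriv (deriv χ) x := by
    rw [← integral_sub (integrable_mul_of_hasCompactSupport _ hχ.continuous hs)
      (integrable_mul_of_hasCompactSupport _ c2.continuous hs.deriv.deriv)]
    congr 1
    funext x
    ring
  rw [e1, e2, h1, h2]
  ring

end SobolevH2

/-! ### The equation tested in space and integrated in time -/

namespace IsGlobalSolution

open SobolevH2

variable {b : ℝ} {u : ℝ → SobolevH2}

/-- Freezing the solution at negative times gives a curve continuous on all of ℝ, which spares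
one-sided continuity arguments at time zero. -/
theorem continuous_max (hu : IsGlobalSolution b u) : Continuous fun t => u (max t 0) :=
  hu.continuousOn.comp_continuous (by fun_prop) fun t => le_max_right t 0

/-- The equation integrated in time and tested against a function of `x`. -/
theorem integral_mul_sub (hu : IsGlobalSolution b u) {ψ : ℝ → ℝ} (hψ : ContDiff ℝ ∞ ψ)
    (hs : HasCompactSupport ψ) {s t : ℝ} (hs0 : 0 ≤ s) (ht0 : 0 ≤ t) :
    (∫ x, fn (u t) x * ψ x) - ∫ x, fn (u s) x * ψ x
      = ∫ τ in s..t, ∫ x, bFlux b (u τ) x * deriv ψ x := by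
  have hψ' : Continuous (deriv ψ) := hψ.continuous_deriv (by simp)
  let a : ℝ → ℝ := fun t => ∫ x, fn (u (max t 0)) x * ψ x
  let c : ℝ → ℝ := fun t => ∫ x, bFlux b (u (max t 0)) x * deriv ψ x
  have ha : Continuous a := ((continuous_integral_mul
    (hψ.continuous.memLp_of_hasCompactSupport hs)).comp continuous_fn).comp hu.continuous_max
  have hc : Continuous c := (continuous_integral_bFlux_mul b hψ' hs.deriv).comp hu.continuous_max
  have hP := IsPrimitive.of_integral hc.locallyIntegrable 0
  -- Product test functions θ(t)ψ(x) turn the equation into a' = c, weakly on (0, ∞), so a minus a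
  -- primitive of c is almost everywhere constant there. Continuity removes the exceptional set and
  -- adds the endpoint t = 0.
  obtain ⟨k, hk⟩ := ae_eq_const_of_integral_mul_deriv_eq_zero isOpen_Ioi ordConnected_Ioi
    (nonempty_Ioi (a := (0 : ℝ))) (h := fun t => a t - ∫ τ in (0 : ℝ)..t, c τ)
    ((ha.sub hP.continuous).locallyIntegrable.locallyIntegrableOn _) (by
      intro θ hθ hθs hsub
      have hθ' : Continuous (deriv θ) := hθ.continuous_deriv (by simp)
      have hi : ∀ k : ℝ → ℝ, Continuous k → Integrable (fun x => k x * deriv θ x) := by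
        intro k hk
        exact (hk.mul hθ').integrable_of_hasCompactSupport hθs.deriv.mul_left
      have hi0 : Integrable (fun x => c x * θ x) :=
        (hc.mul hθ.continuous).integrable_of_hasCompactSupport hθs.mul_left
      simp only [sub_mul]
      rw [integral_sub (hi _ ha) (hi _ hP.continuous),
        hP.integral_mul_deriv (hθ.of_le (by simp)) hθs, sub_neg_eq_add,
        ← integral_add (hi _ ha) hi0]
      have heq := hu.equation (fun p => θ p.1 * ψ p.2)
        ((hθ.comp contDiff_fst).mul (hψ.comp contDiff_snd))
        (by
          refine HasCompactSupport.intro (hθs.isCompact.prod hs.isCompact) fun p hp => ?_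
          rw [mem_prod, not_and_or] at hp
          rcases hp with hp | hp
          · rw [image_eq_zero_of_notMem_tsupport hp, zero_mul]
          · rw [image_eq_zero_of_notMem_tsupport hp, mul_zero])
        (by
          have hcl : tsupport (fun p : ℝ × ℝ => θ p.1 * ψ p.2) ⊆ tsupport θ ×ˢ univ := by
            refine closure_minimal ?_ ((isClosed_tsupport θ).prod isClosed_univ)
            intro p hp
            exact ⟨subset_tsupport _ (left_ne_zero_of_mul hp), mem_univ _⟩
          exact hcl.trans (prod_mono_left hsub))
      rw [← heq, ← setIntegral_eq_integral_of_forall_compl_eq_zero (s := Ioi (0 : ℝ))]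
      · refine setIntegral_congr_fun measurableSet_Ioi fun t ht => ?_
        have hmax : max t 0 = t := max_eq_left (le_of_lt ht)
        have e1 : ∀ x, deriv (fun s => θ s * ψ x) t = deriv θ t * ψ x := fun x =>
          deriv_mul_const (hθ.differentiable (by simp) t) _
        have e2 : ∀ x, deriv (fun y => θ t * ψ y) x = θ t * deriv ψ x := fun x =>
          deriv_const_mul _ (hψ.differentiable (by simp) x)
        simp only [e1, e2, a, c, hmax]
        obtain ⟨C, hC⟩ := hs.deriv.exists_bound_of_continuous hψ'
        have i2 : Integrable fun x => bFlux b (u t) x * deriv ψ x := by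
          simpa [mul_comm] using (integrable_bFlux b (u t)).bdd_mul hψ'.aestronglyMeasurable
            (Eventually.of_forall hC)
        rw [← integral_mul_const, ← integral_mul_const, ← integral_add
          ((integrable_mul_of_hasCompactSupport _ hψ.continuous hs).mul_const _)
          (i2.mul_const _)]
        congr 1
        funext x
        ring
      · intro t ht
        have h1 : t ∉ tsupport θ := fun h => ht (hsub h)
        have h2 : deriv θ t = 0 :=
          image_eq_zero_of_notMem_tsupport fun h => h1 (tsupport_deriv_subset h)
        rw [h2, image_eq_zero_of_notMem_tsupport h1]
        ring)
  have hcont : Continuous fun t => a t - ∫ τ in (0 : ℝ)..t, c τ := ha.sub hP.continuous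
  have hIoi : EqOn (fun t => a t - ∫ τ in (0 : ℝ)..t, c τ) (fun _ => k) (Ioi 0) :=
    Measure.eqOn_open_of_ae_eq ((ae_restrict_iff' measurableSet_Ioi).2 hk) isOpen_Ioi
      hcont.continuousOn continuousOn_const
  have hIci := hIoi.closure hcont continuous_const
  rw [closure_Ioi] at hIci
  have h1 : a t - ∫ τ in (0 : ℝ)..t, c τ = k := hIci ht0
  have h2 : a s - ∫ τ in (0 : ℝ)..s, c τ = k := hIci hs0
  have h3 := hP.sub_eq s t
  have h4 : ∫ τ in s..t, c τ = ∫ τ in s..t, ∫ x, bFlux b (u τ) x * deriv ψ x := by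
    refine intervalIntegral.integral_congr fun τ hτ => ?_
    have : 0 ≤ τ := (le_min hs0 ht0).trans hτ.1
    simp only [c, max_eq_left this]
  have h5 : a t = ∫ x, fn (u t) x * ψ x := by simp only [a, max_eq_left ht0]
  have h6 : a s = ∫ x, fn (u s) x * ψ x := by simp only [a, max_eq_left hs0]
  rw [← h4, ← h5, ← h6, ← h3]
  linarith

/-- The momentum equation `∂ₜm + ∂ₓ(um) + (b-1) ∂ₓu m = 0` integrated in time and tested against
a function of `x`. -/
theorem integral_momentum_mul_sub (hu : IsGlobalSolution b u) {χ : ℝ → ℝ} (hχ : ContDiff ℝ ∞ χ)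
    (hs : HasCompactSupport χ) {s t : ℝ} (hs0 : 0 ≤ s) (ht0 : 0 ≤ t) :
    (∫ x, momentum (u t) x * χ x) - ∫ x, momentum (u s) x * χ x
      = ∫ τ in s..t, ((∫ x, rep (u τ) x * momentum (u τ) x * deriv χ x)
        - (b - 1) * ∫ x, repDx (u τ) x * momentum (u τ) x * χ x) := by
  have c1 : ContDiff ℝ ∞ (deriv χ) := (contDiff_infty_iff_deriv.1 hχ).2
  have c2 : ContDiff ℝ ∞ (deriv (deriv χ)) := (contDiff_infty_iff_deriv.1 c1).2
  simp only [fun v => integral_momentum_mul v hχ hs, ← fun v => integral_bFlux_mul_sub b v hχ hs]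
  exact hu.integral_mul_sub (hχ.sub c2) (hs.sub hs.deriv.deriv) hs0 ht0

end IsGlobalSolution

/-! ### Mollification in L² -/

/-- Minkowski's integral inequality in `L²`, for a kernel `k` and slices bounded on its support. -/
theorem eLpNorm_integral_mul_le {k : ℝ → ℝ} (hk : Integrable k) (hkm : Measurable k)
    {A : ℝ → ℝ → ℝ} (hA : Measurable (Function.uncurry A)) {η : ENNReal}
    (hη : ∀ z, k z ≠ 0 → eLpNorm (fun x => A x z) 2 volume ≤ η) :
    eLpNorm (fun x => ∫ z, k z * A x z) 2 volume ≤ ENNReal.ofReal (∫ z, |k z|) * η := by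
  have hK : ENNReal.ofReal (∫ z, |k z|) = ∫⁻ z, ‖k z‖ₑ := by
    rw [← ofReal_integral_norm_eq_lintegral_enorm hk]
    rfl
  have sq_eq : ∀ g : ℝ → ℝ, eLpNorm g 2 volume ^ 2 = ∫⁻ x, ‖g x‖ₑ ^ 2 := by
    intro g
    rw [eLpNorm_eq_lintegral_rpow_enorm_toReal (by norm_num) (by norm_num), ← ENNReal.rpow_natCast,
      ← ENNReal.rpow_mul]
    norm_num
  have hkA : Measurable fun p : ℝ × ℝ => ‖k p.2‖ₑ * ‖A p.1 p.2‖ₑ ^ 2 :=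
    (hkm.comp measurable_snd).enorm.mul (hA.enorm.pow_const 2)
  rw [hK]
  have hsq : eLpNorm (fun x => ∫ z, k z * A x z) 2 volume ^ 2 ≤ ((∫⁻ z, ‖k z‖ₑ) * η) ^ 2 := by
    rw [sq_eq]
    calc ∫⁻ x, ‖∫ z, k z * A x z‖ₑ ^ 2
        ≤ ∫⁻ x, (∫⁻ z, ‖k z‖ₑ) * ∫⁻ z, ‖k z‖ₑ * ‖A x z‖ₑ ^ 2 := by
          refine lintegral_mono fun x => ?_
          have hAx : Measurable fun z => A x z := hA.comp measurable_prodMk_left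
          have h1 : ‖∫ z, k z * A x z‖ₑ ≤ ∫⁻ z, ‖k z‖ₑ * ‖A x z‖ₑ := by
            refine (enorm_integral_le_lintegral_enorm _).trans (le_of_eq ?_)
            simp only [enorm_mul]
          -- Cauchy–Schwarz for the weight |k(z)| dz, pairing the constant 1 with A x. After Tonelli
          -- only slices with k z ≠ 0 count.
          let μ : Measure ℝ := volume.withDensity fun z => ‖k z‖ₑ
          have h2 := ENNReal.lintegral_mul_le_Lp_mul_Lq μ Real.HolderConjugate.two_two
            (f := fun _ => 1) (g := fun z => ‖A x z‖ₑ) aemeasurable_const hAx.enorm.aemeasurable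
          have w : ∀ g : ℝ → ENNReal, Measurable g → ∫⁻ z, g z ∂μ = ∫⁻ z, ‖k z‖ₑ * g z := by
            intro g hg
            exact lintegral_withDensity_eq_lintegral_mul _ hkm.enorm hg
          simp only [Pi.mul_apply, one_mul, ENNReal.rpow_ofNat, one_pow] at h2
          rw [w _ hAx.enorm, w _ measurable_const, w _ (hAx.enorm.pow_const 2)] at h2
          simp only [mul_one] at h2
          calc ‖∫ z, k z * A x z‖ₑ ^ 2 ≤ (∫⁻ z, ‖k z‖ₑ * ‖A x z‖ₑ) ^ 2 := by gcongr
            _ ≤ ((∫⁻ z, ‖k z‖ₑ) ^ (1 / 2 : ℝ)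
                  * (∫⁻ z, ‖k z‖ₑ * ‖A x z‖ₑ ^ 2) ^ (1 / 2 : ℝ)) ^ 2 := by gcongr
            _ = (∫⁻ z, ‖k z‖ₑ) * ∫⁻ z, ‖k z‖ₑ * ‖A x z‖ₑ ^ 2 := by
              rw [mul_pow, ← ENNReal.rpow_natCast, ← ENNReal.rpow_natCast, ← ENNReal.rpow_mul,
                ← ENNReal.rpow_mul]
              norm_num
      _ = (∫⁻ z, ‖k z‖ₑ) * ∫⁻ z, ∫⁻ x, ‖k z‖ₑ * ‖A x z‖ₑ ^ 2 := by
          rw [lintegral_const_mul _ hkA.lintegral_prod_right',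
            lintegral_lintegral_swap hkA.aemeasurable]
      _ ≤ (∫⁻ z, ‖k z‖ₑ) * ∫⁻ z, ‖k z‖ₑ * η ^ 2 := by
          gcongr with z
          by_cases hz : k z = 0
          · simp [hz]
          · have hAz : Measurable fun x => A x z := hA.comp measurable_prodMk_right
            rw [lintegral_const_mul _ (hAz.enorm.pow_const 2), ← sq_eq]
            gcongr
            exact hη z hz
      _ = ((∫⁻ z, ‖k z‖ₑ) * η) ^ 2 := by
          rw [lintegral_mul_const _ hkm.enorm]
          ring
  exact (ENNReal.pow_le_pow_left_iff two_ne_zero).1 hsq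

theorem measurable_integral_mul {k : ℝ → ℝ} (hkm : Measurable k)
    {A : ℝ → ℝ → ℝ} (hA : Measurable (Function.uncurry A)) :
    Measurable fun x => ∫ z, k z * A x z := by
  have : StronglyMeasurable (Function.uncurry fun x z => k z * A x z) :=
    ((hkm.comp measurable_snd).mul hA).stronglyMeasurable
  exact this.integral_prod_right.measurable

theorem memLp_integral_mul {k : ℝ → ℝ} (hk : Integrable k) (hkm : Measurable k)
    {A : ℝ → ℝ → ℝ} (hA : Measurable (Function.uncurry A)) {η : ℝ}
    (hη : ∀ z, k z ≠ 0 → eLpNorm (fun x => A x z) 2 volume ≤ ENNReal.ofReal η) :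
    MemLp (fun x => ∫ z, k z * A x z) 2 :=
  ⟨(measurable_integral_mul hkm hA).aestronglyMeasurable,
    (eLpNorm_integral_mul_le hk hkm hA hη).trans_lt
      (ENNReal.mul_lt_top ENNReal.ofReal_lt_top ENNReal.ofReal_lt_top)⟩

theorem l2norm_integral_mul_le {k : ℝ → ℝ} (hk : Integrable k) (hkm : Measurable k)
    {A : ℝ → ℝ → ℝ} (hA : Measurable (Function.uncurry A)) {η : ℝ} (hη0 : 0 ≤ η)
    (hη : ∀ z, k z ≠ 0 → eLpNorm (fun x => A x z) 2 volume ≤ ENNReal.ofReal η) :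
    l2norm (fun x => ∫ z, k z * A x z) ≤ (∫ z, |k z|) * η := by
  have h0 : 0 ≤ ∫ z, |k z| := integral_nonneg fun z => abs_nonneg _
  have h := eLpNorm_integral_mul_le hk hkm hA hη
  rw [← ENNReal.ofReal_mul h0] at h
  exact ENNReal.toReal_le_of_le_ofReal (mul_nonneg h0 hη0) h

/-- The convolution of two real functions. -/
noncomputable def conv (k f : ℝ → ℝ) (x : ℝ) : ℝ := ∫ z, k z * f (x - z)

theorem conv_eq_integral_sub (k f : ℝ → ℝ) (x : ℝ) : conv k f x = ∫ y, f y * k (x - y) := by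
  rw [conv, ← integral_sub_left_eq_self _ volume x]
  congr 1
  funext y
  rw [sub_sub_cancel, mul_comm]

theorem eLpNorm_comp_sub {f : ℝ → ℝ} (hf : Measurable f) (z : ℝ) :
    eLpNorm (fun x => f (x - z)) 2 volume = eLpNorm f 2 volume :=
  eLpNorm_comp_measurePreserving (g := f) hf.aestronglyMeasurable
    (measurePreserving_sub_right volume z)

theorem MemLp.eLpNorm_eq_ofReal {f : ℝ → ℝ} (hf : MemLp f 2) :
    eLpNorm f 2 volume = ENNReal.ofReal (l2norm f) :=
  (ENNReal.ofReal_toReal hf.eLpNorm_ne_top).symm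

theorem measurable_uncurry_comp_sub {f : ℝ → ℝ} (hf : Measurable f) :
    Measurable (Function.uncurry fun x z : ℝ => f (x - z)) :=
  hf.comp (measurable_fst.sub measurable_snd)

section conv

variable {k f : ℝ → ℝ}

theorem memLp_conv (hk : Continuous k) (hs : HasCompactSupport k) (hf : Measurable f)
    (hf2 : MemLp f 2) : MemLp (conv k f) 2 :=
  memLp_integral_mul (hk.integrable_of_hasCompactSupport hs) hk.measurable
    (measurable_uncurry_comp_sub hf) fun z _ =>
      ((eLpNorm_comp_sub hf z).trans (MemLp.eLpNorm_eq_ofReal hf2)).le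

theorem l2norm_conv_le (hk : Continuous k) (hs : HasCompactSupport k) (hf : Measurable f)
    (hf2 : MemLp f 2) : l2norm (conv k f) ≤ (∫ z, |k z|) * l2norm f :=
  l2norm_integral_mul_le (hk.integrable_of_hasCompactSupport hs) hk.measurable
    (measurable_uncurry_comp_sub hf) (l2norm_nonneg f) fun z _ =>
      ((eLpNorm_comp_sub hf z).trans (MemLp.eLpNorm_eq_ofReal hf2)).le

theorem integrable_conv_integrand (hk : Continuous k) (hs : HasCompactSupport k)
    (hf : LocallyIntegrable f) (x : ℝ) : Integrable fun z => k z * f (x - z) :=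
  hs.convolutionExists_left (ContinuousLinearMap.mul ℝ ℝ) hk hf x

theorem continuous_conv (hk : Continuous k) (hs : HasCompactSupport k)
    (hf : LocallyIntegrable f) : Continuous (conv k f) :=
  hs.continuous_convolution_left (ContinuousLinearMap.mul ℝ ℝ) hk hf

theorem hasDerivAt_conv (hk : ContDiff ℝ 1 k) (hs : HasCompactSupport k)
    (hf : LocallyIntegrable f) (x : ℝ) : HasDerivAt (conv k f) (conv (deriv k) f x) x :=
  hs.hasDerivAt_convolution_left (ContinuousLinearMap.mul ℝ ℝ) hk hf x

theorem conv_nonneg (hk : ∀ z, 0 ≤ k z) (hf : ∀ᵐ x, 0 ≤ f x) (x : ℝ) : 0 ≤ conv k f x := by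
  rw [conv_eq_integral_sub]
  refine integral_nonneg_of_ae ?_
  filter_upwards [hf] with y hy using mul_nonneg hy (hk _)

/-- If `∫ k = 1` then `k * f` is as close to `f` as the translates of `f` by the support of `k`. -/
theorem l2norm_conv_sub_le (hk : Continuous k) (hs : HasCompactSupport k) (h1 : ∫ z, k z = 1)
    (hf : Measurable f) (hf2 : MemLp f 2) {η : ℝ} (hη0 : 0 ≤ η)
    (hη : ∀ z, k z ≠ 0 → eLpNorm (fun x => f (x - z) - f x) 2 volume ≤ ENNReal.ofReal η) :
    l2norm (fun x => conv k f x - f x) ≤ (∫ z, |k z|) * η := by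
  have hki : Integrable k := hk.integrable_of_hasCompactSupport hs
  have e : (fun x => conv k f x - f x) = fun x => ∫ z, k z * (f (x - z) - f x) := by
    funext x
    simp only [mul_sub]
    rw [integral_sub (integrable_conv_integrand hk hs (hf2.locallyIntegrable (by norm_num)) x)
      (hki.mul_const _), integral_mul_const, h1, one_mul, conv]
  rw [e]
  exact l2norm_integral_mul_le hki hk.measurable
    (A := fun x z => f (x - z) - f x) ((measurable_uncurry_comp_sub hf).sub (hf.comp measurable_fst)) hη0 hη

end conv

/-- Translations act continuously on `L²`, uniformly on compact curves. -/
theorem exists_forall_eLpNorm_sub_le {m : ℝ → Lp ℝ 2 (volume : Measure ℝ)} (hm : Continuous m)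
    (T : ℝ) {η : ℝ} (hη : 0 < η) : ∃ δ > 0, ∀ t ∈ Icc 0 T, ∀ z, |z| ≤ δ →
      eLpNorm (fun x => m t (x - z) - m t x) 2 volume ≤ ENNReal.ofReal η := by
  let g : ℝ → C(ℝ, ℝ) := fun z => ⟨fun x => x - z, by fun_prop⟩
  have hg : Continuous g := by
    refine ContinuousMap.continuous_of_continuous_uncurry _ ?_
    change Continuous fun p : ℝ × ℝ => p.2 - p.1
    fun_prop
  have hgm : ∀ z, MeasurePreserving (g z) volume volume := fun z =>
    measurePreserving_sub_right volume z
  let τ : ℝ × ℝ → Lp ℝ 2 (volume : Measure ℝ) := fun p =>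
    Lp.compMeasurePreserving (g p.1) (hgm p.1) (m p.2)
  have hτ : Continuous τ := (hm.comp continuous_snd).compMeasurePreservingLp
    (hg.comp continuous_fst) (fun p => hgm p.1) (by norm_num)
  have huc := (isCompact_Icc (a := ((-1 : ℝ), (0 : ℝ))) (b := (1, T))).uniformContinuousOn_of_continuous
    hτ.continuousOn
  obtain ⟨δ, hδ, H⟩ := Metric.uniformContinuousOn_iff.1 huc η hη
  -- The bound 1 keeps z in the rectangle [-1, 1] × [0, T] of uniform continuity, and δ/2 turns |z|
  -- ≤ δ/2 into the strict inequality |z| < δ.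
  refine ⟨min (δ / 2) 1, by positivity, fun t ht z hz => ?_⟩
  have hz1 : |z| ≤ 1 := hz.trans (min_le_right _ _)
  have hz2 : |z| < δ := by linarith [hz.trans (min_le_left _ _)]
  have hd := H (z, t) ⟨⟨(_root_.abs_le.1 hz1).1, ht.1⟩, ⟨(_root_.abs_le.1 hz1).2, ht.2⟩⟩ (0, t)
    ⟨⟨by norm_num, ht.1⟩, ⟨by norm_num, ht.2⟩⟩ (by
      rw [Prod.dist_eq, dist_self, Real.dist_0_eq_abs]
      simpa [hδ] using hz2)
  have e : (fun x => m t (x - z) - m t x) =ᵐ[volume] (τ (z, t) - τ (0, t) : Lp ℝ 2 volume) := by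
    filter_upwards [Lp.coeFn_sub (τ (z, t)) (τ (0, t)),
      Lp.coeFn_compMeasurePreserving (m t) (hgm z), Lp.coeFn_compMeasurePreserving (m t) (hgm 0)]
      with x h1 h2 h3
    rw [h1, Pi.sub_apply]
    simp only [τ]
    rw [h2, h3]
    simp [g]
  rw [eLpNorm_congr_ae e, ← ENNReal.ofReal_toReal (Lp.eLpNorm_ne_top _), ← Lp.norm_def,
    ← dist_eq_norm]
  exact ENNReal.ofReal_le_ofReal hd.le

/-- A fixed smooth bump of integral one supported in `[-1, 1]`. -/
noncomputable def baseBump : ℝ → ℝ :=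
  (⟨1 / 2, 1, by norm_num, by norm_num⟩ : ContDiffBump (0 : ℝ)).normed volume

/-- The standard mollifier at scale `ε`. -/
noncomputable def mollifier (ε z : ℝ) : ℝ := ε⁻¹ * baseBump (z / ε)

theorem contDiff_baseBump : ContDiff ℝ ∞ baseBump := ContDiffBump.contDiff_normed _

theorem baseBump_eq_zero {z : ℝ} (hz : 1 < |z|) : baseBump z = 0 := by
  refine image_eq_zero_of_notMem_tsupport ?_
  rw [baseBump, ContDiffBump.tsupport_normed_eq, Metric.mem_closedBall, Real.dist_0_eq_abs, not_le]
  exact hz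

section mollifier

variable {ε : ℝ}

theorem contDiff_mollifier (ε : ℝ) : ContDiff ℝ ∞ (mollifier ε) :=
  contDiff_const.mul (contDiff_baseBump.comp (contDiff_id.div_const ε))

theorem mollifier_eq_zero (hε : 0 < ε) {z : ℝ} (hz : ε < |z|) : mollifier ε z = 0 := by
  rw [mollifier, baseBump_eq_zero, mul_zero]
  rwa [abs_div, abs_of_pos hε, one_lt_div hε]

theorem hasCompactSupport_mollifier (hε : 0 < ε) : HasCompactSupport (mollifier ε) := by
  refine HasCompactSupport.intro (isCompact_Icc (a := -ε) (b := ε)) fun z hz => ?_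
  refine mollifier_eq_zero hε ?_
  by_contra h
  exact hz (_root_.abs_le.1 (not_lt.1 h))

theorem mollifier_nonneg (hε : 0 < ε) (z : ℝ) : 0 ≤ mollifier ε z :=
  mul_nonneg (inv_nonneg.2 hε.le) (ContDiffBump.nonneg_normed _ _)

theorem integral_rescale (hε : 0 < ε) (h : ℝ → ℝ) : ∫ z, ε⁻¹ * h (z / ε) = ∫ z, h z := by
  rw [integral_const_mul, Measure.integral_comp_div, abs_of_pos hε, smul_eq_mul,
    inv_mul_cancel_left₀ hε.ne']

theorem integral_mollifier (hε : 0 < ε) : ∫ z, mollifier ε z = 1 := by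
  simp only [mollifier]
  rw [integral_rescale hε]
  exact ContDiffBump.integral_normed _

/-- The scale invariant quantity `∫ |z ρ'(z)| + |ρ(z)|`. -/
noncomputable def kernelMass (ρ : ℝ → ℝ) : ℝ := ∫ z, (|z * deriv ρ z| + |ρ z|)

/-- The factor z compensates the 1/ε lost to the derivative, so the constant in the commutator
estimate is the same at all scales. -/
theorem kernelMass_mollifier (hε : 0 < ε) : kernelMass (mollifier ε) = kernelMass baseBump := by
  rw [kernelMass, kernelMass, ← integral_rescale hε fun z => |z * deriv baseBump z| + |baseBump z|]
  congr 1
  funext z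
  have hd : deriv (mollifier ε) z = ε⁻¹ * (deriv baseBump (z / ε) * ε⁻¹) := by
    have h1 : HasDerivAt (fun z => z / ε) ε⁻¹ z := by
      simpa [div_eq_mul_inv] using (hasDerivAt_id z).mul_const ε⁻¹
    exact ((((contDiff_baseBump.differentiable (by simp)) (z / ε)).hasDerivAt.comp z h1).const_mul
      ε⁻¹).deriv
  rw [hd, mollifier, abs_mul ε⁻¹, abs_of_pos (inv_pos.2 hε),
    show z * (ε⁻¹ * (deriv baseBump (z / ε) * ε⁻¹)) = ε⁻¹ * (z / ε * deriv baseBump (z / ε)) by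
      rw [div_eq_mul_inv]; ring, abs_mul ε⁻¹, abs_of_pos (inv_pos.2 hε)]
  ring

theorem kernelMass_nonneg (ρ : ℝ → ℝ) : 0 ≤ kernelMass ρ :=
  integral_nonneg fun _ => by positivity

end mollifier

/-! ### The commutator estimate -/

/-- A velocity field `U` with derivative `V`, both bounded by `K`, with `V` Hölder continuous. -/
structure IsVelocity (K : ℝ) (U V : ℝ → ℝ) : Prop where
  hasDerivAt : ∀ x, HasDerivAt U (V x) x
  continuous_deriv : Continuous V
  abs_le : ∀ x, |U x| ≤ K
  abs_deriv_le : ∀ x, |V x| ≤ K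
  abs_deriv_sub_le : ∀ x y, |V x - V y| ≤ √|x - y| * K

namespace IsVelocity

variable {K : ℝ} {U V m ρ : ℝ → ℝ} {b : ℝ}

theorem nonneg (h : IsVelocity K U V) : 0 ≤ K := (abs_nonneg _).trans (h.abs_le 0)

theorem continuous (h : IsVelocity K U V) : Continuous U :=
  continuous_iff_continuousAt.2 fun x => (h.hasDerivAt x).continuousAt

theorem mono (h : IsVelocity K U V) {K' : ℝ} (hK : K ≤ K') : IsVelocity K' U V where
  hasDerivAt := h.hasDerivAt
  continuous_deriv := h.continuous_deriv
  abs_le x := (h.abs_le x).trans hK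
  abs_deriv_le x := (h.abs_deriv_le x).trans hK
  abs_deriv_sub_le x y :=
    (h.abs_deriv_sub_le x y).trans (mul_le_mul_of_nonneg_left hK (Real.sqrt_nonneg _))

/-- Mean value inequality for U(y) - y V(x), whose derivative V(y) - V(x) is Hölder small. The
factor |z| absorbs the size of ρ', and √|z| is the gain. -/
theorem abs_taylor_le (h : IsVelocity K U V) (x z : ℝ) :
    |U (x - z) - U x + z * V x| ≤ |z| * (√|z| * K) := by
  have key := Convex.norm_image_sub_le_of_norm_hasDerivWithin_le
    (f := fun y => U y - y * V x) (f' := fun y => V y - V x) (s := uIcc x (x - z))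
    (C := √|z| * K)
    (fun y _ => ((h.hasDerivAt y).sub (by
      simpa using (hasDerivAt_id y).mul_const (V x))).hasDerivWithinAt)
    (fun y hy => by
      refine (h.abs_deriv_sub_le y x).trans ?_
      refine mul_le_mul_of_nonneg_right (Real.sqrt_le_sqrt ?_) h.nonneg
      have := abs_sub_left_of_mem_uIcc hy
      simpa using this)
    (convex_uIcc _ _) left_mem_uIcc right_mem_uIcc
  rw [Real.norm_eq_abs, Real.norm_eq_abs] at key
  convert! key using 1
  · congr 1
    ring
  · rw [sub_sub_cancel_left, abs_neg]
    ring

/-- The action of the mollified transport operator `∂ₓ(U m) + (b-1) V m`. -/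
noncomputable def transport (b : ℝ) (U V ρ m : ℝ → ℝ) (x : ℝ) : ℝ :=
  conv (deriv ρ) (fun y => U y * m y) x + (b - 1) * conv ρ (fun y => V y * m y) x

/-- The commutator between mollification and the transport operator. -/
noncomputable def commutator (b : ℝ) (U V ρ m : ℝ → ℝ) (x : ℝ) : ℝ :=
  transport b U V ρ m x - (U x * conv (deriv ρ) m x + b * V x * conv ρ m x)

section

variable (h : IsVelocity K U V) (hm : Measurable m) (hm2 : MemLp m 2)
  (hρ : ContDiff ℝ ∞ ρ) (hs : HasCompactSupport ρ)

include h hm2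

theorem memLp_mul : MemLp (fun y => U y * m y) 2 :=
  MemLp.bounded_mul hm2 h.continuous.aestronglyMeasurable h.abs_le

theorem memLp_deriv_mul : MemLp (fun y => V y * m y) 2 :=
  MemLp.bounded_mul hm2 h.continuous_deriv.aestronglyMeasurable h.abs_deriv_le

include hm hρ hs

theorem memLp_transport (b : ℝ) : MemLp (transport b U V ρ m) 2 :=
  (memLp_conv (hρ.continuous_deriv (by simp)) hs.deriv (h.continuous.measurable.mul hm)
    (h.memLp_mul hm2)).add ((memLp_conv hρ.continuous hs (h.continuous_deriv.measurable.mul hm)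
    (h.memLp_deriv_mul hm2)).const_mul (b - 1))

theorem memLp_commutator (b : ℝ) : MemLp (commutator b U V ρ m) 2 := by
  refine (h.memLp_transport hm hm2 hρ hs b).sub ((MemLp.bounded_mul
    (memLp_conv (hρ.continuous_deriv (by simp)) hs.deriv hm hm2)
    h.continuous.aestronglyMeasurable h.abs_le).add (MemLp.bounded_mul (C := |b| * K)
    (memLp_conv hρ.continuous hs hm hm2)
    (h.continuous_deriv.const_mul b).aestronglyMeasurable fun x => ?_))
  rw [abs_mul]
  exact mul_le_mul_of_nonneg_left (h.abs_deriv_le x) (abs_nonneg b)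

/-- Expanding U and V about x leaves two remainders carrying a factor √ε. The first-order part is,
up to sign, V(x) times the integral of (zρ)' m(x - z). As (zρ)' has integral zero, m(x - z) may be
replaced there by m(x - z) - m(x), of L² norm at most η. Minkowski's inequality concludes. -/
theorem l2norm_commutator_le (b : ℝ) {ε η : ℝ} (hε : ∀ z, ε < |z| → ρ z = 0) (hη0 : 0 ≤ η)
    (hη : ∀ z, |z| ≤ ε → eLpNorm (fun x => m (x - z) - m x) 2 volume ≤ ENNReal.ofReal η) :
    l2norm (commutator b U V ρ m)
      ≤ kernelMass ρ * (K * η + K * (1 + |b - 1|) * √ε * l2norm m) := by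
  have hK := h.nonneg
  have hρ' : Continuous (deriv ρ) := hρ.continuous_deriv (by simp)
  have hε' : ∀ z, ε < |z| → deriv ρ z = 0 := by
    intro z hz
    have : ρ =ᶠ[𝓝 z] fun _ => 0 := by
      filter_upwards [continuous_abs.continuousAt.eventually (lt_mem_nhds hz)] with y hy
        using hε y hy
    rw [this.deriv_eq, deriv_const]
  have hlm : LocallyIntegrable m := hm2.locallyIntegrable (by norm_num)
  set k : ℝ → ℝ := fun z => |z * deriv ρ z| + |ρ z| with hk
  set D : ℝ := K * (1 + |b - 1|) * √ε with hD
  have hD0 : 0 ≤ D := by positivity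
  set A : ℝ → ℝ → ℝ := fun x z => K * |m (x - z) - m x| + D * |m (x - z)| with hA
  have hkc : Continuous k := by
    have := hρ.continuous
    fun_prop
  have hks : HasCompactSupport k := by
    refine HasCompactSupport.add ?_ ?_
    · exact (hs.deriv.mul_left (f := fun z => z)).norm
    · exact hs.norm
  have hki : Integrable k := hkc.integrable_of_hasCompactSupport hks
  have hAm : Measurable (Function.uncurry A) := by
    have h1 : Measurable fun p : ℝ × ℝ => m (p.1 - p.2) := measurable_uncurry_comp_sub hm
    have h2 : Measurable fun p : ℝ × ℝ => m p.1 := hm.comp measurable_fst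
    exact ((h1.sub h2).abs.const_mul K).add (h1.abs.const_mul D)
  have hkz : ∀ z, k z ≠ 0 → |z| ≤ ε := by
    intro z hz
    by_contra hn
    rw [not_le] at hn
    exact hz (by simp [hk, hε z hn, hε' z hn])
  have hmz : ∀ z, MemLp (fun x => m (x - z)) 2 := fun z =>
    hm2.comp_measurePreserving (measurePreserving_sub_right volume z)
  have hAz : ∀ z, k z ≠ 0 → eLpNorm (fun x => A x z) 2 volume
      ≤ ENNReal.ofReal (K * η + D * l2norm m) := by
    intro z hz
    have hd : MemLp (fun x => m (x - z) - m x) 2 := (hmz z).sub hm2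
    have h1 : l2norm (fun x => m (x - z) - m x) ≤ η :=
      ENNReal.toReal_le_of_le_ofReal hη0 (hη z (hkz z hz))
    have h2 : l2norm (fun x => m (x - z)) = l2norm m := by
      rw [l2norm, eLpNorm_comp_sub hm, l2norm]
    have hAM : MemLp (fun x => A x z) 2 := (hd.abs.const_mul K).add ((hmz z).abs.const_mul D)
    rw [MemLp.eLpNorm_eq_ofReal hAM]
    refine ENNReal.ofReal_le_ofReal ?_
    refine (l2norm_add_le (hd.abs.const_mul K) ((hmz z).abs.const_mul D)).trans ?_
    have e1 := l2norm_const_mul K fun x => |m (x - z) - m x|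
    have e2 := l2norm_const_mul D fun x => |m (x - z)|
    rw [l2norm_abs, abs_of_nonneg hK] at e1
    rw [l2norm_abs, abs_of_nonneg hD0, h2] at e2
    refine add_le_add (e1.le.trans ?_) e2.le
    exact mul_le_mul_of_nonneg_left h1 hK
  have hη' : 0 ≤ K * η + D * l2norm m := by
    have := l2norm_nonneg m
    positivity
  have hB := memLp_integral_mul hki hkc.measurable hAm hAz
  have hBn := l2norm_integral_mul_le hki hkc.measurable hAm hη' hAz
  have hkabs : ∫ z, |k z| = kernelMass ρ := by
    rw [kernelMass]
    congr 1
    funext z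
    exact abs_of_nonneg (by positivity)
  rw [hkabs] at hBn
  refine (l2norm_mono hB fun x => ?_).trans hBn
  have hlU : LocallyIntegrable fun y => U y * m y := hlm.continuous_mul h.continuous
  have hlV : LocallyIntegrable fun y => V y * m y := hlm.continuous_mul h.continuous_deriv
  have i1 := integrable_conv_integrand hρ' hs.deriv hlU x
  have i2 := integrable_conv_integrand hρ.continuous hs hlV x
  have i3 := integrable_conv_integrand hρ' hs.deriv hlm x
  have i4 := integrable_conv_integrand hρ.continuous hs hlm x
  have hzρ : IsPrimitive (fun z => z * ρ z) (fun z => 1 * ρ z + z * deriv ρ z) := by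
    have := (IsPrimitive.of_contDiff (contDiff_id (𝕜 := ℝ) (n := 1))).mul
      (IsPrimitive.of_contDiff (hρ.of_le (by simp)))
    simpa using this
  have hκs : HasCompactSupport (fun z => 1 * ρ z + z * deriv ρ z) :=
    hs.mul_left.add hs.deriv.mul_left
  have hκ0 : ∫ z, (1 * ρ z + z * deriv ρ z) = 0 :=
    hzρ.integral_eq_zero hs.mul_left hκs
  have i5 : Integrable (fun z => 1 * ρ z + z * deriv ρ z) := by
    refine Continuous.integrable_of_hasCompactSupport ?_ hκs
    have := hρ.continuous
    fun_prop
  have erep : commutator b U V ρ m x = ∫ z, (deriv ρ z * (U (x - z) - U x + z * V x) * m (x - z)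
      + (b - 1) * ρ z * (V (x - z) - V x) * m (x - z)
      - V x * (1 * ρ z + z * deriv ρ z) * (m (x - z) - m x)) := by
    have e0 : commutator b U V ρ m x = commutator b U V ρ m x
        + V x * m x * ∫ z, (1 * ρ z + z * deriv ρ z) := by rw [hκ0]; ring
    rw [e0, commutator, transport]
    simp only [conv]
    have j1 : Integrable fun z => deriv ρ z * (U (x - z) * m (x - z))
        + (b - 1) * (ρ z * (V (x - z) * m (x - z))) := i1.add (i2.const_mul _)
    have j2 : Integrable fun z => U x * (deriv ρ z * m (x - z))
        + b * V x * (ρ z * m (x - z)) := (i3.const_mul _).add (i4.const_mul _)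
    have j3 : Integrable fun z => deriv ρ z * (U (x - z) * m (x - z))
        + (b - 1) * (ρ z * (V (x - z) * m (x - z))) - (U x * (deriv ρ z * m (x - z))
        + b * V x * (ρ z * m (x - z))) := j1.sub j2
    rw [← integral_const_mul (b - 1), ← integral_const_mul (U x), ← integral_const_mul (b * V x),
      ← integral_const_mul (V x * m x), ← integral_add i1 (i2.const_mul _),
      ← integral_add (i3.const_mul _) (i4.const_mul _), ← integral_sub j1 j2,
      ← integral_add j3 (i5.const_mul _)]
    congr 1
    funext z
    ring
  rw [erep]
  have ikA : Integrable fun z => k z * A x z := by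
    have j1 := integrable_conv_integrand hkc hks (f := fun y => |m y - m x|)
      (fun y => ((hlm.sub (locallyIntegrable_const (m x))) y).norm) x
    have j2 := integrable_conv_integrand hkc hks (f := fun y => |m y|) (fun y => (hlm y).norm) x
    refine ((j1.const_mul K).add (j2.const_mul D)).congr (Eventually.of_forall fun z => ?_)
    simp only [hA, Pi.add_apply]
    ring
  rw [← Real.norm_eq_abs]
  refine norm_integral_le_of_norm_le ikA (Eventually.of_forall fun z => ?_)
  rw [Real.norm_eq_abs]
  by_cases hz : ε < |z|
  · rw [hε z hz, hε' z hz]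
    simp only [zero_mul, mul_zero, add_zero, sub_zero, abs_zero]
    positivity
  · rw [not_lt] at hz
    have hsz : √|z| ≤ √ε := Real.sqrt_le_sqrt hz
    have t1 : |deriv ρ z * (U (x - z) - U x + z * V x) * m (x - z)|
        ≤ |z * deriv ρ z| * (√ε * K) * |m (x - z)| := by
      rw [abs_mul, abs_mul, abs_mul z]
      have := h.abs_taylor_le x z
      calc |deriv ρ z| * |U (x - z) - U x + z * V x| * |m (x - z)|
          ≤ |deriv ρ z| * (|z| * (√ε * K)) * |m (x - z)| := by
            gcongr
            exact this.trans (by gcongr)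
        _ = _ := by ring
    have t2 : |(b - 1) * ρ z * (V (x - z) - V x) * m (x - z)|
        ≤ |b - 1| * |ρ z| * (√ε * K) * |m (x - z)| := by
      rw [abs_mul, abs_mul, abs_mul]
      have := h.abs_deriv_sub_le (x - z) x
      rw [sub_sub_cancel_left, abs_neg] at this
      gcongr
      exact this.trans (by gcongr)
    have t3 : |V x * (1 * ρ z + z * deriv ρ z) * (m (x - z) - m x)|
        ≤ K * k z * |m (x - z) - m x| := by
      rw [abs_mul, abs_mul]
      gcongr
      · exact h.abs_deriv_le x
      · rw [hk, one_mul, add_comm]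
        exact abs_add_le _ _
    refine (abs_sub _ _).trans ((add_le_add ((abs_add_le _ _).trans (add_le_add t1 t2)) t3).trans ?_)
    have g1 : 0 ≤ |z * deriv ρ z| := abs_nonneg _
    have g2 : 0 ≤ |ρ z| := abs_nonneg _
    have g3 : 0 ≤ √ε * K * |m (x - z)| := by positivity
    have g4 : 0 ≤ |b - 1| := abs_nonneg _
    -- The constant `D` weights both parts of `k` by 1 + |b-1|, more than the three terms require;
    -- the right-hand side is the nonnegative excess.
    have : k z * A x z - (|z * deriv ρ z| * (√ε * K) * |m (x - z)|
        + |b - 1| * |ρ z| * (√ε * K) * |m (x - z)| + K * k z * |m (x - z) - m x|)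
        = (|z * deriv ρ z| * |b - 1| + |ρ z|) * (√ε * K * |m (x - z)|) := by
      simp only [hk, hA, hD]
      ring
    have := mul_nonneg (add_nonneg (mul_nonneg g1 g4) g2) g3
    linarith

end

end IsVelocity

/-! ### Energy estimate for the negative part -/

theorem abs_min_zero_sub_le (a b : ℝ) : |min a 0 - min b 0| ≤ |a - b| := by
  simpa using abs_min_sub_min_le_max a 0 b 0

theorem abs_min_zero_le (a : ℝ) : |min a 0| ≤ |a| := by
  simpa using abs_min_zero_sub_le a 0

/-- Squaring removes the corner of the negative part, so the classical chain rule applies both in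
space and in time. -/
theorem hasDerivAt_min_zero_sq (s : ℝ) : HasDerivAt (fun s : ℝ => min s 0 ^ 2) (2 * min s 0) s := by
  rcases lt_trichotomy s 0 with hs | rfl | hs
  · have : (fun s : ℝ => min s 0 ^ 2) =ᶠ[𝓝 s] fun s => s ^ 2 := by
      filter_upwards [Iio_mem_nhds hs] with y hy
      rw [min_eq_left (le_of_lt hy)]
    rw [min_eq_left hs.le]
    simpa using (hasDerivAt_pow 2 s).congr_of_eventuallyEq this
  · rw [hasDerivAt_iff_isLittleO]
    simp only [min_self, mul_zero, sub_zero, smul_zero, ne_eq, OfNat.ofNat_ne_zero,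
      not_false_eq_true, zero_pow]
    refine Asymptotics.IsBigO.trans_isLittleO (g := fun x : ℝ => x ^ 2) ?_ ?_
    · refine Asymptotics.IsBigO.of_bound 1 (Eventually.of_forall fun x => ?_)
      rw [one_mul, norm_pow, norm_pow]
      exact pow_le_pow_left₀ (norm_nonneg _) (abs_min_zero_le x) 2
    · simpa using Asymptotics.isLittleO_pow_id (𝕜 := ℝ) one_lt_two
  · have : (fun s : ℝ => min s 0 ^ 2) =ᶠ[𝓝 s] fun _ => 0 := by
      filter_upwards [Ioi_mem_nhds hs] with y hy
      rw [min_eq_right (le_of_lt hy)]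
      simp
    rw [min_eq_right hs.le, mul_zero]
    exact (hasDerivAt_const s (0 : ℝ)).congr_of_eventuallyEq this

theorem MemLp.min_zero {f : ℝ → ℝ} (hf : MemLp f 2) : MemLp (fun x => min (f x) 0) 2 :=
  hf.mono (hf.1.inf aestronglyMeasurable_const)
    (Eventually.of_forall fun x => abs_min_zero_le (f x))

theorem l2norm_min_zero_le {f : ℝ → ℝ} (hf : MemLp f 2) :
    l2norm (fun x => min (f x) 0) ≤ l2norm f :=
  (l2norm_mono hf.abs fun x => abs_min_zero_le (f x)).trans_eq (l2norm_abs f)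

namespace IsVelocity

variable {K : ℝ} {U V m ρ : ℝ → ℝ}

/-- The dissipation estimate for the negative part of the mollified momentum. -/
theorem integral_min_zero_mul_transport_le (h : IsVelocity K U V) (hm : Measurable m)
    (hm2 : MemLp m 2) (hρ : ContDiff ℝ ∞ ρ) (hs : HasCompactSupport ρ) (hρ0 : ∀ z, 0 ≤ ρ z)
    (hρ1 : ∫ z, ρ z = 1) (b : ℝ) :
    ∫ x, -(2 * min (conv ρ m x) 0 * transport b U V ρ m x)
      ≤ (1 + 2 * |b|) * K * (∫ x, min (conv ρ m x) 0 ^ 2)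
        + 2 * l2norm m * l2norm (commutator b U V ρ m) := by
  have hK := h.nonneg
  have hρ' : Continuous (deriv ρ) := hρ.continuous_deriv (by simp)
  have hM := memLp_conv hρ.continuous hs hm hm2
  have hM' := memLp_conv hρ' hs.deriv hm hm2
  have hr := h.memLp_commutator hm hm2 hρ hs b
  have hn := MemLp.min_zero hM
  have hlm : LocallyIntegrable m := hm2.locallyIntegrable (by norm_num)
  set n : ℝ → ℝ := fun x => min (conv ρ m x) 0 with hndef
  have hn2 : Integrable fun x => n x ^ 2 := hn.integrable_sq
  have i1 : Integrable fun x => V x * n x ^ 2 :=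
    hn2.bdd_mul h.continuous_deriv.aestronglyMeasurable (Eventually.of_forall h.abs_deriv_le)
  have i1' : Integrable fun x => U x * n x ^ 2 :=
    hn2.bdd_mul h.continuous.aestronglyMeasurable (Eventually.of_forall h.abs_le)
  have i2 : Integrable fun x => U x * (2 * n x * conv (deriv ρ) m x) := by
    have := ((hn.integrable_mul hM').const_mul 2).bdd_mul
      h.continuous.aestronglyMeasurable (Eventually.of_forall h.abs_le)
    refine this.congr (Eventually.of_forall fun x => ?_)
    simp only [Pi.mul_apply]
    ring
  have i3 : Integrable fun x => n x * commutator b U V ρ m x := hn.integrable_mul hr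
  -- The integral of (U n²)' vanishes. This trades the term 2 n U (ρ * m)' for V n², so that no
  -- derivative of the mollified momentum survives in the estimate.
  have hzero : ∫ x, (V x * n x ^ 2 + U x * (2 * n x * conv (deriv ρ) m x)) = 0 := by
    refine integral_eq_zero_of_hasDerivAt_of_integrable (f := fun x => U x * n x ^ 2)
      (fun x => ?_) (i1.add i2) i1'
    exact (h.hasDerivAt x).mul ((hasDerivAt_min_zero_sq _).comp x
      (hasDerivAt_conv (hρ.of_le (by simp)) hs hlm x))
  have hnM : ∀ x, n x * conv ρ m x = n x ^ 2 := by
    intro x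
    simp only [hndef]
    rcases le_total (conv ρ m x) 0 with hx | hx
    · rw [min_eq_left hx, sq]
    · rw [min_eq_right hx]
      ring
  have e : ∫ x, -(2 * n x * transport b U V ρ m x)
      = (1 - 2 * b) * (∫ x, V x * n x ^ 2) - 2 * (∫ x, n x * commutator b U V ρ m x) := by
    have : ∫ x, -(2 * n x * transport b U V ρ m x)
        = ∫ x, ((1 - 2 * b) * (V x * n x ^ 2) - 2 * (n x * commutator b U V ρ m x)
          - (V x * n x ^ 2 + U x * (2 * n x * conv (deriv ρ) m x))) := by
      congr 1
      funext x
      rw [commutator]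
      linear_combination (-2 * b * V x) * hnM x
    rw [this, integral_sub, hzero, sub_zero, integral_sub (i1.const_mul _) (i3.const_mul _),
      integral_const_mul, integral_const_mul]
    · exact (i1.const_mul _).sub (i3.const_mul _)
    · exact i1.add i2
  rw [e]
  have hV : |∫ x, V x * n x ^ 2| ≤ K * ∫ x, n x ^ 2 := by
    rw [← integral_const_mul, ← Real.norm_eq_abs]
    refine norm_integral_le_of_norm_le (hn2.const_mul K) (Eventually.of_forall fun x => ?_)
    rw [norm_mul, Real.norm_eq_abs, Real.norm_eq_abs, abs_of_nonneg (sq_nonneg (n x))]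
    exact mul_le_mul_of_nonneg_right (h.abs_deriv_le x) (sq_nonneg _)
  have hnr := abs_integral_mul_le hn hr
  have hρa : ∫ z, |ρ z| = 1 := by
    rw [← hρ1]
    congr 1
    funext z
    exact abs_of_nonneg (hρ0 z)
  have hnm : l2norm n ≤ l2norm m := by
    have := l2norm_conv_le hρ.continuous hs hm hm2
    rw [hρa, one_mul] at this
    exact (l2norm_min_zero_le hM).trans this
  have h1 : (1 - 2 * b) * (∫ x, V x * n x ^ 2) ≤ (1 + 2 * |b|) * (K * ∫ x, n x ^ 2) := by
    refine (le_abs_self _).trans ?_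
    rw [abs_mul]
    have hb : |1 - 2 * b| ≤ 1 + 2 * |b| := by
      refine (abs_sub _ _).trans ?_
      rw [abs_mul]
      simp
    gcongr
  have h2 : -(2 * (∫ x, n x * commutator b U V ρ m x))
      ≤ 2 * (l2norm m * l2norm (commutator b U V ρ m)) := by
    have := neg_le_abs (∫ x, n x * commutator b U V ρ m x)
    have := mul_le_mul_of_nonneg_right hnm (l2norm_nonneg (commutator b U V ρ m))
    linarith
  linarith

end IsVelocity

/-- Grönwall's inequality in integral form. -/
theorem le_exp_of_le_integral {Φ : ℝ → ℝ} (hΦ : Continuous Φ) {a C T : ℝ} (hC : 0 < C)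
    (h : ∀ t ∈ Icc 0 T, Φ t ≤ C * (∫ s in (0 : ℝ)..t, Φ s) + a) :
    ∀ t ∈ Icc 0 T, Φ t ≤ a * Real.exp (C * t) := by
  intro t ht
  have hd : ∀ x, HasDerivAt (fun t => ∫ s in (0 : ℝ)..t, Φ s) (Φ x) x :=
    (IsPrimitive.of_integral hΦ.locallyIntegrable 0).hasDerivAt hΦ
  -- The differential form is applied to the primitive of Φ, which starts at zero and has derivative
  -- at most C times itself plus a. Inserting its bound in the hypothesis gives the bound for Φ.
  have := le_gronwallBound_of_liminf_deriv_right_le (f := fun t => ∫ s in (0 : ℝ)..t, Φ s)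
    (f' := Φ) (δ := 0) (K := C) (ε := a) (a := 0) (b := T)
    (continuous_iff_continuousAt.2 fun x => (hd x).continuousAt).continuousOn
    (fun x _ r hr => (hd x).hasDerivWithinAt.liminf_right_slope_le hr)
    (by simp) (fun x hx => h x ⟨hx.1, hx.2.le⟩) t ht
  rw [gronwallBound_of_K_ne_0 hC.ne'] at this
  have h2 := h t ht
  have h3 := mul_le_mul_of_nonneg_left this hC.le
  have e : C * (0 * Real.exp (C * (t - 0)) + a / C * (Real.exp (C * (t - 0)) - 1))
      = a * Real.exp (C * t) - a := by
    rw [sub_zero]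
    field_simp
    ring
  linarith

theorem measurable_coe (f : Lp ℝ 2 (volume : Measure ℝ)) : Measurable f :=
  (Lp.stronglyMeasurable f).measurable

namespace SobolevH2

theorem isVelocity (v : SobolevH2) : IsVelocity (2 * ‖v‖) (rep v) (repDx v) where
  hasDerivAt := hasDerivAt_rep v
  continuous_deriv := continuous_repDx v
  abs_le := abs_rep_le v
  abs_deriv_le := abs_repDx_le v
  abs_deriv_sub_le x y := (abs_repDx_sub_le v x y).trans (by
    gcongr
    linarith [norm_nonneg v])

/-- The mollified transport term of the momentum equation. -/
noncomputable def transport (b : ℝ) (ρ : ℝ → ℝ) (v : SobolevH2) : ℝ → ℝ :=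
  IsVelocity.transport b (rep v) (repDx v) ρ (momentum v)

/-- The representatives `rep` and `repDx` come from a choice made separately for each `v`. Returning
to the L² classes makes the expression bilinear in continuous functions of `v`. -/
theorem transport_eq (b : ℝ) (ρ : ℝ → ℝ) (v : SobolevH2) (x : ℝ) :
    transport b ρ v x = (∫ y, fn v y * momentum v y * deriv ρ (x - y))
      + (b - 1) * ∫ y, dx v y * momentum v y * ρ (x - y) := by
  rw [transport, IsVelocity.transport, conv_eq_integral_sub, conv_eq_integral_sub]
  congr 1
  · refine integral_congr_ae ?_
    filter_upwards [fn_ae v] with y hy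
    rw [hy]
  · congr 1
    refine integral_congr_ae ?_
    filter_upwards [dx_ae v] with y hy
    rw [hy]

theorem continuous_transport (b : ℝ) {ρ : ℝ → ℝ} (hρ : ContDiff ℝ ∞ ρ) (hs : HasCompactSupport ρ)
    (x : ℝ) : Continuous fun v => transport b ρ v x := by
  simp only [fun v => transport_eq b ρ v x]
  have hρ' : Continuous (deriv ρ) := hρ.continuous_deriv (by simp)
  obtain ⟨C, hC⟩ := hs.exists_bound_of_continuous hρ.continuous
  obtain ⟨C', hC'⟩ := hs.deriv.exists_bound_of_continuous hρ'
  have := hρ.continuous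
  refine Continuous.add ?_ (Continuous.const_mul ?_ _)
  · exact (continuous_integral_mul_mul (w := fun y => deriv ρ (x - y)) (by fun_prop)
      fun y => hC' _).comp (continuous_fn.prodMk continuous_momentum)
  · exact (continuous_integral_mul_mul (w := fun y => ρ (x - y)) (by fun_prop)
      fun y => hC _).comp (continuous_dx.prodMk continuous_momentum)

theorem continuous_conv_momentum {ρ : ℝ → ℝ} (hρ : Continuous ρ) (hs : HasCompactSupport ρ)
    (x : ℝ) : Continuous fun v => conv ρ (momentum v) x := by
  simp only [fun v : SobolevH2 => conv_eq_integral_sub ρ (momentum v) x]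
  refine (continuous_integral_mul (χ := fun y => ρ (x - y)) ?_).comp continuous_momentum
  exact (hρ.memLp_of_hasCompactSupport hs).comp_measurePreserving
    (Measure.measurePreserving_sub_left volume x)

end SobolevH2

/-- The integral of |ρ'| is not uniform in the mollification scale; the bound serves only to justify
Fubini's theorem for a fixed mollifier. -/
theorem IsVelocity.l2norm_transport_le {K : ℝ} {U V m ρ : ℝ → ℝ} (h : IsVelocity K U V)
    (hm : Measurable m) (hm2 : MemLp m 2) (hρ : ContDiff ℝ ∞ ρ) (hs : HasCompactSupport ρ)
    (b : ℝ) : l2norm (transport b U V ρ m)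
      ≤ ((∫ z, |deriv ρ z|) + |b - 1| * ∫ z, |ρ z|) * (K * l2norm m) := by
  have hρ' : Continuous (deriv ρ) := hρ.continuous_deriv (by simp)
  have mU := memLp_conv hρ' hs.deriv (h.continuous.measurable.mul hm) (h.memLp_mul hm2)
  have mV := memLp_conv hρ.continuous hs (h.continuous_deriv.measurable.mul hm)
    (h.memLp_deriv_mul hm2)
  have h1 := l2norm_conv_le hρ' hs.deriv (h.continuous.measurable.mul hm) (h.memLp_mul hm2)
  have h2 := l2norm_conv_le hρ.continuous hs (h.continuous_deriv.measurable.mul hm)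
    (h.memLp_deriv_mul hm2)
  have h3 := l2norm_add_le mU (mV.const_mul (b - 1))
  have h4 := l2norm_const_mul (b - 1) (conv ρ fun y => V y * m y)
  have h5 := l2norm_bounded_mul_le h.nonneg hm2 h.abs_le
  have h6 := l2norm_bounded_mul_le h.nonneg hm2 h.abs_deriv_le
  have p1 : 0 ≤ ∫ z, |deriv ρ z| := integral_nonneg fun _ => abs_nonneg _
  have p2 : 0 ≤ ∫ z, |ρ z| := integral_nonneg fun _ => abs_nonneg _
  have h7 := mul_le_mul_of_nonneg_left h5 p1
  have h8 := mul_le_mul_of_nonneg_left (h2.trans (mul_le_mul_of_nonneg_left h6 p2))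
    (abs_nonneg (b - 1))
  calc _ ≤ _ := h3
    _ ≤ (∫ z, |deriv ρ z|) * (K * l2norm m) + |b - 1| * ((∫ z, |ρ z|) * (K * l2norm m)) := by
      refine add_le_add (h1.trans h7) (h4.le.trans h8)
    _ = _ := by ring

theorem SobolevH2.l2norm_momentum_le (v : SobolevH2) : l2norm (momentum v) ≤ 2 * ‖v‖ := by
  rw [l2norm_coe]
  refine (norm_sub_le _ _).trans ?_
  linarith [norm_fn_le v, norm_dxx_le v]

/-! ### Persistence of the sign of the momentum -/

namespace IsGlobalSolution

open SobolevH2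

variable {b : ℝ} {u : ℝ → SobolevH2}

/-- The test function y ↦ ρ(x - y) gives, for each fixed x, an integral equation in time with
continuous integrand, so regularity of m in space plays no role. -/
theorem conv_momentum_sub (hu : IsGlobalSolution b u) {ρ : ℝ → ℝ} (hρ : ContDiff ℝ ∞ ρ)
    (hs : HasCompactSupport ρ) (x : ℝ) {t : ℝ} (ht : 0 ≤ t) :
    conv ρ (momentum (u t)) x
      = conv ρ (momentum (u 0)) x - ∫ τ in (0 : ℝ)..t, SobolevH2.transport b ρ (u (max τ 0)) x := by
  have hc : ContDiff ℝ ∞ fun y => ρ (x - y) := hρ.comp (contDiff_const.sub contDiff_id)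
  have hcs : HasCompactSupport fun y => ρ (x - y) :=
    hs.comp_homeomorph (Homeomorph.subLeft x)
  have hd : ∀ y, deriv (fun y => ρ (x - y)) y = -deriv ρ (x - y) := by
    intro y
    exact deriv_comp_const_sub ρ x y
  have h := hu.integral_momentum_mul_sub hc hcs le_rfl ht
  rw [← conv_eq_integral_sub, ← conv_eq_integral_sub] at h
  rw [sub_eq_iff_eq_add'.1 h, eq_sub_iff_add_eq, add_assoc, add_eq_left, add_eq_zero_iff_eq_neg,
    ← intervalIntegral.integral_neg]
  refine intervalIntegral.integral_congr fun τ hτ => ?_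
  rw [uIcc_of_le ht] at hτ
  simp only [max_eq_left hτ.1, SobolevH2.transport, IsVelocity.transport, conv_eq_integral_sub, hd,
    mul_neg, integral_neg]
  ring

/-- The negative part of the mollified momentum grows at most with the commutator. -/
theorem integral_min_zero_sq_le (hu : IsGlobalSolution b u)
    (h0 : ∀ᵐ x, 0 ≤ momentum (u 0) x) {ρ : ℝ → ℝ} (hρ : ContDiff ℝ ∞ ρ)
    (hs : HasCompactSupport ρ) (hρ0 : ∀ z, 0 ≤ ρ z) (hρ1 : ∫ z, ρ z = 1) {T B δ : ℝ} (hB0 : 0 < B)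
    (hB : ∀ t ∈ Icc 0 T, ‖u t‖ ≤ B)
    (hδ : ∀ t ∈ Icc 0 T, l2norm (IsVelocity.commutator b (rep (u t)) (repDx (u t)) ρ
      (momentum (u t))) ≤ δ) :
    ∀ t ∈ Icc 0 T, ∫ x, min (conv ρ (momentum (u t)) x) 0 ^ 2
      ≤ 4 * B * δ * T * Real.exp ((1 + 2 * |b|) * (2 * B) * t) := by
  let w : ℝ → SobolevH2 := fun t => u (max t 0)
  have hw : Continuous w := hu.continuous_max
  have hwt : ∀ {t}, 0 ≤ t → w t = u t := fun ht => by simp only [w, max_eq_left ht]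
  let M : ℝ → ℝ → ℝ := fun t x => conv ρ (momentum (w t)) x
  let N : ℝ → ℝ → ℝ := fun t x => SobolevH2.transport b ρ (w t) x
  have hl : ∀ v : SobolevH2, LocallyIntegrable (momentum v) := fun v =>
    (Lp.memLp _).locallyIntegrable (by norm_num)
  have hMt : ∀ x, Continuous fun t => M t x := fun x =>
    (continuous_conv_momentum hρ.continuous hs x).comp hw
  have hNt : ∀ x, Continuous fun t => N t x := fun x => (continuous_transport b hρ hs x).comp hw
  have hMx : ∀ t, Continuous (M t) := fun t => continuous_conv hρ.continuous hs (hl _)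
  have hNx : ∀ t, Continuous (N t) := fun t =>
    (continuous_conv (hρ.continuous_deriv (by simp)) hs.deriv
      ((hl _).continuous_mul (continuous_rep _))).add
    ((continuous_conv hρ.continuous hs ((hl _).continuous_mul (continuous_repDx _))).const_mul _)
  let D : ℝ → ℝ → ℝ := fun t x => -(2 * min (M t x) 0 * N t x)
  have hDt : ∀ x, Continuous fun t => D t x := fun x =>
    (((hMt x).min continuous_const).const_mul 2 |>.mul (hNt x)).neg
  have hDx : ∀ t, Continuous (D t) := fun t =>
    (((hMx t).min continuous_const).const_mul 2 |>.mul (hNx t)).neg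
  have hDm : StronglyMeasurable (Function.uncurry D) :=
    stronglyMeasurable_uncurry_of_continuous_of_stronglyMeasurable hDt
      fun t => (hDx t).stronglyMeasurable
  have hM2 : ∀ t, MemLp (M t) 2 := fun t =>
    memLp_conv hρ.continuous hs (measurable_coe _) (Lp.memLp _)
  have hN2 : ∀ t, MemLp (N t) 2 := fun t =>
    (isVelocity (w t)).memLp_transport (measurable_coe _) (Lp.memLp _) hρ hs b
  have hn2 : ∀ t, MemLp (fun x => min (M t x) 0) 2 := fun t => MemLp.min_zero (hM2 t)
  have hρa : ∫ z, |ρ z| = 1 := by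
    rw [← hρ1]
    congr 1
    funext z
    exact abs_of_nonneg (hρ0 z)
  have hDi : ∀ t, Integrable (D t) := fun t => by
    refine (((hn2 t).integrable_mul (hN2 t)).const_mul (-2)).congr
      (Eventually.of_forall fun x => ?_)
    simp only [Pi.mul_apply, D]
    ring
  have hBm : ∀ t ∈ Icc 0 T, l2norm (momentum (w t)) ≤ 2 * B := fun t ht => by
    rw [hwt ht.1]
    linarith [l2norm_momentum_le (u t), hB t ht]
  obtain ⟨R, hR⟩ : ∃ R, ∀ t ∈ Icc 0 T, ∫ x, ‖D t x‖ ≤ R := by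
    refine ⟨2 * (2 * B * (((∫ z, |deriv ρ z|) + |b - 1| * ∫ z, |ρ z|) * (2 * B * (2 * B)))),
      fun t ht => ?_⟩
    have e : ∫ x, ‖D t x‖ = 2 * ∫ x, |min (M t x) 0| * |N t x| := by
      rw [← integral_const_mul]
      congr 1
      funext x
      simp only [D, Real.norm_eq_abs, abs_neg, abs_mul, abs_two]
      ring
    rw [e]
    have h1 := (le_abs_self _).trans (abs_integral_mul_le (hn2 t).abs (hN2 t).abs)
    have h2 : l2norm |fun x => min (M t x) 0| ≤ 2 * B := by
      have h3 := l2norm_conv_le hρ.continuous hs (measurable_coe (momentum (w t))) (Lp.memLp _)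
      rw [hρa, one_mul] at h3
      exact (l2norm_abs _).le.trans (((l2norm_min_zero_le (hM2 t)).trans h3).trans (hBm t ht))
    have hv := isVelocity (w t)
    have h4 : l2norm |N t| ≤ ((∫ z, |deriv ρ z|) + |b - 1| * ∫ z, |ρ z|) * (2 * B * (2 * B)) := by
      refine (l2norm_abs _).le.trans ((hv.l2norm_transport_le (measurable_coe _)
        (Lp.memLp _) hρ hs b).trans ?_)
      have p1 : 0 ≤ ∫ z, |deriv ρ z| := integral_nonneg fun _ => abs_nonneg _
      have p2 : 0 ≤ ∫ z, |ρ z| := integral_nonneg fun _ => abs_nonneg _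
      have hBt : ‖w t‖ ≤ B := by
        rw [hwt ht.1]
        exact hB t ht
      gcongr
      · exact l2norm_nonneg _
      · exact hBm t ht
    have h5 : ∫ x, |min (M t x) 0| * |N t x| ≤ l2norm |fun x => min (M t x) 0| * l2norm |N t| := h1
    have := mul_le_mul h2 h4 (l2norm_nonneg _) (by positivity)
    linarith
  have hDprod : Integrable (Function.uncurry D) ((volume.restrict (Ioc 0 T)).prod volume) := by
    rw [integrable_prod_iff hDm.aestronglyMeasurable]
    refine ⟨Eventually.of_forall hDi, ?_⟩
    refine Integrable.of_bound (C := R)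
      (hDm.norm.integral_prod_right (f := fun t x => ‖D t x‖)).aestronglyMeasurable ?_
    refine (ae_restrict_iff' measurableSet_Ioc).2 (Eventually.of_forall fun t ht => ?_)
    rw [Real.norm_eq_abs, abs_of_nonneg (integral_nonneg fun _ => norm_nonneg _)]
    exact hR t (Ioc_subset_Icc_self ht)
  let E : ℝ → ℝ := fun t => ∫ x, min (M t x) 0 ^ 2
  let g : ℝ → ℝ := fun t => ∫ x, D t x
  have hgi : IntegrableOn g (Ioc 0 T) := hDprod.integral_prod_left
  -- Integrability of `g` is known only on (0, T]; truncation gives a primitive that is continuous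
  -- on the whole line.
  let g' : ℝ → ℝ := (Ioc 0 T).indicator g
  have hg'i : Integrable g' := (integrable_indicator_iff measurableSet_Ioc).2 hgi
  let Φ : ℝ → ℝ := fun t => ∫ τ in (0 : ℝ)..t, g' τ
  have hΦc : Continuous Φ := intervalIntegral.continuous_primitive
    (fun _ _ => hg'i.intervalIntegrable) 0
  have hEΦ : ∀ t ∈ Icc 0 T, E t = Φ t := by
    intro t ht
    have hx : ∀ x, min (M t x) 0 ^ 2 = ∫ τ in Ioc 0 t, D τ x := by
      intro x
      -- `M` is frozen for negative times and may have a corner at zero. `G` agrees with it for t ≥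
      -- 0 and is differentiable everywhere.
      let G : ℝ → ℝ := fun t => M 0 x - ∫ τ in (0 : ℝ)..t, N τ x
      have hG : ∀ t, HasDerivAt G (-N t x) t := fun t => by
        have := ((IsPrimitive.of_integral (hNt x).locallyIntegrable 0).hasDerivAt (hNt x)
          t).const_sub (M 0 x)
        exact this
      have hGM : ∀ τ, 0 ≤ τ → G τ = M τ x := fun τ hτ => by
        have := hu.conv_momentum_sub hρ hs x hτ
        simp only [M, G, hwt hτ, hwt le_rfl]
        rw [this]
      -- The nonnegative kernel keeps the sign of the initial momentum, so the energy starts from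
      -- zero.
      have hM0 : 0 ≤ M 0 x := by
        simp only [M, hwt le_rfl]
        exact conv_nonneg hρ0 h0 x
      have hint := intervalIntegral.integral_eq_sub_of_hasDerivAt (a := 0) (b := t)
        (fun τ _ => (hasDerivAt_min_zero_sq (G τ)).comp τ (hG τ)) (by
          refine Continuous.intervalIntegrable ?_ _ _
          have hGc : Continuous G := continuous_iff_continuousAt.2 fun τ => (hG τ).continuousAt
          have := hNt x
          fun_prop)
      simp only [Function.comp_apply, hGM t ht.1, hGM 0 le_rfl, min_eq_right hM0] at hint
      rw [← intervalIntegral.integral_of_le ht.1]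
      rw [zero_pow two_ne_zero, sub_zero] at hint
      rw [← hint]
      refine intervalIntegral.integral_congr fun τ hτ => ?_
      rw [uIcc_of_le ht.1] at hτ
      simp only [D, hGM τ hτ.1]
      ring
    have hsub : Ioc 0 t ⊆ Ioc 0 T := Ioc_subset_Ioc_right ht.2
    have hDprod' : Integrable (Function.uncurry D) ((volume.restrict (Ioc 0 t)).prod volume) :=
      hDprod.mono_measure (Measure.prod_mono (Measure.restrict_mono hsub le_rfl) le_rfl)
    simp only [E, hx]
    rw [← integral_integral_swap hDprod']
    simp only [Φ]
    rw [intervalIntegral.integral_of_le ht.1]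
    refine setIntegral_congr_fun measurableSet_Ioc fun τ hτ => ?_
    simp only [g']
    rw [indicator_of_mem (hsub hτ)]
  -- Both the velocity bound and the L² norm of m are at most 2B; the latter turns the commutator
  -- term into 2 · 2B · δ.
  have hδ0 : ∀ t ∈ Icc 0 T, g t ≤ (1 + 2 * |b|) * (2 * B) * E t + 4 * B * δ := by
    intro t ht
    have hv := (isVelocity (w t)).mono (K' := 2 * B) (by
      rw [hwt ht.1]
      linarith [hB t ht])
    refine (hv.integral_min_zero_mul_transport_le (measurable_coe _) (Lp.memLp _)
      hρ hs hρ0 hρ1 b).trans ?_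
    have h1 := hδ t ht
    rw [← hwt ht.1] at h1
    have h2 := hBm t ht
    have h3 : 2 * l2norm (momentum (w t)) * l2norm (IsVelocity.commutator b (rep (w t))
        (repDx (w t)) ρ (momentum (w t))) ≤ 2 * (2 * B) * δ := by
      have := l2norm_nonneg (momentum (w t))
      have := l2norm_nonneg (IsVelocity.commutator b (rep (w t)) (repDx (w t)) ρ (momentum (w t)))
      gcongr
    simp only [E, M]
    linarith
  have hgron := le_exp_of_le_integral hΦc (a := 4 * B * δ * T) (C := (1 + 2 * |b|) * (2 * B))
    (T := T) (by positivity) (by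
      intro t ht
      have hδn : 0 ≤ δ := (l2norm_nonneg _).trans (hδ t ht)
      have h1 : Φ t ≤ ∫ τ in (0 : ℝ)..t, ((1 + 2 * |b|) * (2 * B) * Φ τ + 4 * B * δ) := by
        refine intervalIntegral.integral_mono_on ht.1 hg'i.intervalIntegrable
          (Continuous.intervalIntegrable (by fun_prop) _ _) fun τ hτ => ?_
        have hτT : τ ∈ Icc 0 T := ⟨hτ.1, hτ.2.trans ht.2⟩
        rw [← hEΦ τ hτT]
        have hEn : 0 ≤ E τ := integral_nonneg fun _ => sq_nonneg _
        by_cases hm : τ ∈ Ioc 0 T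
        · simp only [g']
          rw [indicator_of_mem hm]
          exact hδ0 τ hτT
        · simp only [g']
          rw [indicator_of_notMem hm]
          positivity
      rw [intervalIntegral.integral_add (Continuous.intervalIntegrable (by fun_prop) _ _)
        (by simp), intervalIntegral.integral_const_mul, intervalIntegral.integral_const,
        smul_eq_mul, sub_zero] at h1
      have h2 : t * (4 * B * δ) ≤ 4 * B * δ * T := by
        rw [mul_comm]
        exact mul_le_mul_of_nonneg_left ht.2 (by positivity)
      linarith)
  intro t ht
  have := hgron t ht
  rw [← hEΦ t ht] at this
  simpa only [E, M, hwt ht.1] using this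

/-- The momentum stays nonnegative. -/
theorem momentum_nonneg (hu : IsGlobalSolution b u) (h0 : ∀ᵐ x, 0 ≤ momentum (u 0) x) {t : ℝ}
    (ht : 0 ≤ t) : ∀ᵐ x, 0 ≤ momentum (u t) x := by
  let w : ℝ → SobolevH2 := fun t => u (max t 0)
  have hw : Continuous w := hu.continuous_max
  have hwt : ∀ {t}, 0 ≤ t → w t = u t := fun ht => by simp only [w, max_eq_left ht]
  obtain ⟨B0, hB0⟩ := (isCompact_Icc (a := 0) (b := t)).exists_bound_of_continuousOn hw.continuousOn
  let B := max B0 1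
  have hB1 : 1 ≤ B := le_max_right _ _
  have hB : ∀ s ∈ Icc 0 t, ‖u s‖ ≤ B := fun s hs => by
    rw [← hwt hs.1]
    exact (hB0 s hs).trans (le_max_left _ _)
  have hBm : ∀ s ∈ Icc 0 t, l2norm (momentum (u s)) ≤ 2 * B := fun s hs => by
    linarith [l2norm_momentum_le (u s), hB s hs]
  set m := momentum (u t) with hm
  have hm2 : MemLp m 2 := Lp.memLp _
  set P : ℝ := kernelMass baseBump with hP
  have hP0 : 0 ≤ P := kernelMass_nonneg _
  set Q : ℝ := P * (2 * B + 2 * B * (1 + |b - 1|) * (2 * B)) with hQ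
  set S : ℝ := 4 * B * t * Real.exp ((1 + 2 * |b|) * (2 * B) * t) * Q with hS
  -- The root bounds the negative part of the mollified momentum and the second η the mollification
  -- error. `S` does not depend on η, so η → 0 finishes the proof.
  have hest : ∀ η : ℝ, 0 < η → l2norm (fun x => min (m x) 0) ≤ √(S * η) + η := by
    intro η hη
    obtain ⟨δ, hδ, hδη⟩ := exists_forall_eLpNorm_sub_le (continuous_momentum.comp hw) t hη
    -- δ makes the translates of m η-close at all times in [0, t], and η² gives √ε ≤ η, so both
    -- parts of the commutator bound are of order η.
    let ε := min δ (η ^ 2)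
    have hε : 0 < ε := lt_min hδ (by positivity)
    have hsqrt : √ε ≤ η := by
      rw [Real.sqrt_le_left hη.le]
      exact min_le_right _ _
    have htrans : ∀ s ∈ Icc 0 t, ∀ z, |z| ≤ ε →
        eLpNorm (fun x => momentum (u s) (x - z) - momentum (u s) x) 2 volume
          ≤ ENNReal.ofReal η := by
      intro s hs z hz
      have := hδη s hs z (hz.trans (min_le_left _ _))
      simpa only [Function.comp_apply, hwt hs.1] using this
    have hρ := contDiff_mollifier ε
    have hs := hasCompactSupport_mollifier hε
    have hcomm : ∀ s ∈ Icc 0 t, l2norm (IsVelocity.commutator b (rep (u s)) (repDx (u s))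
        (mollifier ε) (momentum (u s))) ≤ Q * η := by
      intro s hst
      have hv := (isVelocity (u s)).mono (K' := 2 * B) (by linarith [hB s hst])
      refine (hv.l2norm_commutator_le (measurable_coe _) (Lp.memLp _) hρ hs b
        (fun z hz => mollifier_eq_zero hε hz) hη.le (htrans s hst)).trans ?_
      rw [kernelMass_mollifier hε, hQ, mul_assoc P]
      refine mul_le_mul_of_nonneg_left ?_ hP0
      have h1 : 2 * B * (1 + |b - 1|) * √ε * l2norm (momentum (u s))
          ≤ 2 * B * (1 + |b - 1|) * η * (2 * B) := by
        gcongr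
        · exact l2norm_nonneg _
        · exact hBm s hst
      linarith
    have hE := hu.integral_min_zero_sq_le h0 hρ hs (mollifier_nonneg hε) (integral_mollifier hε)
      (by linarith) hB hcomm t ⟨ht, le_rfl⟩
    rw [show 4 * B * (Q * η) * t * Real.exp ((1 + 2 * |b|) * (2 * B) * t) = S * η by
      rw [hS]; ring, ← hm] at hE
    have hM2 : MemLp (conv (mollifier ε) m) 2 :=
      memLp_conv hρ.continuous hs (measurable_coe _) hm2
    rw [← l2norm_sq (MemLp.min_zero hM2)] at hE
    have h1 : l2norm (fun x => min (conv (mollifier ε) m x) 0) ≤ √(S * η) :=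
      Real.le_sqrt_of_sq_le hE
    have h2 : l2norm (fun x => conv (mollifier ε) m x - m x) ≤ η := by
      have h3 := l2norm_conv_sub_le hρ.continuous hs (integral_mollifier hε) (measurable_coe m) hm2
        hη.le (fun z hz => htrans t ⟨ht, le_rfl⟩ z (by
          by_contra hn
          exact hz (mollifier_eq_zero hε (not_le.1 hn))))
      have h4 : ∫ z, |mollifier ε z| = 1 := by
        rw [← integral_mollifier hε]
        congr 1
        funext z
        exact abs_of_nonneg (mollifier_nonneg hε z)
      rwa [h4, one_mul] at h3
    have hd : MemLp (fun x => conv (mollifier ε) m x - m x) 2 := hM2.sub hm2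
    calc l2norm (fun x => min (m x) 0)
        ≤ l2norm (fun x => |min (conv (mollifier ε) m x) 0| + |conv (mollifier ε) m x - m x|) := by
          refine l2norm_mono ((MemLp.min_zero hM2).abs.add hd.abs) fun x => ?_
          have h5 := abs_min_zero_sub_le (conv (mollifier ε) m x) (m x)
          have h6 := abs_sub_abs_le_abs_sub (min (m x) 0) (min (conv (mollifier ε) m x) 0)
          rw [abs_sub_comm] at h6
          linarith
      _ ≤ _ := l2norm_add_le (MemLp.min_zero hM2).abs hd.abs
      _ ≤ √(S * η) + η := by
          refine add_le_add ((l2norm_abs _).le.trans h1) ((l2norm_abs _).le.trans h2)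
  have hlim : Tendsto (fun η : ℝ => √(S * η) + η) (𝓝[>] 0) (𝓝 0) := by
    have : Continuous fun η : ℝ => √(S * η) + η := by fun_prop
    have h2 := this.tendsto 0
    simp only [mul_zero, Real.sqrt_zero, add_zero] at h2
    exact h2.mono_left nhdsWithin_le_nhds
  have hzero : l2norm (fun x => min (m x) 0) ≤ 0 :=
    ge_of_tendsto hlim (eventually_nhdsWithin_of_forall fun η hη => hest η hη)
  have hmm : MemLp (fun x => min (m x) 0) 2 := MemLp.min_zero hm2
  have h1 : eLpNorm (fun x => min (m x) 0) 2 volume = 0 := by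
    rw [MemLp.eLpNorm_eq_ofReal hmm, ENNReal.ofReal_eq_zero]
    exact hzero
  rw [eLpNorm_eq_zero_iff hmm.1 (by norm_num)] at h1
  filter_upwards [h1] with x hx
  exact min_eq_right_iff.1 hx

end IsGlobalSolution

/-! ### Positivity of (1 - ∂ₓ²)⁻¹ -/

namespace IsPrimitive

variable {F G f g : ℝ → ℝ}

theorem add (hF : IsPrimitive F f) (hG : IsPrimitive G g) :
    IsPrimitive (fun x => F x + G x) (fun x => f x + g x) where
  locallyIntegrable := hF.locallyIntegrable.add hG.locallyIntegrable
  sub_eq a b := by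
    rw [intervalIntegral.integral_add (hF.intervalIntegrable a b) (hG.intervalIntegrable a b),
      ← hF.sub_eq, ← hG.sub_eq]
    ring

theorem sub (hF : IsPrimitive F f) (hG : IsPrimitive G g) :
    IsPrimitive (fun x => F x - G x) (fun x => f x - g x) where
  locallyIntegrable := hF.locallyIntegrable.sub hG.locallyIntegrable
  sub_eq a b := by
    rw [intervalIntegral.integral_sub (hF.intervalIntegrable a b) (hG.intervalIntegrable a b),
      ← hF.sub_eq, ← hG.sub_eq]
    ring

theorem monotone (hF : IsPrimitive F f) (hf : ∀ᵐ x, 0 ≤ f x) : Monotone F := by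
  intro a b hab
  rw [← sub_nonneg, hF.sub_eq]
  exact intervalIntegral.integral_nonneg_of_ae hab hf

theorem antitone (hF : IsPrimitive F f) (hf : ∀ᵐ x, f x ≤ 0) : Antitone F := by
  intro a b hab
  rw [← sub_nonpos, hF.sub_eq]
  have := intervalIntegral.integral_nonneg_of_ae (f := fun x => -f x) (μ := volume) hab (by
    filter_upwards [hf] with x hx
    simpa using hx)
  rw [intervalIntegral.integral_neg] at this
  linarith

end IsPrimitive

namespace SobolevH2

/-- The operator `(1 - ∂ₓ²)⁻¹` preserves nonnegativity. -/
theorem rep_nonneg {v : SobolevH2} (hm : ∀ᵐ x, 0 ≤ momentum v x) (x : ℝ) : 0 ≤ rep v x := by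
  have hU := isPrimitive_rep v
  have hV := isPrimitive_repDx v
  have he : IsPrimitive (fun x : ℝ => Real.exp x) (fun x => Real.exp x) := by
    simpa using IsPrimitive.of_contDiff Real.contDiff_exp
  have he' : IsPrimitive (fun x : ℝ => Real.exp (-x)) (fun x => -Real.exp (-x)) := by
    have h := IsPrimitive.of_contDiff (χ := fun x : ℝ => Real.exp (-x))
      (Real.contDiff_exp.comp contDiff_neg)
    have hd : deriv (fun x : ℝ => Real.exp (-x)) = fun x => -Real.exp (-x) := by
      funext x
      simpa using ((hasDerivAt_id x).neg.exp).deriv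
    rwa [hd] at h
  -- The derivative of eˣ(u - uₓ) is eˣm ≥ 0 and the function tends to zero at -∞, so u - uₓ ≥ 0.
  -- Symmetrically e⁻ˣ(u + uₓ) decreases to zero at +∞. Adding the two inequalities gives 2u ≥ 0.
  have hmono : Monotone fun x => Real.exp x * (rep v x - repDx v x) := by
    refine (he.mul (hU.sub hV)).monotone ?_
    filter_upwards [hm, momentum_ae v, fn_ae v] with x h1 h2 h3
    rw [h2, h3] at h1
    have := mul_nonneg (Real.exp_pos x).le h1
    linarith
  have hanti : Antitone fun x => Real.exp (-x) * (rep v x + repDx v x) := by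
    refine (he'.mul (hU.add hV)).antitone ?_
    filter_upwards [hm, momentum_ae v, fn_ae v] with x h1 h2 h3
    rw [h2, h3] at h1
    have := mul_nonneg (Real.exp_pos (-x)).le h1
    linarith
  have hb1 : ∀ y, |rep v y - repDx v y| ≤ 4 * ‖v‖ := fun y => by
    refine (abs_sub _ _).trans ?_
    linarith [abs_rep_le v y, abs_repDx_le v y]
  have hb2 : ∀ y, |rep v y + repDx v y| ≤ 4 * ‖v‖ := fun y => by
    refine (abs_add_le _ _).trans ?_
    linarith [abs_rep_le v y, abs_repDx_le v y]
  have l1 : Tendsto (fun y => Real.exp y * (rep v y - repDx v y)) atBot (𝓝 0) := by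
    refine squeeze_zero_norm (a := fun y => Real.exp y * (4 * ‖v‖)) (fun y => ?_) ?_
    · rw [norm_mul, Real.norm_eq_abs, Real.norm_eq_abs, abs_of_pos (Real.exp_pos y)]
      exact mul_le_mul_of_nonneg_left (hb1 y) (Real.exp_pos y).le
    · simpa using Real.tendsto_exp_atBot.mul_const (4 * ‖v‖)
  have l2 : Tendsto (fun y => Real.exp (-y) * (rep v y + repDx v y)) atTop (𝓝 0) := by
    refine squeeze_zero_norm (a := fun y => Real.exp (-y) * (4 * ‖v‖)) (fun y => ?_) ?_
    · rw [norm_mul, Real.norm_eq_abs, Real.norm_eq_abs, abs_of_pos (Real.exp_pos _)]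
      exact mul_le_mul_of_nonneg_left (hb2 y) (Real.exp_pos _).le
    · simpa using (Real.tendsto_exp_atBot.comp tendsto_neg_atTop_atBot).mul_const (4 * ‖v‖)
  have h1 : 0 ≤ Real.exp x * (rep v x - repDx v x) := hmono.le_of_tendsto l1 x
  have h2 : 0 ≤ Real.exp (-x) * (rep v x + repDx v x) := hanti.le_of_tendsto l2 x
  have h3 := nonneg_of_mul_nonneg_right h1 (Real.exp_pos x)
  have h4 := nonneg_of_mul_nonneg_right h2 (Real.exp_pos (-x))
  linarith

theorem fn_nonneg {v : SobolevH2} (hm : ∀ᵐ x, 0 ≤ momentum v x) : ∀ᵐ x, 0 ≤ fn v x := by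
  filter_upwards [fn_ae v] with x hx
  rw [hx]
  exact rep_nonneg hm x

end SobolevH2

/-! ### Cutoffs, integrability of u and bounds on the flux -/

/-- A smooth cutoff function: one on `[-1, 1]`, zero outside `[-2, 2]`. -/
noncomputable def cutoff : ℝ → ℝ :=
  (⟨1, 2, by norm_num, by norm_num⟩ : ContDiffBump (0 : ℝ))

theorem contDiff_cutoff : ContDiff ℝ ∞ cutoff := ContDiffBump.contDiff _

theorem hasCompactSupport_cutoff : HasCompactSupport cutoff := ContDiffBump.hasCompactSupport _

theorem cutoff_nonneg (x : ℝ) : 0 ≤ cutoff x := ContDiffBump.nonneg _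

theorem cutoff_le_one (x : ℝ) : cutoff x ≤ 1 := ContDiffBump.le_one _

theorem abs_cutoff_le_one (x : ℝ) : |cutoff x| ≤ 1 := by
  rw [abs_of_nonneg (cutoff_nonneg x)]
  exact cutoff_le_one x

theorem cutoff_eq_one {x : ℝ} (hx : |x| ≤ 1) : cutoff x = 1 :=
  ContDiffBump.one_of_mem_closedBall _ (by simpa using hx)

theorem tsupport_cutoff : tsupport cutoff = Metric.closedBall 0 2 := ContDiffBump.tsupport_eq _

section scaling

variable {χ : ℝ → ℝ}

theorem contDiff_comp_mul (hχ : ContDiff ℝ ∞ χ) (c : ℝ) : ContDiff ℝ ∞ fun x => χ (c * x) :=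
  hχ.comp (contDiff_const.mul contDiff_id)

theorem hasCompactSupport_comp_mul (hs : HasCompactSupport χ) {c : ℝ} (hc : c ≠ 0) :
    HasCompactSupport fun x => χ (c * x) :=
  hs.comp_homeomorph (Homeomorph.mulLeft₀ c hc)

theorem deriv_comp_mul (χ : ℝ → ℝ) (c : ℝ) :
    deriv (fun x => χ (c * x)) = fun x => c * deriv χ (c * x) := by
  funext x
  exact deriv_comp_mul_left c χ x

theorem deriv_deriv_comp_mul (χ : ℝ → ℝ) (c : ℝ) :
    deriv (deriv fun x => χ (c * x)) = fun x => c ^ 2 * deriv (deriv χ) (c * x) := by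
  rw [deriv_comp_mul]
  funext x
  have h := congr_fun (deriv_comp_mul (deriv χ) c) x
  rw [deriv_const_mul_field, h]
  ring

end scaling

theorem integrable_mul_bounded {k w : ℝ → ℝ} {D : ℝ} (hk : Integrable k) (hw : Continuous w)
    (hD : ∀ x, |w x| ≤ D) : Integrable fun x => k x * w x := by
  simpa [mul_comm] using hk.bdd_mul hw.aestronglyMeasurable (Eventually.of_forall hD)

/-- A nonnegative function whose integrals against dilated cutoffs are bounded is integrable. -/
theorem integrable_of_integral_mul_cutoff_le {f : ℝ → ℝ} (hf : LocallyIntegrable f)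
    (hf0 : ∀ᵐ x, 0 ≤ f x) {I : ℝ}
    (hI : ∀ c : ℝ, 0 < c → c ≤ 1 → ∫ x, f x * cutoff (c * x) ≤ I) : Integrable f := by
  refine integrable_of_intervalIntegral_norm_bounded (ι := ℝ) (l := atTop) I
    (a := fun i => -i) (b := fun i => i) (fun i => ?_) tendsto_neg_atTop_atBot tendsto_id ?_
  · exact (hf.integrableOn_isCompact isCompact_Icc).mono_set Ioc_subset_Icc_self
  · filter_upwards [eventually_ge_atTop 1] with i hi
    have hi0 : 0 < i := by linarith
    have hc : 0 < i⁻¹ := inv_pos.2 hi0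
    refine le_trans ?_ (hI i⁻¹ hc (inv_le_one_of_one_le₀ hi))
    rw [intervalIntegral.integral_of_le (by linarith), ← integral_indicator measurableSet_Ioc]
    have hint : Integrable fun x => f x * cutoff (i⁻¹ * x) := by
      simpa [mul_comm] using hf.integrable_smul_left_of_hasCompactSupport
        (contDiff_comp_mul contDiff_cutoff i⁻¹).continuous
        (hasCompactSupport_comp_mul hasCompactSupport_cutoff hc.ne')
    refine integral_mono_of_nonneg (Eventually.of_forall fun x => indicator_nonneg
      (fun _ _ => norm_nonneg _) x) hint ?_
    filter_upwards [hf0] with x hx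
    by_cases hm : x ∈ Ioc (-i) i
    · rw [indicator_of_mem hm, cutoff_eq_one, mul_one, Real.norm_eq_abs, abs_of_nonneg hx]
      rw [abs_mul, abs_of_pos hc, inv_mul_le_iff₀ hi0, mul_one]
      exact _root_.abs_le.2 ⟨hm.1.le, hm.2⟩
    · rw [indicator_of_notMem hm]
      exact mul_nonneg hx (cutoff_nonneg _)

namespace SobolevH2

theorem locallyIntegrable_fn (v : SobolevH2) : LocallyIntegrable (fn v) :=
  (memLp_fn v).locallyIntegrable (by norm_num)

/-- Testing m = u - uₓₓ against χ(cx) bounds ∫ u χ(cx) by ∫ m + c² ∫ u χ''(cx). By Cauchy–Schwarz on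
the support, the last term is at most C c² √(4/c) ‖u‖ ≤ 2C ‖u‖ for c ≤ 1. -/
theorem integrable_fn {v : SobolevH2} (hm : ∀ᵐ x, 0 ≤ momentum v x)
    (hi : Integrable (momentum v)) : Integrable (fn v) := by
  have h2 : ContDiff ℝ ∞ (deriv (deriv cutoff)) :=
    (contDiff_infty_iff_deriv.1 (contDiff_infty_iff_deriv.1 contDiff_cutoff).2).2
  obtain ⟨C, hC⟩ := hasCompactSupport_cutoff.deriv.deriv.exists_bound_of_continuous h2.continuous
  have hC0 : 0 ≤ C := (norm_nonneg _).trans (hC 0)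
  refine integrable_of_integral_mul_cutoff_le (locallyIntegrable_fn v) (fn_nonneg hm)
    (I := (∫ x, momentum v x) + 2 * C * l2norm (fn v)) fun c hc hc1 => ?_
  have hχ := contDiff_comp_mul contDiff_cutoff c
  have hχs := hasCompactSupport_comp_mul hasCompactSupport_cutoff hc.ne'
  have hχ2 := contDiff_comp_mul h2 c
  have hχ2s := hasCompactSupport_comp_mul hasCompactSupport_cutoff.deriv.deriv hc.ne'
  have i1 := integrable_mul_of_hasCompactSupport (fn v) hχ.continuous hχs
  have i2 := integrable_mul_of_hasCompactSupport (fn v) hχ2.continuous hχ2s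
  have key := integral_momentum_mul v hχ hχs
  rw [deriv_deriv_comp_mul] at key
  have e : ∫ x, fn v x * (cutoff (c * x) - c ^ 2 * deriv (deriv cutoff) (c * x))
      = (∫ x, fn v x * cutoff (c * x)) - c ^ 2 * ∫ x, fn v x * deriv (deriv cutoff) (c * x) := by
    rw [← integral_const_mul, ← integral_sub i1 (i2.const_mul _)]
    congr 1
    funext x
    ring
  rw [e] at key
  have b1 : ∫ x, momentum v x * cutoff (c * x) ≤ ∫ x, momentum v x := by
    refine integral_mono_of_nonneg ?_ hi ?_
    · filter_upwards [hm] with x hx using mul_nonneg hx (cutoff_nonneg _)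
    · filter_upwards [hm] with x hx using mul_le_of_le_one_right hx (cutoff_le_one _)
  have b2 : ∫ x, fn v x * deriv (deriv cutoff) (c * x) ≤ C * (√(4 / c) * l2norm (fn v)) := by
    have hvol : volume.real (Icc (-(2 / c)) (2 / c)) = 4 / c := by
      rw [Real.volume_real_Icc_of_le (by
        have : 0 < 2 / c := by positivity
        linarith)]
      ring
    have h3 := setIntegral_abs_le (memLp_fn v) (s := Icc (-(2 / c)) (2 / c)) measurableSet_Icc
      (by simp)
    rw [hvol] at h3
    refine le_trans ?_ (mul_le_mul_of_nonneg_left h3 hC0)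
    rw [← integral_const_mul, ← integral_indicator measurableSet_Icc]
    refine integral_mono i2 ((integrable_indicator_iff measurableSet_Icc).2
      (((locallyIntegrable_fn v).integrableOn_isCompact isCompact_Icc).norm.const_mul C))
      fun x => ?_
    by_cases hx : x ∈ Icc (-(2 / c)) (2 / c)
    · rw [indicator_of_mem hx]
      refine (le_abs_self _).trans ?_
      rw [abs_mul, mul_comm]
      exact mul_le_mul_of_nonneg_right (hC _) (abs_nonneg _)
    · rw [indicator_of_notMem hx]
      have : deriv (deriv cutoff) (c * x) = 0 := by
        refine image_eq_zero_of_notMem_tsupport fun hmem => hx ?_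
        have h4 := tsupport_deriv_subset (tsupport_deriv_subset hmem)
        rw [tsupport_cutoff, Metric.mem_closedBall, Real.dist_0_eq_abs, abs_mul, abs_of_pos hc] at h4
        rw [mem_Icc, ← _root_.abs_le, le_div_iff₀ hc]
        linarith
      simp only [this, mul_zero, le_refl]
  have b3 : c ^ 2 * √(4 / c) ≤ 2 := by
    have h5 : √(4 / c) ≤ 2 / c := by
      rw [Real.sqrt_le_left (by positivity), div_pow]
      rw [div_le_div_iff₀ hc (by positivity)]
      nlinarith
    have h6 : c ^ 2 * (2 / c) = 2 * c := by field_simp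
    have := mul_le_mul_of_nonneg_left h5 (sq_nonneg c)
    linarith
  have b4 := mul_le_mul_of_nonneg_left b2 (sq_nonneg c)
  have b5 := mul_le_mul_of_nonneg_right b3 (mul_nonneg hC0 (l2norm_nonneg (fn v)))
  have b6 : c ^ 2 * (C * (√(4 / c) * l2norm (fn v))) = c ^ 2 * √(4 / c) * (C * l2norm (fn v)) := by
    ring
  linarith

/-- Here the range 0 < b < 3 matters: both coefficients are positive. -/
theorem density_nonneg {b : ℝ} (hb : b ∈ Ioo (0 : ℝ) 3) (v : SobolevH2) (x : ℝ) :
    0 ≤ density b v x := by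
  have h1 := hb.1
  have h2 : 0 < 3 - b := by linarith [hb.2]
  rw [density]
  positivity

/-- The nonlocal part has a positive kernel and may be dropped. The remaining coercivity drives the
virial argument. -/
theorem half_sq_le_bFlux {b : ℝ} (hb : b ∈ Ioo (0 : ℝ) 3) (v : SobolevH2) (x : ℝ) :
    1 / 2 * fn v x ^ 2 ≤ bFlux b v x := by
  rw [bFlux_eq]
  linarith [greenOp_nonneg (density_nonneg hb v) x]

theorem bFlux_nonneg {b : ℝ} (hb : b ∈ Ioo (0 : ℝ) 3) (v : SobolevH2) (x : ℝ) :
    0 ≤ bFlux b v x := le_trans (by positivity) (half_sq_le_bFlux hb v x)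

/-- `G` preserves integrals, so the nonlocal part contributes exactly the integral of its density.
-/
theorem integral_bFlux_le {b : ℝ} (hb : b ∈ Ioo (0 : ℝ) 3) (v : SobolevH2) :
    ∫ x, bFlux b v x ≤ 2 * ‖v‖ ^ 2 := by
  have i1 := (memLp_fn v).integrable_sq
  have i2 := (memLp_dx v).integrable_sq
  have e : ∫ x, bFlux b v x = 1 / 2 * (∫ x, fn v x ^ 2)
      + (b / 2 * (∫ x, fn v x ^ 2) + (3 - b) / 2 * ∫ x, dx v x ^ 2) := by
    simp only [bFlux_eq]
    rw [integral_add (i1.const_mul _) (Integrable.greenOp (integrable_density b v)),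
      integral_greenOp (integrable_density b v)]
    simp only [density]
    rw [integral_add (i1.const_mul _) (i2.const_mul _), integral_const_mul, integral_const_mul,
      integral_const_mul]
  rw [e, ← l2norm_sq (memLp_fn v), ← l2norm_sq (memLp_dx v), l2norm_coe, l2norm_coe]
  have h1 := pow_le_pow_left₀ (norm_nonneg _) (norm_fn_le v) 2
  have h2 := pow_le_pow_left₀ (norm_nonneg _) (norm_dx_le v) 2
  have h3 := hb.1
  have h4 : 0 < 3 - b := by linarith [hb.2]
  nlinarith

end SobolevH2

theorem SobolevH2.abs_integral_bFlux_mul_le {b : ℝ} (hb : b ∈ Ioo (0 : ℝ) 3) (v : SobolevH2)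
    {w : ℝ → ℝ} {D : ℝ} (hD : ∀ x, |w x| ≤ D) :
    |∫ x, bFlux b v x * w x| ≤ D * ∫ x, bFlux b v x := by
  rw [← integral_const_mul, ← Real.norm_eq_abs]
  refine norm_integral_le_of_norm_le ((integrable_bFlux b v).const_mul D)
    (Eventually.of_forall fun x => ?_)
  rw [norm_mul, Real.norm_eq_abs, abs_of_nonneg (bFlux_nonneg hb v x), mul_comm]
  exact mul_le_mul_of_nonneg_right (hD x) (bFlux_nonneg hb v x)

theorem exists_abs_deriv_cutoff_le : ∃ C, 0 ≤ C ∧ ∀ x, |deriv cutoff x| ≤ C := by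
  obtain ⟨C, hC⟩ := hasCompactSupport_cutoff.deriv.exists_bound_of_continuous
    (contDiff_cutoff.continuous_deriv (by simp))
  exact ⟨C, (norm_nonneg _).trans (hC 0), hC⟩

theorem tendsto_integral_mul_cutoff {f : ℝ → ℝ} (hf : Integrable f) :
    Tendsto (fun c => ∫ x, f x * cutoff (c * x)) (𝓝[>] 0) (𝓝 (∫ x, f x)) := by
  refine tendsto_integral_filter_of_dominated_convergence (fun x => |f x|)
    (Eventually.of_forall fun c => ?_) (Eventually.of_forall fun c => ?_) hf.abs
    (Eventually.of_forall fun x => ?_)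
  · exact hf.1.mul (contDiff_comp_mul contDiff_cutoff c).continuous.aestronglyMeasurable
  · refine Eventually.of_forall fun x => ?_
    rw [norm_mul]
    exact mul_le_of_le_one_right (norm_nonneg _) (abs_cutoff_le_one _)
  · have h1 : Tendsto (fun c => f x * cutoff (c * x)) (𝓝 0) (𝓝 (f x * cutoff (0 * x))) := by
      have : Continuous fun c => f x * cutoff (c * x) :=
        continuous_const.mul (contDiff_cutoff.continuous.comp (continuous_mul_const x))
      exact this.tendsto 0
    rw [zero_mul, cutoff_eq_one (by simp), mul_one] at h1
    exact h1.mono_left nhdsWithin_le_nhds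

/-! ### Integrability in time and the virial inequality -/

namespace IsGlobalSolution

open SobolevH2

variable {b : ℝ} {u : ℝ → SobolevH2}

theorem exists_integral_bFlux_le (hu : IsGlobalSolution b u) (hb : b ∈ Ioo (0 : ℝ) 3) (t : ℝ) :
    ∃ A, 0 ≤ A ∧ ∀ τ ∈ Icc 0 t, ∫ x, bFlux b (u τ) x ≤ A := by
  obtain ⟨B, hB⟩ := (isCompact_Icc (a := 0) (b := t)).exists_bound_of_continuousOn
    (hu.continuousOn.mono Icc_subset_Ici_self)
  refine ⟨2 * B ^ 2, by positivity, fun τ hτ => (integral_bFlux_le hb _).trans ?_⟩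
  have := pow_le_pow_left₀ (norm_nonneg _) (hB τ hτ) 2
  linarith

theorem fn_nonneg (hu : IsGlobalSolution b u) (h0 : ∀ᵐ x, 0 ≤ momentum (u 0) x) {t : ℝ}
    (ht : 0 ≤ t) : ∀ᵐ x, 0 ≤ fn (u t) x :=
  SobolevH2.fn_nonneg (hu.momentum_nonneg h0 ht)

/-- Test with χ(cx): for c ≤ 1 its derivative is bounded independently of c, and the total flux is
bounded on [0, t], so the tested masses are bounded uniformly in c. -/
theorem integrable_fn (hu : IsGlobalSolution b u) (hb : b ∈ Ioo (0 : ℝ) 3)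
    (h0 : ∀ᵐ x, 0 ≤ momentum (u 0) x) (hi : Integrable (momentum (u 0))) {t : ℝ} (ht : 0 ≤ t) :
    Integrable (fn (u t)) := by
  obtain ⟨A, hA0, hA⟩ := hu.exists_integral_bFlux_le hb t
  obtain ⟨C, hC0, hC⟩ := exists_abs_deriv_cutoff_le
  have hi0 := SobolevH2.integrable_fn h0 hi
  refine integrable_of_integral_mul_cutoff_le (locallyIntegrable_fn _) (hu.fn_nonneg h0 ht)
    (I := (∫ x, fn (u 0) x) + C * A * |t - 0|) fun c hc hc1 => ?_
  have key := hu.integral_mul_sub (contDiff_comp_mul contDiff_cutoff c)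
    (hasCompactSupport_comp_mul hasCompactSupport_cutoff hc.ne') le_rfl ht
  have h1 : ∫ x, fn (u 0) x * cutoff (c * x) ≤ ∫ x, fn (u 0) x := by
    refine integral_mono_of_nonneg ?_ hi0 ?_
    · filter_upwards [hu.fn_nonneg h0 le_rfl] with x hx using mul_nonneg hx (cutoff_nonneg _)
    · filter_upwards [hu.fn_nonneg h0 le_rfl] with x hx
        using mul_le_of_le_one_right hx (cutoff_le_one _)
  have h2 := intervalIntegral.norm_integral_le_of_norm_le_const (a := 0) (b := t) (C := C * A)
    (f := fun τ => ∫ x, bFlux b (u τ) x * deriv (fun x => cutoff (c * x)) x) fun τ hτ => by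
      rw [uIoc_of_le ht] at hτ
      refine (abs_integral_bFlux_mul_le hb (u τ) (D := C) fun x => ?_).trans
        (mul_le_mul_of_nonneg_left (hA τ ⟨hτ.1.le, hτ.2⟩) hC0)
      rw [deriv_comp_mul, abs_mul, abs_of_pos hc]
      exact (mul_le_of_le_one_left (abs_nonneg _) hc1).trans (hC _)
  rw [← key] at h2
  have := (le_abs_self _).trans h2
  linarith

/-- The virial inequality: a functional `∫ u φ` whose flux is at most `-d` decreases at rate `d`. -/
theorem integral_mul_le_sub (hu : IsGlobalSolution b u) (hb : b ∈ Ioo (0 : ℝ) 3)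
    (h0 : ∀ᵐ x, 0 ≤ momentum (u 0) x) (hi : Integrable (momentum (u 0))) {s t : ℝ} (hs0 : 0 ≤ s)
    (hst : s ≤ t)
    {φ : ℝ → ℝ} (hφ : ContDiff ℝ ∞ φ) (hs : HasCompactSupport (deriv φ)) {D : ℝ}
    (hD : ∀ x, |φ x| ≤ D) {d : ℝ}
    (hd : ∀ τ ∈ Icc s t, ∫ x, bFlux b (u τ) x * deriv φ x ≤ -d) :
    ∫ x, fn (u t) x * φ x ≤ (∫ x, fn (u s) x * φ x) - d * (t - s) := by
  have ht : 0 ≤ t := hs0.trans hst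
  obtain ⟨A, hA0, hA⟩ := hu.exists_integral_bFlux_le hb t
  obtain ⟨C, hC0, hC⟩ := exists_abs_deriv_cutoff_le
  have hD0 : 0 ≤ D := (abs_nonneg _).trans (hD 0)
  have hφ' : Continuous (deriv φ) := hφ.continuous_deriv (by simp)
  obtain ⟨R, hR⟩ := hs.isCompact.isBounded.subset_closedBall 0
  have hlim : ∀ r, 0 ≤ r → Tendsto (fun c => ∫ x, fn (u r) x * (φ x * cutoff (c * x))) (𝓝[>] 0)
      (𝓝 (∫ x, fn (u r) x * φ x)) := by
    intro r hr0
    have := tendsto_integral_mul_cutoff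
      (integrable_mul_bounded (hu.integrable_fn hb h0 hi hr0) hφ.continuous hD)
    simpa only [mul_assoc] using this
  have hlin : Tendsto (fun c : ℝ => (-d + c * (D * C * A)) * (t - s)) (𝓝[>] 0) (𝓝 (-d * (t - s))) := by
    have : Continuous fun c : ℝ => (-d + c * (D * C * A)) * (t - s) := by fun_prop
    have h := this.tendsto 0
    rw [zero_mul, add_zero] at h
    exact h.mono_left nhdsWithin_le_nhds
  have hrhs := (hlim s hs0).add hlin
  rw [show (∫ x, fn (u s) x * φ x) - d * (t - s) = (∫ x, fn (u s) x * φ x) + -d * (t - s) by ring]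
  refine le_of_tendsto_of_tendsto (hlim t ht) hrhs ?_
  -- Since φ need not have compact support, it is multiplied by `cutoff` (c x). Once cR < 1 this
  -- factor is one on the support of φ', so truncation adds only φ times the derivative of the
  -- cutoff, of order c.
  have hsmall : ∀ᶠ c : ℝ in 𝓝[>] 0, c * R < 1 := by
    have : Continuous fun c : ℝ => c * R := by fun_prop
    have h := this.tendsto 0
    rw [zero_mul] at h
    exact (h.mono_left nhdsWithin_le_nhds).eventually (gt_mem_nhds one_pos)
  filter_upwards [hsmall, self_mem_nhdsWithin] with c hcR hc
  have hc : 0 < c := hc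
  have hκ := contDiff_comp_mul contDiff_cutoff c
  have hκs := hasCompactSupport_comp_mul hasCompactSupport_cutoff hc.ne'
  have key := hu.integral_mul_sub (hφ.mul hκ) hκs.mul_left hs0 ht
  have hderiv : ∀ x, deriv (fun x => φ x * cutoff (c * x)) x
      = deriv φ x + φ x * (c * deriv cutoff (c * x)) := by
    intro x
    rw [deriv_fun_mul (hφ.differentiable (by simp) x) (hκ.differentiable (by simp) x),
      deriv_comp_mul]
    congr 1
    by_cases hx : x ∈ tsupport (deriv φ)
    · have h1 := hR hx
      rw [Metric.mem_closedBall, Real.dist_0_eq_abs] at h1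
      rw [cutoff_eq_one, mul_one]
      rw [abs_mul, abs_of_pos hc]
      exact (mul_le_mul_of_nonneg_left h1 hc.le).trans hcR.le
    · rw [image_eq_zero_of_notMem_tsupport hx, zero_mul]
  have hcont : ContinuousOn (fun τ => ∫ x, bFlux b (u τ) x * deriv (fun x => φ x * cutoff (c * x)) x)
      (uIcc s t) := by
    rw [uIcc_of_le hst]
    exact (continuous_integral_bFlux_mul b ((hφ.mul hκ).continuous_deriv (by simp))
      (hκs.mul_left (f := φ)).deriv).comp_continuousOn (hu.continuousOn.mono fun τ hτ => hs0.trans hτ.1)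
  have hbound : ∫ τ in s..t, ∫ x, bFlux b (u τ) x * deriv (fun x => φ x * cutoff (c * x)) x
      ≤ ∫ τ in s..t, (-d + c * (D * C * A)) := by
    refine intervalIntegral.integral_mono_on hst hcont.intervalIntegrable (by simp) fun τ hτ => ?_
    have i1 := integrable_mul_bounded (integrable_bFlux b (u τ)) hφ'
      (hs.exists_bound_of_continuous hφ').choose_spec
    have hw : Continuous fun x => φ x * (c * deriv cutoff (c * x)) :=
      hφ.continuous.mul (((contDiff_cutoff.continuous_deriv (by simp)).comp
        (continuous_const_mul c)).const_mul c)
    have hwb : ∀ x, |φ x * (c * deriv cutoff (c * x))| ≤ c * (D * C) := by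
      intro x
      rw [abs_mul, abs_mul, abs_of_pos hc]
      calc |φ x| * (c * |deriv cutoff (c * x)|) ≤ D * (c * C) := by
            gcongr
            · exact hD x
            · exact hC _
        _ = _ := by ring
    have i2 := integrable_mul_bounded (integrable_bFlux b (u τ)) hw hwb
    simp only [hderiv, mul_add]
    rw [integral_add i1 i2]
    refine add_le_add (hd τ hτ) ?_
    refine (le_abs_self _).trans ((abs_integral_bFlux_mul_le hb (u τ) hwb).trans ?_)
    rw [show c * (D * C * A) = c * (D * C) * A by ring]
    exact mul_le_mul_of_nonneg_left (hA τ ⟨hs0.trans hτ.1, hτ.2⟩) (by positivity)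
  rw [← key, intervalIntegral.integral_const, smul_eq_mul] at hbound
  linarith

theorem integral_fn_le (hu : IsGlobalSolution b u) (hb : b ∈ Ioo (0 : ℝ) 3)
    (h0 : ∀ᵐ x, 0 ≤ momentum (u 0) x) (hi : Integrable (momentum (u 0))) {t : ℝ} (ht : 0 ≤ t) :
    ∫ x, fn (u t) x ≤ ∫ x, fn (u 0) x := by
  have h := hu.integral_mul_le_sub hb h0 hi le_rfl ht (φ := fun _ => 1) contDiff_const
    (by rw [deriv_const']; exact HasCompactSupport.zero) (D := 1) (by simp) (d := 0) (by simp)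
  simpa using h

end IsGlobalSolution

/-! ### Monotonicity of the left mass and the window estimate -/

/-- A smooth nonincreasing step from one to zero. -/
noncomputable def step (x : ℝ) : ℝ := 1 - Real.smoothTransition x

theorem contDiff_step : ContDiff ℝ ∞ step := contDiff_const.sub Real.smoothTransition.contDiff

theorem step_nonneg (x : ℝ) : 0 ≤ step x := sub_nonneg.2 (Real.smoothTransition.le_one x)

theorem step_le_one (x : ℝ) : step x ≤ 1 := sub_le_self _ (Real.smoothTransition.nonneg x)

theorem step_eq_one {x : ℝ} (hx : x ≤ 0) : step x = 1 := by
  rw [step, Real.smoothTransition.zero_of_nonpos hx, sub_zero]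

theorem step_eq_zero {x : ℝ} (hx : 1 ≤ x) : step x = 0 := by
  rw [step, Real.smoothTransition.one_of_one_le hx, sub_self]

theorem antitone_step : Antitone step := fun _ _ h =>
  sub_le_sub_left (Real.smoothTransition.monotone h) 1

theorem hasCompactSupport_deriv_step : HasCompactSupport (deriv step) := by
  refine HasCompactSupport.intro (isCompact_Icc (a := 0) (b := 1)) fun x hx => ?_
  rw [mem_Icc, not_and_or, not_le, not_le] at hx
  rcases hx with hx | hx
  · have : step =ᶠ[𝓝 x] fun _ => 1 := by
      filter_upwards [Iio_mem_nhds hx] with y hy using step_eq_one (le_of_lt hy)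
    rw [this.deriv_eq, deriv_const]
  · have : step =ᶠ[𝓝 x] fun _ => 0 := by
      filter_upwards [Ioi_mem_nhds hx] with y hy using step_eq_zero (le_of_lt hy)
    rw [this.deriv_eq, deriv_const]

/-- A bounded antiderivative of `-cutoff (x / 2)`. -/
noncomputable def ramp (x : ℝ) : ℝ := -∫ y in (0 : ℝ)..x, cutoff (2⁻¹ * y)

theorem hasDerivAt_ramp (x : ℝ) : HasDerivAt ramp (-cutoff (2⁻¹ * x)) x :=
  ((IsPrimitive.of_integral (contDiff_comp_mul contDiff_cutoff 2⁻¹).continuous.locallyIntegrable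
    0).hasDerivAt (contDiff_comp_mul contDiff_cutoff 2⁻¹).continuous x).neg

theorem deriv_ramp : deriv ramp = fun x => -cutoff (2⁻¹ * x) :=
  funext fun x => (hasDerivAt_ramp x).deriv

theorem contDiff_ramp : ContDiff ℝ ∞ ramp := by
  rw [contDiff_infty_iff_deriv, deriv_ramp]
  exact ⟨fun x => (hasDerivAt_ramp x).differentiableAt,
    (contDiff_comp_mul contDiff_cutoff 2⁻¹).neg⟩

theorem hasCompactSupport_deriv_ramp : HasCompactSupport (deriv ramp) := by
  rw [deriv_ramp]
  exact (hasCompactSupport_comp_mul hasCompactSupport_cutoff (by norm_num)).neg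

theorem exists_abs_ramp_le : ∃ D, 0 ≤ D ∧ ∀ x, |ramp x| ≤ D := by
  have hi : Integrable fun y => cutoff (2⁻¹ * y) :=
    (contDiff_comp_mul contDiff_cutoff 2⁻¹).continuous.integrable_of_hasCompactSupport
      (hasCompactSupport_comp_mul hasCompactSupport_cutoff (by norm_num))
  refine ⟨∫ y, ‖cutoff (2⁻¹ * y)‖, integral_nonneg fun _ => norm_nonneg _, fun x => ?_⟩
  rw [ramp, abs_neg]
  refine (intervalIntegral.norm_integral_le_integral_norm_uIoc (μ := volume)
    (f := fun y => cutoff (2⁻¹ * y))).trans ?_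
  exact setIntegral_le_integral hi.norm (Eventually.of_forall fun _ => norm_nonneg _)

namespace IsGlobalSolution

open SobolevH2

variable {b : ℝ} {u : ℝ → SobolevH2}

/-- The mass to the left of a fixed smooth step is nonincreasing in time. -/
theorem integral_mul_step_le (hu : IsGlobalSolution b u) (hb : b ∈ Ioo (0 : ℝ) 3)
    (h0 : ∀ᵐ x, 0 ≤ momentum (u 0) x) (hi : Integrable (momentum (u 0))) {s t : ℝ} (hs0 : 0 ≤ s)
    (hst : s ≤ t) {c : ℝ} (hc : 0 < c) (a : ℝ) :
    ∫ x, fn (u t) x * step (c * x - a) ≤ ∫ x, fn (u s) x * step (c * x - a) := by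
  have hsmooth : ContDiff ℝ ∞ fun y => step (y - a) :=
    contDiff_step.comp (contDiff_id.sub contDiff_const)
  have hsupp : HasCompactSupport (deriv fun y => step (y - a)) := by
    have : (deriv fun y => step (y - a)) = fun y => deriv step (y - a) := by
      funext y
      exact deriv_comp_sub_const step a y
    rw [this]
    exact hasCompactSupport_deriv_step.comp_homeomorph (Homeomorph.subRight a)
  have hanti : Antitone fun x => step (c * x - a) := fun x y hxy =>
    antitone_step (sub_le_sub_right (mul_le_mul_of_nonneg_left hxy hc.le) a)
  have h := hu.integral_mul_le_sub hb h0 hi hs0 hst (φ := fun x => step (c * x - a))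
    (contDiff_comp_mul hsmooth c)
    (by
      rw [deriv_comp_mul (fun y => step (y - a)) c]
      exact (hasCompactSupport_comp_mul hsupp hc.ne').mul_left)
    (D := 1)
    (fun x => by
      rw [abs_of_nonneg (step_nonneg _)]
      exact step_le_one _)
    (d := 0)
    (fun τ _ => by
      rw [neg_zero]
      exact integral_nonpos fun x =>
        mul_nonpos_of_nonneg_of_nonpos (bFlux_nonneg hb _ x) hanti.deriv_nonpos)
  simpa using h

/-- The mass in a window at time `T` is controlled by the initial mass to its left and by
`λ / √T`. -/
theorem exists_setIntegral_fn_le (hu : IsGlobalSolution b u) (hb : b ∈ Ioo (0 : ℝ) 3)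
    (h0 : ∀ᵐ x, 0 ≤ momentum (u 0) x) (hi : Integrable (momentum (u 0))) :
    ∃ A : ℝ, ∀ T r : ℝ, 0 < T → 0 < r → ∫ x in Icc (-r) r, fn (u T) x
      ≤ (∫ x in Iic (-r), fn (u 0) x) + A * (r / √T) := by
  obtain ⟨D, hD0, hD⟩ := exists_abs_ramp_le
  set M := ∫ x, fn (u 0) x with hM
  have hM0 : 0 ≤ M := integral_nonneg_of_ae (hu.fn_nonneg h0 le_rfl)
  -- The virial functional stays within [-DM, DM] and loses (μ - e)²T/(8r²) over [0, T], whence (μ -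
  -- e)² ≤ 16DM r²/T.
  refine ⟨√(16 * D * M), fun T r hT hr => ?_⟩
  have hint : ∀ {t}, 0 ≤ t → Integrable (fn (u t)) := fun ht => hu.integrable_fn hb h0 hi ht
  have hpos : ∀ {t}, 0 ≤ t → ∀ᵐ x, 0 ≤ fn (u t) x := fun ht => hu.fn_nonneg h0 ht
  set c := r⁻¹ with hcdef
  have hc : 0 < c := inv_pos.2 hr
  have hcr : c * r = 1 := inv_mul_cancel₀ hr.ne'
  have hstep : ∀ (t a : ℝ), 0 ≤ t → Integrable fun x => fn (u t) x * step (c * x - a) :=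
    fun t a ht => integrable_mul_bounded (hint ht)
      (contDiff_step.continuous.comp (by fun_prop)) (D := 1) fun x => by
        rw [abs_of_nonneg (step_nonneg _)]
        exact step_le_one _
  set μ := ∫ x in Icc (-r) r, fn (u T) x with hμ
  set e := ∫ x in Iic (-r), fn (u 0) x with he
  -- The step x ↦ `step` (c x + 2) is one left of -2r and zero right of -r; the mass it sees does
  -- not grow.
  have hleft : ∀ t, 0 ≤ t → ∫ x in Iio (-(2 * r)), fn (u t) x ≤ e := by
    intro t ht
    have h1 : ∫ x in Iio (-(2 * r)), fn (u t) x ≤ ∫ x, fn (u t) x * step (c * x - -2) := by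
      rw [← integral_indicator measurableSet_Iio]
      refine integral_mono_ae ((integrable_indicator_iff measurableSet_Iio).2
        (hint ht).integrableOn) (hstep t _ ht) ?_
      filter_upwards [hpos ht] with x hx
      by_cases hm : x ∈ Iio (-(2 * r))
      · rw [indicator_of_mem hm, step_eq_one, mul_one]
        have := mul_le_mul_of_nonneg_left (le_of_lt hm) hc.le
        linarith
      · rw [indicator_of_notMem hm]
        exact mul_nonneg hx (step_nonneg _)
    have h2 : ∫ x, fn (u 0) x * step (c * x - -2) ≤ e := by
      rw [he, ← integral_indicator measurableSet_Iic]
      refine integral_mono_ae (hstep 0 _ le_rfl) ((integrable_indicator_iff measurableSet_Iic).2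
        (hint le_rfl).integrableOn) ?_
      filter_upwards [hpos le_rfl] with x hx
      by_cases hm : x ∈ Iic (-r)
      · rw [indicator_of_mem hm]
        exact mul_le_of_le_one_right hx (step_le_one _)
      · rw [indicator_of_notMem hm, step_eq_zero, mul_zero]
        rw [mem_Iic, not_le] at hm
        have := mul_le_mul_of_nonneg_left hm.le hc.le
        linarith
    exact h1.trans ((hu.integral_mul_step_le hb h0 hi le_rfl ht hc _).trans h2)
  -- The step x ↦ `step` (c x - 1) is one left of r and zero right of 2r. So the mass left of 2r at
  -- time t is at least μ, and `hleft` removes at most e.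
  have hwindow : ∀ t ∈ Icc 0 T, μ - e ≤ ∫ x in Icc (-(2 * r)) (2 * r), fn (u t) x := by
    intro t ht
    have h1 : μ ≤ ∫ x, fn (u T) x * step (c * x - 1) := by
      rw [hμ, ← integral_indicator measurableSet_Icc]
      refine integral_mono_ae ((integrable_indicator_iff measurableSet_Icc).2
        (hint hT.le).integrableOn) (hstep T _ hT.le) ?_
      filter_upwards [hpos hT.le] with x hx
      by_cases hm : x ∈ Icc (-r) r
      · rw [indicator_of_mem hm, step_eq_one, mul_one]
        have := mul_le_mul_of_nonneg_left hm.2 hc.le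
        linarith
      · rw [indicator_of_notMem hm]
        exact mul_nonneg hx (step_nonneg _)
    have h2 : ∫ x, fn (u t) x * step (c * x - 1) ≤ ∫ x in Iic (2 * r), fn (u t) x := by
      rw [← integral_indicator measurableSet_Iic]
      refine integral_mono_ae (hstep t _ ht.1) ((integrable_indicator_iff measurableSet_Iic).2
        (hint ht.1).integrableOn) ?_
      filter_upwards [hpos ht.1] with x hx
      by_cases hm : x ∈ Iic (2 * r)
      · rw [indicator_of_mem hm]
        exact mul_le_of_le_one_right hx (step_le_one _)
      · rw [indicator_of_notMem hm, step_eq_zero, mul_zero]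
        rw [mem_Iic, not_le] at hm
        have := mul_le_mul_of_nonneg_left hm.le hc.le
        linarith
    have h3 : ∫ x in Iic (2 * r), fn (u t) x = (∫ x in Iio (-(2 * r)), fn (u t) x)
        + ∫ x in Icc (-(2 * r)) (2 * r), fn (u t) x := by
      rw [← Iio_union_Icc_eq_Iic (a := -(2 * r)) (b := 2 * r) (by linarith),
        setIntegral_union _ measurableSet_Icc (hint ht.1).integrableOn (hint ht.1).integrableOn]
      rw [Set.disjoint_left]
      intro x hx hx'
      exact absurd hx'.1 (not_le.2 hx)
    have h4 := hu.integral_mul_step_le hb h0 hi ht.1 ht.2 hc 1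
    linarith [hleft t ht.1]
  -- If μ ≤ e the claim is trivial; otherwise the lower bound μ - e is positive and may be squared.
  rcases le_or_gt μ e with hle | hlt
  · have : 0 ≤ √(16 * D * M) * (r / √T) := by positivity
    linarith
  -- The slope of the dilated ramp is -1/r on all of [-2r, 2r]. There F ≥ u²/2, and Cauchy–Schwarz
  -- on this interval of length 4r bounds ∫ u² below by (μ - e)²/(4r).
  have hdiss : ∀ t ∈ Icc 0 T,
      ∫ x, bFlux b (u t) x * deriv (fun x => ramp (c * x)) x ≤ -((μ - e) ^ 2 / (8 * r ^ 2)) := by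
    intro t ht
    let S : Set ℝ := Icc (-(2 * r)) (2 * r)
    have hS : MeasurableSet S := measurableSet_Icc
    have hvol : volume.real S = 4 * r := by
      rw [Real.volume_real_Icc_of_le (by linarith)]
      ring
    let f : ℝ → ℝ := S.indicator (fn (u t))
    have hf : MemLp f 2 := (memLp_fn (u t)).indicator hS
    have h1 := setIntegral_abs_le hf hS (by simp [S])
    rw [hvol] at h1
    have h2 : ∫ x in S, |f x| = ∫ x in S, fn (u t) x := by
      refine setIntegral_congr_ae hS ?_
      filter_upwards [hpos ht.1] with x hx hxS
      rw [show f x = fn (u t) x from indicator_of_mem hxS _, abs_of_nonneg hx]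
    rw [h2] at h1
    have h3 := (hwindow t ht).trans h1
    have h4 : (μ - e) ^ 2 ≤ 4 * r * ∫ x, f x ^ 2 := by
      rw [← l2norm_sq hf]
      refine (pow_le_pow_left₀ (by linarith) h3 2).trans (le_of_eq ?_)
      rw [mul_pow, Real.sq_sqrt (by positivity)]
    have i1 : Integrable fun x => bFlux b (u t) x * cutoff (2⁻¹ * (c * x)) :=
      integrable_mul_bounded (integrable_bFlux b (u t)) (contDiff_cutoff.continuous.comp
        (by fun_prop)) (D := 1) fun x => abs_cutoff_le_one _
    have h5 : 1 / 2 * ∫ x, f x ^ 2 ≤ ∫ x, bFlux b (u t) x * cutoff (2⁻¹ * (c * x)) := by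
      rw [← integral_const_mul]
      refine integral_mono (hf.integrable_sq.const_mul _) i1 fun x => ?_
      by_cases hx : x ∈ S
      · have hx2 : cutoff (2⁻¹ * (c * x)) = 1 := by
          refine cutoff_eq_one ?_
          have h7 := mul_le_mul_of_nonneg_left (_root_.abs_le.2 hx) hc.le
          rw [abs_mul, abs_mul, abs_of_pos hc, abs_of_pos (by norm_num : (0 : ℝ) < 2⁻¹)]
          linarith
        have hfx : f x = fn (u t) x := indicator_of_mem hx _
        simp only [hx2, mul_one, hfx]
        exact half_sq_le_bFlux hb (u t) x
      · have hfx : f x = 0 := indicator_of_notMem hx _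
        simp only [hfx]
        have := mul_nonneg (bFlux_nonneg hb (u t) x) (cutoff_nonneg (2⁻¹ * (c * x)))
        linarith
    have h6 : ∫ x, bFlux b (u t) x * deriv (fun x => ramp (c * x)) x
        = -(c * ∫ x, bFlux b (u t) x * cutoff (2⁻¹ * (c * x))) := by
      rw [deriv_comp_mul, deriv_ramp, ← integral_const_mul, ← integral_neg]
      congr 1
      funext x
      ring
    rw [h6, neg_le_neg_iff]
    have h8 := mul_le_mul_of_nonneg_left h5 hc.le
    refine le_trans ?_ h8
    have h9 : c * (1 / 2 * ∫ x, f x ^ 2) = (4 * r * ∫ x, f x ^ 2) / (8 * r ^ 2) := by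
      rw [hcdef]
      field_simp
      ring
    rw [h9]
    gcongr
  have hvir := hu.integral_mul_le_sub hb h0 hi le_rfl hT.le
    (contDiff_comp_mul contDiff_ramp c)
    (by
      rw [deriv_comp_mul]
      exact (hasCompactSupport_comp_mul hasCompactSupport_deriv_ramp hc.ne').mul_left)
    (fun x => hD (c * x)) hdiss
  have hramp : ∀ t, 0 ≤ t → |∫ x, fn (u t) x * ramp (c * x)| ≤ D * M := by
    intro t ht
    refine le_trans ?_ (mul_le_mul_of_nonneg_left (hu.integral_fn_le hb h0 hi ht) hD0)
    rw [← integral_const_mul, ← Real.norm_eq_abs]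
    refine norm_integral_le_of_norm_le ((hint ht).const_mul D) ?_
    filter_upwards [hpos ht] with x hx
    rw [norm_mul, Real.norm_eq_abs, Real.norm_eq_abs, abs_of_nonneg hx, mul_comm]
    exact mul_le_mul_of_nonneg_right (hD _) hx
  have k1 := (_root_.abs_le.1 (hramp T hT.le)).1
  have k2 := (_root_.abs_le.1 (hramp 0 le_rfl)).2
  have k3 : (μ - e) ^ 2 / (8 * r ^ 2) * T ≤ 2 * (D * M) := by
    rw [sub_zero] at hvir
    linarith
  have k4 : (μ - e) ^ 2 ≤ (√(16 * D * M) * (r / √T)) ^ 2 := by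
    rw [mul_pow, div_pow, Real.sq_sqrt (by positivity), Real.sq_sqrt hT.le]
    rw [div_mul_eq_mul_div, div_le_iff₀ (by positivity)] at k3
    rw [mul_div_assoc', le_div_iff₀ hT]
    linarith
  have k5 := abs_le_of_sq_le_sq k4 (by positivity)
  linarith [(_root_.abs_le.1 k5).2]

/-- Both the mass of `u` and the mass of `m` in a window are controlled by the mass of `u` in a
wider window. -/
theorem exists_setIntegral_momentum_le (hu : IsGlobalSolution b u)
    (h0 : ∀ᵐ x, 0 ≤ momentum (u 0) x) :
    ∃ C : ℝ, 0 ≤ C ∧ ∀ t r : ℝ, 0 ≤ t → 1 ≤ r → ∫ x in Ioo (-r) r, momentum (u t) x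
      ≤ C * ∫ x in Icc (-(2 * r)) (2 * r), fn (u t) x := by
  have h2 : ContDiff ℝ ∞ (deriv (deriv cutoff)) :=
    (contDiff_infty_iff_deriv.1 (contDiff_infty_iff_deriv.1 contDiff_cutoff).2).2
  obtain ⟨C, hC⟩ := hasCompactSupport_cutoff.deriv.deriv.exists_bound_of_continuous h2.continuous
  have hC0 : 0 ≤ C := (norm_nonneg _).trans (hC 0)
  refine ⟨1 + C, by positivity, fun t r ht hr1 => ?_⟩
  have hr : 0 < r := by linarith
  set c := r⁻¹ with hcdef
  have hc : 0 < c := inv_pos.2 hr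
  have hc1 : c ≤ 1 := inv_le_one_of_one_le₀ hr1
  have hcr : c * r = 1 := inv_mul_cancel₀ hr.ne'
  have hχ := contDiff_comp_mul contDiff_cutoff c
  have hχs := hasCompactSupport_comp_mul hasCompactSupport_cutoff hc.ne'
  have hχ2 := contDiff_comp_mul h2 c
  have hχ2s := hasCompactSupport_comp_mul hasCompactSupport_cutoff.deriv.deriv hc.ne'
  have hout : ∀ x, x ∉ Icc (-(2 * r)) (2 * r) → c * x ∉ tsupport cutoff := by
    intro x hx hmem
    rw [tsupport_cutoff, Metric.mem_closedBall, Real.dist_0_eq_abs, abs_mul, abs_of_pos hc] at hmem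
    refine hx (_root_.abs_le.1 ?_)
    have := mul_le_mul_of_nonneg_right hmem hr.le
    calc |x| = c * |x| * r := by rw [mul_right_comm, hcr, one_mul]
      _ ≤ 2 * r := this
  have hm := hu.momentum_nonneg h0 ht
  have i1 := integrable_mul_of_hasCompactSupport (momentum (u t)) hχ.continuous hχs
  have a1 : ∫ x in Ioo (-r) r, momentum (u t) x ≤ ∫ x, momentum (u t) x * cutoff (c * x) := by
    rw [← integral_indicator measurableSet_Ioo]
    refine integral_mono_of_nonneg ?_ i1 ?_
    · filter_upwards [hm] with x hx using indicator_apply_nonneg fun _ => hx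
    · filter_upwards [hm] with x hx
      by_cases hxm : x ∈ Ioo (-r) r
      · rw [indicator_of_mem hxm, cutoff_eq_one, mul_one]
        have h3 := mul_le_mul_of_nonneg_left (abs_lt.2 hxm).le hc.le
        rw [abs_mul, abs_of_pos hc]
        linarith
      · rw [indicator_of_notMem hxm]
        exact mul_nonneg hx (cutoff_nonneg _)
  refine a1.trans ?_
  -- Both derivatives fall on the cutoff. As c ≤ 1, the weight χ(cx) - c²χ''(cx) is at most 1 + C,
  -- and it vanishes outside [-2r, 2r].
  rw [integral_momentum_mul (u t) hχ hχs, deriv_deriv_comp_mul, ← integral_const_mul,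
    ← integral_indicator measurableSet_Icc]
  have i2 : Integrable fun x => fn (u t) x * (cutoff (c * x)
      - c ^ 2 * deriv (deriv cutoff) (c * x)) :=
    integrable_mul_of_hasCompactSupport _ (hχ.continuous.sub (hχ2.continuous.const_mul _))
      (hχs.sub hχ2s.mul_left)
  refine integral_mono_ae i2 ((integrable_indicator_iff measurableSet_Icc).2
    (((locallyIntegrable_fn _).integrableOn_isCompact isCompact_Icc).const_mul _)) ?_
  filter_upwards [hu.fn_nonneg h0 ht] with x hx
  by_cases hxm : x ∈ Icc (-(2 * r)) (2 * r)
  · rw [indicator_of_mem hxm, mul_comm]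
    refine mul_le_mul_of_nonneg_right ?_ hx
    have h4 : |c ^ 2 * deriv (deriv cutoff) (c * x)| ≤ C := by
      rw [abs_mul, abs_of_pos (by positivity : 0 < c ^ 2)]
      exact (mul_le_of_le_one_left (abs_nonneg _) (pow_le_one₀ hc.le hc1)).trans (hC _)
    linarith [cutoff_le_one (c * x), (_root_.abs_le.1 h4).1]
  · rw [indicator_of_notMem hxm, image_eq_zero_of_notMem_tsupport (hout x hxm),
      image_eq_zero_of_notMem_tsupport fun h =>
        hout x hxm (tsupport_deriv_subset (tsupport_deriv_subset h))]
    simp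

end IsGlobalSolution

/-! ### Conclusion -/

theorem tendsto_setIntegral_Iic_neg {f : ℝ → ℝ} (hf : Integrable f) {r : ℝ → ℝ}
    (hr : Tendsto r atTop atTop) : Tendsto (fun t => ∫ x in Iic (-r t), f x) atTop (𝓝 0) := by
  have h : Tendsto (fun a => ∫ x in Iic a, f x) atBot (𝓝 0) := by
    have h1 : ∀ a, ∫ x in Iic a, f x = (∫ x, f x) - ∫ x in Ioi a, f x := fun a => by
      rw [← integral_add_compl (measurableSet_Iic (a := a)) hf, compl_Iic]
      ring
    have h2 : Tendsto (fun a => ∫ x in Ioi a, f x) atBot (𝓝 (∫ x, f x)) :=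
      (aecover_Ioi (μ := volume) tendsto_id).integral_tendsto_of_countably_generated hf
    simp only [h1]
    simpa using h2.const_sub (∫ x, f x)
  exact h.comp (tendsto_neg_atTop_atBot.comp hr)

theorem theorem1p4 (b : ℝ) (hb : b ∈ Set.Ioo (0 : ℝ) 3) (u : ℝ → SobolevH2)
    (hu : IsGlobalSolution b u)
    (hm_nonneg : ∀ᵐ x : ℝ, 0 ≤ SobolevH2.momentum (u 0) x)
    (hm_int : Integrable (fun x : ℝ => SobolevH2.momentum (u 0) x)) :
    ∃ L : ℝ,
      Tendsto (fun t : ℝ => L1NormOn (Lam (1 / 2) t) (fun x => SobolevH2.momentum (u t) x)) atTop (𝓝 L) ∧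
      Tendsto (fun t : ℝ => L1NormOn (Lam (1 / 2) t) (fun x => SobolevH2.fn (u t) x)) atTop (𝓝 L) := by
  obtain ⟨A, hA⟩ := hu.exists_setIntegral_fn_le hb hm_nonneg hm_int
  obtain ⟨C, hC0, hC⟩ := hu.exists_setIntegral_momentum_le hm_nonneg
  let r : ℝ → ℝ := fun t => |t| ^ (1 / 2 : ℝ) / Real.log |t|
  have hrT : ∀ᶠ t in atTop, r t = √t / Real.log t := by
    filter_upwards [eventually_gt_atTop 0] with t ht
    simp only [r]
    rw [abs_of_pos ht, Real.sqrt_eq_rpow]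
  have hr : Tendsto r atTop atTop := by
    have h1 : Tendsto (fun t : ℝ => Real.log t / t ^ (1 / 2 : ℝ)) atTop (𝓝[>] 0) := by
      refine tendsto_nhdsWithin_iff.2
        ⟨(isLittleO_log_rpow_atTop (by norm_num)).tendsto_div_nhds_zero, ?_⟩
      filter_upwards [eventually_gt_atTop 1] with t ht
      exact div_pos (Real.log_pos ht) (Real.rpow_pos_of_pos (by linarith) _)
    refine h1.inv_tendsto_nhdsGT_zero.congr' ?_
    filter_upwards [hrT] with t ht
    rw [ht, Pi.inv_apply, inv_div, Real.sqrt_eq_rpow]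
  have hrs : Tendsto (fun t => r t / √t) atTop (𝓝 0) := by
    refine (Real.tendsto_log_atTop.inv_tendsto_atTop).congr' ?_
    filter_upwards [hrT, eventually_gt_atTop 0] with t ht ht0
    rw [ht, Pi.inv_apply, div_right_comm, div_self (Real.sqrt_pos.2 ht0).ne', one_div]
  have hr2 : Tendsto (fun t => 2 * r t) atTop atTop := hr.const_mul_atTop two_pos
  -- The window estimate at half-width 2r(t): a tail of the integrable u(0), plus 2A r(t)/√t, which
  -- is eventually 2A/log t.
  have hwide : Tendsto (fun t => ∫ x in Icc (-(2 * r t)) (2 * r t), SobolevH2.fn (u t) x)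
      atTop (𝓝 0) := by
    have hup : Tendsto (fun t => (∫ x in Iic (-(2 * r t)), SobolevH2.fn (u 0) x)
        + A * (2 * r t / √t)) atTop (𝓝 0) := by
      have h1 := tendsto_setIntegral_Iic_neg
        (hu.integrable_fn hb hm_nonneg hm_int le_rfl) hr2
      have h2 : Tendsto (fun t => A * (2 * r t / √t)) atTop (𝓝 0) := by
        have := hrs.const_mul (A * 2)
        rw [mul_zero] at this
        refine this.congr fun t => ?_
        ring
      simpa using h1.add h2
    refine squeeze_zero' ?_ ?_ hup
    · filter_upwards [eventually_ge_atTop 0] with t ht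
      exact setIntegral_nonneg_of_ae (hu.fn_nonneg hm_nonneg ht)
    · filter_upwards [eventually_gt_atTop 0, hr2.eventually_gt_atTop 0] with t ht hrt
      exact hA t _ ht hrt
  -- Mass of m in (-r, r) is at most C times that of u in [-2r, 2r], and u is nonnegative, so both
  -- norms are squeezed by `hwide`.
  refine ⟨0, ?_, ?_⟩
  · have hup := hwide.const_mul C
    rw [mul_zero] at hup
    refine squeeze_zero' (Eventually.of_forall fun t => ?_) ?_ hup
    · exact integral_nonneg fun _ => abs_nonneg _
    · filter_upwards [eventually_ge_atTop 0, hr.eventually_ge_atTop 1] with t ht hrt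
      refine le_trans (le_of_eq ?_) (hC t (r t) ht hrt)
      refine setIntegral_congr_ae measurableSet_Ioo ?_
      filter_upwards [hu.momentum_nonneg hm_nonneg ht] with x hx _ using abs_of_nonneg hx
  · refine squeeze_zero' (Eventually.of_forall fun t => ?_) ?_ hwide
    · exact integral_nonneg fun _ => abs_nonneg _
    · filter_upwards [eventually_ge_atTop 0, hr.eventually_ge_atTop 1] with t ht hrt
      have h1 : L1NormOn (Lam (1 / 2) t) (fun x => SobolevH2.fn (u t) x)
          = ∫ x in Ioo (-r t) (r t), SobolevH2.fn (u t) x := by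
        refine setIntegral_congr_ae measurableSet_Ioo ?_
        filter_upwards [hu.fn_nonneg hm_nonneg ht] with x hx _ using abs_of_nonneg hx
      rw [h1]
      refine setIntegral_mono_set (hu.integrable_fn hb hm_nonneg hm_int ht).integrableOn
        (ae_restrict_of_ae (hu.fn_nonneg hm_nonneg ht)) ?_
      refine LE.le.eventuallyLE fun x hx => ⟨?_, ?_⟩
      · linarith [hx.1]
      · linarith [hx.2]
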